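/- Let $a,b\in\mathbb{Q}$. Brumer's quintic polynomial is $$B(a,b;X)=X^5+(a-3)X^4-(a-b-3)X^3+(a^2-a-2b-1)X^2+bX+a .$$ Put $$d=-4b^3+(a^2-30a+1)b^2+2a(3a+1)(4a-7)b-a(4a^4-4a^3-40a^2+91a-4)$$ and assume $a\neq 0$ and $d\neq 0$. Consider the elliptic curves over $\mathbb{Q}$ $$E_{a,b}:\ y^2=x^3+d(a^2-30a+1)x^2-8d^2a(3a+1)(4a-7)x-16d^3a(4a^4-4a^3-40a^2+91a-4),$$ $$E^*_{a,b}:\ y^2=x^3+d(a^2-30a+1)x^2-8d^2(26a^4-310a^3+327a^2+315a+26)x+16d^3(68a^6-1120a^5+3804a^4+1760a^3+6929a^2+1380a+68).$$ There is an isogeny $\phi:E_{a,b}\to E^*_{a,b}$ of degree $5$ over $\mathbb{Q}$ whose dual isogeny $\phi^*:E^*_{a,b}\to E_{a,b}$ (a homomorphism over $\mathbb{Q}$, with kernel of order $5$ over $\overline{\mathbb{Q}}$, such that $\phi^*\circ\phi=[5]$ and $\phi\circ\phi^*=[5]$) is given by $$\phi^*(x,y)=\Bigl(4d\,(\lambda(X)+2a),\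 \tfrac{y}{125}\,\lambda'(X)\Bigr),\qquad X=\frac{x}{100d}-\frac{2(a^2-5a+1)}{25},$$ $$\lambda(X)=\frac{X^5-2aX^4+a(a^2+3a-1)X^3-3a^2(a-1)X^2+a^3(a-3)X+a^4}{X^2(X-a)^2},$$ the kernel consisting of the point at infinity $O$ and the points with $X\in\{0,a\}$. For $P=(x(P),y(P))\in E_{a,b}(\mathbb{Q})$, $P\neq O$, put $B(P;X)=B\bigl(a,\tfrac{x(P)}{-4d};X\bigr)$. Splitting fields over $\mathbb{Q}$ are taken inside a fixed algebraic closure $\overline{\mathbb{Q}}$. Then the group $E_{a,b}(\mathbb{Q})/\phi^*(E^*_{a,b}(\mathbb{Q}))$ is finite, and: 1. For every $P\in E_{a,b}(\mathbb{Q})$ with $P\neq O$, the polynomial $B(P;X)$ is reducible over $\mathbb{Q}$ if and only if $P\in\phi^*(E^*_{a,b}(\mathbb{Q}))$. 2. For every $P\in E_{a,b}(\mathbb{Q})\setminus\phi^*(E^*_{a,b}(\mathbb{Q}))$ the class of $P$ generates a subgroup of order $5$ of $E_{a,b}(\mathbb{Q})/\phi^*(E^*_{a,b}(\mathbb{Q}))$,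 and there is a bijection from the set of subgroups of order $5$ of $E_{a,b}(\mathbb{Q})/\phi^*(E^*_{a,b}(\mathbb{Q}))$ onto the set of splitting fields over $\mathbb{Q}$ of the polynomials $B(P;X)$ with $P\in E_{a,b}(\mathbb{Q})\setminus\phi^*(E^*_{a,b}(\mathbb{Q}))$, which sends, for every such $P$, the subgroup generated by the class of $P$ to the splitting field of $B(P;X)$. -/

import Mathlib

open Polynomial

namespace Brumer

/-- Brumer's quintic polynomial `B(a, b; X)`. -/
noncomputable def quintic (a b : ℚ) : ℚ[X] :=
  X ^ 5 + C (a - 3) * X ^ 4 - C (a - b - 3) * X ^ 3 + C (a ^ 2 - a - 2 * b - 1) * X ^ 2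
    + C b * X + C a

/-- The quantity `d(a, b)`; the discriminant of `B(a, b; X)` is `a ^ 2 * d(a, b) ^ 2`. -/
def d (a b : ℚ) : ℚ :=
  -4 * b ^ 3 + (a ^ 2 - 30 * a + 1) * b ^ 2 + 2 * a * (3 * a + 1) * (4 * a - 7) * b
    - a * (4 * a ^ 4 - 4 * a ^ 3 - 40 * a ^ 2 + 91 * a - 4)

/-- The curve `E_{a,b}`. -/
def E (a b : ℚ) : WeierstrassCurve ℚ where
  a₁ := 0
  a₂ := d a b * (a ^ 2 - 30 * a + 1)
  a₃ := 0
  a₄ := -8 * d a b ^ 2 * a * (3 * a + 1) * (4 * a - 7)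
  a₆ := -16 * d a b ^ 3 * a * (4 * a ^ 4 - 4 * a ^ 3 - 40 * a ^ 2 + 91 * a - 4)

/-- The curve `E*_{a,b}`, the image of the 5-isogeny `φ` on `E_{a,b}`. -/
def Estar (a b : ℚ) : WeierstrassCurve ℚ where
  a₁ := 0
  a₂ := (a ^ 2 - 30 * a + 1) * d a b
  a₃ := 0
  a₄ := -8 * (26 * a ^ 4 - 310 * a ^ 3 + 327 * a ^ 2 + 315 * a + 26) * d a b ^ 2
  a₆ := 16 * (68 * a ^ 6 - 1120 * a ^ 5 + 3804 * a ^ 4 + 1760 * a ^ 3 + 6929 * a ^ 2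
    + 1380 * a + 68) * d a b ^ 3

/-- The group `E_{a,b}(K)` for a field extension `K` of `ℚ`. -/
abbrev EPoint (a b : ℚ) (K : Type*) [Field K] [Algebra ℚ K] : Type _ :=
  ((E a b).baseChange K).toAffine.Point

/-- The group `E*_{a,b}(K)` for a field extension `K` of `ℚ`. -/
abbrev EstarPoint (a b : ℚ) (K : Type*) [Field K] [Algebra ℚ K] : Type _ :=
  ((Estar a b).baseChange K).toAffine.Point

section Isogeny

variable {K : Type*} [Field K]

/-- The numerator of the `X`-coordinate `N(X) / (X ^ 2 * (X - a) ^ 2)` of the quotient map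
`λ* : E*_a → E_a` of the curve `E*_a : Y² - (a-1)XY - aY = X³ - aX²` by the subgroup of order 5
generated by the point `(0, 0)`. -/
def lambdaNum (a X : K) : K :=
  X ^ 5 - 2 * a * X ^ 4 + a * (a ^ 2 + 3 * a - 1) * X ^ 3 - 3 * a ^ 2 * (a - 1) * X ^ 2
    + a ^ 3 * (a - 3) * X + a ^ 4

/-- The derivative of `lambdaNum a X` with respect to `X`. -/
def lambdaNumDeriv (a X : K) : K :=
  5 * X ^ 4 - 8 * a * X ^ 3 + 3 * a * (a ^ 2 + 3 * a - 1) * X ^ 2 - 6 * a ^ 2 * (a - 1) * X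
    + a ^ 3 * (a - 3)

/-- The function `λ*(X) = N(X) / (X ^ 2 * (X - a) ^ 2)`. -/
def lambdaX (a X : K) : K := lambdaNum a X / (X ^ 2 * (X - a) ^ 2)

/-- The derivative of `λ*(X)` with respect to `X`, by the quotient rule. -/
def lambdaXDeriv (a X : K) : K :=
  (lambdaNumDeriv a X * (X * (X - a)) - 2 * lambdaNum a X * (2 * X - a)) / (X ^ 3 * (X - a) ^ 3)

/-- The `X`-coordinate, on `E*_a`, of the point of `E*_{a,b}` with first coordinate `x`, under the
isomorphism `f*` of `E*_{a,b}` with `E*_a` over `ℚ(√d)`. -/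
def twistX (a d x : K) : K := x / (100 * d) - 2 * (a ^ 2 - 5 * a + 1) / 25

/-- `λ*` in coordinates, on the equations with completed squares. -/
theorem lambda_equation (a X : K) (h0 : X ≠ 0) (h1 : X ≠ a) :
    (4 * (X ^ 3 - a * X ^ 2) + ((a - 1) * X + a) ^ 2) * lambdaXDeriv a X ^ 2 =
      4 * (lambdaX a X ^ 3 - a * lambdaX a X ^ 2 - 5 * a * (a ^ 2 + 2 * a - 1) * lambdaX a X
        - a * (a ^ 4 + 10 * a ^ 3 - 5 * a ^ 2 + 15 * a - 1)) + ((a - 1) * lambdaX a X + a) ^ 2 := by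
  have h1' : X - a ≠ 0 := sub_ne_zero.mpr h1
  unfold lambdaX lambdaXDeriv
  field_simp
  unfold lambdaNum lambdaNumDeriv
  ring

end Isogeny

theorem quadratic_ne_zero (a : ℚ) : a ^ 2 - 11 * a - 1 ≠ 0 := by
  intro h
  have h5 : IsSquare (125 : ℚ) := ⟨2 * a - 11, by linarith⟩
  revert h5
  norm_num

theorem E_Δ (a b : ℚ) :
    (E a b).Δ = 2 ^ 12 * d a b ^ 6 * a * (a ^ 2 - 11 * a - 1) ^ 5 := by
  simp only [WeierstrassCurve.Δ, WeierstrassCurve.b₂, WeierstrassCurve.b₄, WeierstrassCurve.b₆,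
    WeierstrassCurve.b₈, E]
  generalize d a b = d
  ring

/-- The formulas for `φ*` map affine points of `E*_{a,b}` off the kernel to points of `E_{a,b}`. -/
theorem dualIsogeny_nonsingular {a b : ℚ} (ha : a ≠ 0) (hd : d a b ≠ 0) {K : Type*} [Field K]
    [Algebra ℚ K] {x y : K} (h : ((Estar a b).baseChange K).toAffine.Nonsingular x y)
    (hX : twistX (algebraMap ℚ K a) (algebraMap ℚ K (d a b)) x ≠ 0 ∧
      twistX (algebraMap ℚ K a) (algebraMap ℚ K (d a b)) x ≠ algebraMap ℚ K a) :
    ((E a b).baseChange K).toAffine.Nonsingular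
      (4 * algebraMap ℚ K (d a b) * (lambdaX (algebraMap ℚ K a)
        (twistX (algebraMap ℚ K a) (algebraMap ℚ K (d a b)) x) + 2 * algebraMap ℚ K a))
      (y / 125 * lambdaXDeriv (algebraMap ℚ K a)
        (twistX (algebraMap ℚ K a) (algebraMap ℚ K (d a b)) x)) := by
  have : CharZero K := algebraRat.charZero K
  have hΔ : ((E a b).baseChange K).Δ ≠ 0 := by
    rw [WeierstrassCurve.baseChange, WeierstrassCurve.map_Δ, E_Δ, _root_.map_ne_zero]
    have := quadratic_ne_zero a
    positivity
  rw [← WeierstrassCurve.Affine.equation_iff_nonsingular_of_Δ_ne_zero hΔ]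
  have h' := h.1
  rw [WeierstrassCurve.Affine.equation_iff] at h' ⊢
  have hD : algebraMap ℚ K (d a b) ≠ 0 := by rwa [_root_.map_ne_zero]
  have hl := lambda_equation (algebraMap ℚ K a) _ hX.1 hX.2
  simp only [WeierstrassCurve.baseChange, WeierstrassCurve.map, E, Estar, map_mul, map_add,
    map_sub, map_neg, map_pow, map_ofNat, map_zero, map_one] at h' ⊢
  generalize algebraMap ℚ K a = A at *
  generalize algebraMap ℚ K (d a b) = D at *
  have hx : x = 100 * D * (twistX A D x + 2 * (A ^ 2 - 5 * A + 1) / 25) := by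
    unfold twistX
    field_simp
    ring
  generalize twistX A D x = T at *
  generalize lambdaX A T = L at *
  generalize lambdaXDeriv A T = M at *
  subst hx
  have hy : y ^ 2 = 250000 * D ^ 3 * (4 * (T ^ 3 - A * T ^ 2) + ((A - 1) * T + A) ^ 2) := by
    linear_combination h'
  linear_combination M ^ 2 / 15625 * hy + 16 * D ^ 3 * hl

open Classical in
/-- The isogeny `φ* : E*_{a,b} → E_{a,b}` of degree 5, dual to `φ`, on `K`-points. It is the
composite `f⁻¹ ∘ λ* ∘ f*`, where `λ* : E*_a → E_a` is the quotient by the subgroup generated by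
the point `(0, 0)` of order 5 and `f* : E*_{a,b} → E*_a`, `f : E_{a,b} → E_a` are the isomorphisms
over `ℚ(√d)`; the square roots cancel. With `X = x / (100 d) - 2 (a² - 5a + 1) / 25` it maps
`(x, y)` to `(4d (λ*(X) + 2a), (y / 125) * (dλ*/dX)(X))`. Its kernel consists of the point at
infinity and the points with `X = 0` or `X = a`. -/
noncomputable def dualIsogeny {a b : ℚ} (ha : a ≠ 0) (hd : d a b ≠ 0) (K : Type*) [Field K]
    [Algebra ℚ K] : EstarPoint a b K → EPoint a b K
  | .zero => 0
  | .some x y h =>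
    if hX : twistX (algebraMap ℚ K a) (algebraMap ℚ K (d a b)) x ≠ 0 ∧
        twistX (algebraMap ℚ K a) (algebraMap ℚ K (d a b)) x ≠ algebraMap ℚ K a then
      .some
        (4 * algebraMap ℚ K (d a b) * (lambdaX (algebraMap ℚ K a)
          (twistX (algebraMap ℚ K a) (algebraMap ℚ K (d a b)) x) + 2 * algebraMap ℚ K a))
        (y / 125 * lambdaXDeriv (algebraMap ℚ K a)
          (twistX (algebraMap ℚ K a) (algebraMap ℚ K (d a b)) x))
        (dualIsogeny_nonsingular ha hd h hX)
    else 0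

/-- `B(P; X) = B(a, x(P) / (-4d); X)` for an affine point `P` of `E_{a,b}(ℚ)`. The point at
infinity has no `x`-coordinate; the value `0` there is a placeholder. -/
noncomputable def quinticAt (a b : ℚ) : EPoint a b ℚ → ℚ[X]
  | .zero => 0
  | .some x _ _ => quintic a (x / (-4 * d a b))

/-- The splitting field over `ℚ` of a polynomial, inside the algebraic closure of `ℚ`. -/
noncomputable def splittingField (f : ℚ[X]) : IntermediateField ℚ (AlgebraicClosure ℚ) :=
  IntermediateField.adjoin ℚ (f.rootSet (AlgebraicClosure ℚ))

end Brumer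

/-! Over a field containing √d the curves `E*_{a,b}` and `E_{a,b}` become `E*_a` and `E_a`, and φ*
becomes the quotient of `E*_a` by the group C generated by T = (0, 0), namely (X, Y) ↦ (λ(X), Y
λ'(X)) when squares are completed. An automorphism σ sends T to T or -T according to its sign on √d.
Putting X = a/z in λ(X) = v and clearing denominators gives B(a, -(v + 2a); z) = 0
(`aeval_quintic_div`), so the roots of B(P; X) are the numbers a/X(R) with R in the fibre of φ* over
P. If R lies over a rational P, then σR - R lies in C, hence 5R is rational and 5P is always in the
image. If P is not in the image, it follows that 2P ≠ 0, so R and -R never lie in the same fibre,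
and the roots are in Galois-equivariant bijection with the fibre R + C.

Reducibility: a rational R over P gives the rational root a/X(R). Conversely a proper factor of B(P;
X) cuts out a Galois-stable set of n points of the fibre, 0 < n < 5. Their sum is rational and maps
to nP, and since 5P is in the image, so is P (`mem_of_finset`).

Splitting fields: σ fixes the splitting field of P exactly when it fixes T and one point R over P.
If this forces σ to fix the fibre over Q, then comparing the translations of R and of S, a point
over Q, by an automorphism τ that fixes T and moves R yields k with S - kR fixed by the stabilizer
of T. That stabilizer has index at most 2, prime to 5, so Q - kP is in the image
(`exists_zsmul_sub_mem`). By Galois theory equal splitting fields mean equal cyclic subgroups of the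
quotient.

Additivity of φ*: λ carries lines to lines (`lambda_line`, `lambda_sum`), which settles generic
pairs. Over an algebraically closed field there are enough points to deduce all pairs
(`map_add_of_generic`), and ℚ embeds. The isogeny φ is the factorization of [5] through the
surjection φ*.

Finiteness is a descent over L = ℚ(√d, ζ₅). A function on E with divisor 5(S) - 5(O), S a generator
of ker φ, pulls back to the fifth power of a Lagrange resolvent on E* (`resolvent_pow`). Its values
at rational points have valuation divisible by 5 outside a finite set of places, so they fall into
finitely many classes modulo fifth powers. Equal classes give P - Q in the image, first over L, and
then over ℚ because Gal(L/ℚ) has order prime to 5. -/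

namespace Brumer

/-! ### Explicit identities on `E*_a` and `E_a`: lines, translation by T, and the Kummer function.
-/

section Algebra

variable {K : Type*} [Field K]

/-- The cubic `F` of the model `Y² = F(X)` of `E*_a` with completed square. -/
def starCubic (a X : K) : K := 4 * (X ^ 3 - a * X ^ 2) + ((a - 1) * X + a) ^ 2

/-- The cubic `G` of the model `w² = G(v)` of `E_a` with completed square. -/
def baseCubic (a v : K) : K :=
  4 * (v ^ 3 - a * v ^ 2 - 5 * a * (a ^ 2 + 2 * a - 1) * v
    - a * (a ^ 4 + 10 * a ^ 3 - 5 * a ^ 2 + 15 * a - 1)) + ((a - 1) * v + a) ^ 2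

/-- The common denominator of slope and intercept of the image of the line `Y = m X + c`. -/
def lineDen (a m c : K) : K := (c ^ 2 - a ^ 2) * ((m * a + c) ^ 2 - a ^ 4)

/-- The numerator of the slope of the image under `λ*` of the line `Y = m X + c`. -/
def lineSlopeNum (a m c : K) : K :=
  4 * a ^ 4 * c + 4 * a ^ 6 * c + 4 * a * c ^ 3 - 8 * a ^ 2 * c ^ 3 - 4 * a ^ 3 * c ^ 3
    + 4 * a ^ 5 * m - 3 * a ^ 6 * m + 11 * a ^ 2 * m * c ^ 2 - 12 * a ^ 3 * m * c ^ 2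
    - a ^ 4 * m * c ^ 2 + m * c ^ 4 + 10 * a ^ 3 * m ^ 2 * c - 4 * a ^ 4 * m ^ 2 * c
    + 2 * a * m ^ 2 * c ^ 3 + 3 * a ^ 4 * m ^ 3 + a ^ 2 * m ^ 3 * c ^ 2

/-- The numerator of the intercept of the image under `λ*` of the line `Y = m X + c`. -/
def lineInterceptNum (a m c : K) : K :=
  a ^ 4 * c - 14 * a ^ 5 * c - 5 * a ^ 6 * c + 10 * a ^ 7 * c + a ^ 8 * c + a * c ^ 3
    - 17 * a ^ 2 * c ^ 3 + 4 * a ^ 3 * c ^ 3 - 13 * a ^ 4 * c ^ 3 - a ^ 5 * c ^ 3 + c ^ 5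
    + a ^ 5 * m - 15 * a ^ 6 * m - a ^ 7 * m - a ^ 8 * m + 3 * a ^ 2 * m * c ^ 2
    - 39 * a ^ 3 * m * c ^ 2 + 13 * a ^ 4 * m * c ^ 2 - 11 * a ^ 5 * m * c ^ 2 + 2 * a * m * c ^ 4
    + 3 * a ^ 3 * m ^ 2 * c - 29 * a ^ 4 * m ^ 2 * c + 9 * a ^ 5 * m ^ 2 * c - 2 * a ^ 6 * m ^ 2 * c
    - a * m ^ 2 * c ^ 3 + 3 * a ^ 2 * m ^ 2 * c ^ 3 + a ^ 3 * m ^ 2 * c ^ 3 + a ^ 4 * m ^ 3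
    - 7 * a ^ 5 * m ^ 3 + 2 * a ^ 6 * m ^ 3 - 3 * a ^ 2 * m ^ 3 * c ^ 2 + 3 * a ^ 3 * m ^ 3 * c ^ 2
    - 3 * a ^ 3 * m ^ 4 * c + a ^ 4 * m ^ 4 * c - a ^ 4 * m ^ 5

/-- `λ*` maps the points of `Y = m X + c` on `E*_a` to points of a line. -/
theorem lambda_line (a m c : K) {x y : K} (h0 : x ≠ 0) (h1 : x ≠ a) (hy : y ^ 2 = starCubic a x)
    (hl : y = m * x + c) :
    lineDen a m c * (y * lambdaXDeriv a x) =
      lineSlopeNum a m c * lambdaX a x + lineInterceptNum a m c := by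
  have h1' : x - a ≠ 0 := sub_ne_zero.mpr h1
  -- With c eliminated, the claim is a polynomial identity in a, m, x, y modulo the curve equation
  -- alone; the long factor below is its cofactor.
  obtain rfl : c = y - m * x := by rw [hl]; ring
  unfold lambdaX lambdaXDeriv
  field_simp
  unfold starCubic at hy
  unfold lambdaNum lambdaNumDeriv lineDen lineSlopeNum lineInterceptNum
  linear_combination (a^9*m*x^2 + 3*a^9*m*x + (-1)*a^9*x*y + (-2)*a^9*y + a^8*m*x^3 + (-2)*a^8*m*x^2
       + (-4)*a^8*m*x + (-1)*a^8*x^2*y + 3*a^8*x*y + (-1)*a^7*m^3*x^2 + (-3)*a^7*m^3*x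
       + a^7*m^2*x*y + 2*a^7*m^2*y + (-1)*a^7*m*x^4 + (-2)*a^7*m*x^3 + 12*a^7*m*x^2
       + a^7*x^3*y + 3*a^7*x^2*y + (-4)*a^7*x*y + 5*a^6*m^3*x^3 + 16*a^6*m^3*x^2
       + (-7)*a^6*m^2*x^2*y + (-17)*a^6*m^2*x*y + (-1)*a^6*m*x^5 + a^6*m*x^4 + (-13)*a^6*m*x^3
       + 2*a^6*m*x*y^2 + 4*a^6*m*y^2 + a^6*x^4*y + (-2)*a^6*x^3*y + 8*a^6*x^2*y
       + (-2)*a^5*m^3*x^5 + (-10)*a^5*m^3*x^4 + (-35)*a^5*m^3*x^3 + 4*a^5*m^2*x^4*y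
       + 18*a^5*m^2*x^3*y + 51*a^5*m^2*x^2*y + 6*a^5*m*x^4 + (-2)*a^5*m*x^3*y^2
       + (-9)*a^5*m*x^2*y^2 + (-21)*a^5*m*x*y^2 + (-5)*a^5*x^3*y + a^5*x*y^3 + 2*a^5*y^3
       + a^4*m^3*x^6 + 11*a^4*m^3*x^5 + 40*a^4*m^3*x^4 + (-3)*a^4*m^2*x^5*y
       + (-24)*a^4*m^2*x^4*y + (-74)*a^4*m^2*x^3*y + (-1)*a^4*m*x^5 + 3*a^4*m*x^4*y^2
       + 16*a^4*m*x^3*y^2 + 42*a^4*m*x^2*y^2 + a^4*x^4*y + (-1)*a^4*x^3*y^3 + (-3)*a^4*x^2*y^3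
       + (-7)*a^4*x*y^3 + a^3*m^3*x^7 + (-7)*a^3*m^3*x^6 + (-25)*a^3*m^3*x^5
       + (-3)*a^3*m^2*x^6*y + 18*a^3*m^2*x^5*y + 56*a^3*m^2*x^4*y + 3*a^3*m*x^5*y^2
       + (-15)*a^3*m*x^4*y^2 + (-40)*a^3*m*x^3*y^2 + (-1)*a^3*x^4*y^3 + 4*a^3*x^3*y^3
       + 9*a^3*x^2*y^3 + 2*a^2*m^3*x^7 + 8*a^2*m^3*x^6 + (-6)*a^2*m^2*x^6*y
       + (-21)*a^2*m^2*x^5*y + 6*a^2*m*x^5*y^2 + 18*a^2*m*x^4*y^2 + (-2)*a^2*x^4*y^3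
       + (-5)*a^2*x^3*y^3 + (-1)*a*m^3*x^7 + 3*a*m^2*x^6*y + (-3)*a*m*x^5*y^2 + a*x^4*y^3) * hy

/-- The partial fraction decomposition of `λ*`. -/
theorem lambdaX_eq {a x : K} (h0 : x ≠ 0) (h1 : x ≠ a) :
    lambdaX a x = x + (a ^ 2 - a) * (1 / x) + a ^ 2 * (1 / x ^ 2)
      + (a ^ 3 + a ^ 2) * (1 / (x - a)) + a ^ 4 * (1 / (x - a) ^ 2) := by
  have h1' : x - a ≠ 0 := sub_ne_zero.mpr h1
  unfold lambdaX
  field_simp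
  unfold lambdaNum
  ring

/-- The hypotheses are Vieta's formulas for the cubic F(X) - (mX + c)², whose roots are the
abscissae of the intersection with a line. As λ has poles only at 0, a and infinity, the sum of its
values is rational in the power sums of the 1/xᵢ and 1/(xᵢ - a). The values of the cubic at 0 and a
give the two factors of `lineDen`. The conclusion says that the image abscissae satisfy the sum
formula for a line on `E_a` of the image slope. -/
theorem lambda_sum (a m c : K) (h4 : (4 : K) ≠ 0) {x₁ x₂ x₃ : K} (h10 : x₁ ≠ 0) (h1 : x₁ ≠ a)
    (h20 : x₂ ≠ 0) (h2 : x₂ ≠ a) (h30 : x₃ ≠ 0) (h3 : x₃ ≠ a)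
    (e1 : 4 * (x₁ + x₂ + x₃) = 4 * a - (a - 1) ^ 2 + m ^ 2)
    (e2 : 4 * (x₁ * x₂ + x₂ * x₃ + x₃ * x₁) = 2 * a * (a - 1) - 2 * m * c)
    (e3 : 4 * (x₁ * x₂ * x₃) = c ^ 2 - a ^ 2) :
    lineDen a m c ≠ 0 ∧ 4 * (lambdaX a x₁ + lambdaX a x₂ + lambdaX a x₃) =
      (lineSlopeNum a m c / lineDen a m c) ^ 2 - ((a - 1) ^ 2 - 4 * a) := by
  have e4 : 4 * ((x₁ - a) * (x₂ - a) * (x₃ - a)) = (m * a + c) ^ 2 - a ^ 4 := by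
    linear_combination e3 - a * e2 + a ^ 2 * e1
  have h1' : x₁ - a ≠ 0 := sub_ne_zero.mpr h1
  have h2' : x₂ - a ≠ 0 := sub_ne_zero.mpr h2
  have h3' : x₃ - a ≠ 0 := sub_ne_zero.mpr h3
  have d1 : c ^ 2 - a ^ 2 ≠ 0 := by
    rw [← e3]; exact mul_ne_zero h4 (mul_ne_zero (mul_ne_zero h10 h20) h30)
  have d2 : (m * a + c) ^ 2 - a ^ 4 ≠ 0 := by
    rw [← e4]; exact mul_ne_zero h4 (mul_ne_zero (mul_ne_zero h1' h2') h3')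
  refine ⟨mul_ne_zero d1 d2, ?_⟩
  -- First power sums of the reciprocals at the poles 0 and a; the second ones follow from p₂ = e₁²
  -- - 2e₂.
  have s1 : 1 / x₁ + 1 / x₂ + 1 / x₃ = (2 * a * (a - 1) - 2 * m * c) / (c ^ 2 - a ^ 2) := by
    rw [← e2, ← e3]
    field_simp
    ring
  have t1 : 1 / (x₁ - a) + 1 / (x₂ - a) + 1 / (x₃ - a) = (2 * a * (a - 1) - 2 * m * c
      - 2 * a * (4 * a - (a - 1) ^ 2 + m ^ 2) + 12 * a ^ 2) / ((m * a + c) ^ 2 - a ^ 4) := by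
    rw [← e2, ← e4, ← e1]
    field_simp
    ring
  have s2 : 1 / x₁ ^ 2 + 1 / x₂ ^ 2 + 1 / x₃ ^ 2 = (1 / x₁ + 1 / x₂ + 1 / x₃) ^ 2
      - 2 * (4 * a - (a - 1) ^ 2 + m ^ 2) / (c ^ 2 - a ^ 2) := by
    rw [← e1, ← e3]
    field_simp
    ring
  have t2 : 1 / (x₁ - a) ^ 2 + 1 / (x₂ - a) ^ 2 + 1 / (x₃ - a) ^ 2 =
      (1 / (x₁ - a) + 1 / (x₂ - a) + 1 / (x₃ - a)) ^ 2
      - 2 * (4 * a - (a - 1) ^ 2 + m ^ 2 - 12 * a) / ((m * a + c) ^ 2 - a ^ 4) := by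
    rw [← e1, ← e4]
    field_simp
    ring
  rw [s1] at s2
  rw [t1] at t2
  have key : 4 * (lambdaX a x₁ + lambdaX a x₂ + lambdaX a x₃) = 4 * (x₁ + x₂ + x₃)
      + 4 * ((a ^ 2 - a) * (1 / x₁ + 1 / x₂ + 1 / x₃)
      + a ^ 2 * (1 / x₁ ^ 2 + 1 / x₂ ^ 2 + 1 / x₃ ^ 2)
      + (a ^ 3 + a ^ 2) * (1 / (x₁ - a) + 1 / (x₂ - a) + 1 / (x₃ - a))
      + a ^ 4 * (1 / (x₁ - a) ^ 2 + 1 / (x₂ - a) ^ 2 + 1 / (x₃ - a) ^ 2)) := by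
    rw [lambdaX_eq h10 h1, lambdaX_eq h20 h2, lambdaX_eq h30 h3]
    ring
  rw [key, s1, s2, t1, t2, e1]
  unfold lineDen lineSlopeNum
  generalize hD1 : c ^ 2 - a ^ 2 = D1 at *
  generalize hD2 : (m * a + c) ^ 2 - a ^ 4 = D2 at *
  field_simp
  subst hD1 hD2
  ring




/-- Translation by the point `(0, 0)` of `E*_a` maps points off the kernel to points off the
kernel. -/
theorem translate_ne {a x u : K} (ha : a ≠ 0) (h0 : x ≠ 0) (h1 : x ≠ a)
    (hu : u ^ 2 - (a - 1) * x * u - a * u = x ^ 3 - a * x ^ 2) :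
    a * u / x ^ 2 ≠ 0 ∧ a * u / x ^ 2 ≠ a := by
  have h1' : x - a ≠ 0 := sub_ne_zero.mpr h1
  constructor
  · refine div_ne_zero (mul_ne_zero ha ?_) (pow_ne_zero 2 h0)
    rintro rfl
    have : x ^ 2 * (x - a) = 0 := by linear_combination -hu
    exact absurd this (mul_ne_zero (pow_ne_zero _ h0) h1')
  · intro h
    rw [div_eq_iff (pow_ne_zero 2 h0)] at h
    obtain rfl : u = x ^ 2 := mul_left_cancel₀ ha h
    have : x ^ 3 * (x - a) = 0 := by linear_combination hu
    exact absurd this (mul_ne_zero (pow_ne_zero _ h0) h1')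

/-- The second coordinate of the translate by `(0, 0)`. -/
def translateY (a x u : K) : K := a + (a - 1) * (a * u / x ^ 2) - a * u ^ 2 / x ^ 3

/-- Both coordinates of the quotient map must be invariant under translation by T. Here (x, u) is a
point of `E*_a`, its translate has abscissa au/x², and 2u - (a-1)x - a is the coordinate Y of the
completed square. -/
theorem lambda_translate {a x u : K} (ha : a ≠ 0) (h0 : x ≠ 0) (h1 : x ≠ a)
    (hu : u ^ 2 - (a - 1) * x * u - a * u = x ^ 3 - a * x ^ 2) :
    lambdaX a (a * u / x ^ 2) = lambdaX a x ∧
      (2 * translateY a x u - (a - 1) * (a * u / x ^ 2) - a) * lambdaXDeriv a (a * u / x ^ 2) =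
        (2 * u - (a - 1) * x - a) * lambdaXDeriv a x := by
  obtain ⟨h2, h3⟩ := translate_ne ha h0 h1 hu
  have hu0 : u ≠ 0 := by rintro rfl; simp at h2
  have h1' : x - a ≠ 0 := sub_ne_zero.mpr h1
  have h3' : u - x ^ 2 ≠ 0 := by
    intro h; apply h3; rw [sub_eq_zero.mp h]; field_simp
  have h4 : a * u / x ^ 2 - a = a * (u - x ^ 2) / x ^ 2 := by field_simp
  have h5 : 2 * translateY a x u - (a - 1) * (a * u / x ^ 2) - a =
      a + (a - 1) * (a * u / x ^ 2) - 2 * a * u ^ 2 / x ^ 3 := by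
    unfold translateY; ring
  rw [h5]
  constructor
  · unfold lambdaX
    rw [h4]
    field_simp
    unfold lambdaNum
    field_simp
    linear_combination ((-1) * a ^ 3 * x ^ 3 * u ^ 2 - 1 * a ^ 3 * x ^ 2 * u ^ 2 + a ^ 3 * u ^ 3
      + a ^ 2 * x ^ 6 * u + 2 * a ^ 2 * x ^ 3 * u ^ 2 - 2 * a ^ 2 * x * u ^ 3 + a * x ^ 8
      - 2 * a * x ^ 6 * u + a * x ^ 2 * u ^ 3 - 1 * x ^ 9 + 2 * x ^ 7 * u - 1 * x ^ 5 * u ^ 2) * hu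
  · unfold lambdaXDeriv
    rw [h4]
    field_simp
    unfold lambdaNum lambdaNumDeriv
    field_simp
    linear_combination ((-1) * a ^ 5 * x ^ 6 * u ^ 3 - 3 * a ^ 5 * x ^ 5 * u ^ 3
        - 1 * a ^ 5 * x ^ 4 * u ^ 4
      - 2 * a ^ 5 * x ^ 4 * u ^ 3 + 4 * a ^ 5 * x ^ 3 * u ^ 4 + 4 * a ^ 5 * x ^ 2 * u ^ 4
      - 1 * a ^ 5 * x * u ^ 5 - 2 * a ^ 5 * u ^ 5 - 1 * a ^ 4 * x ^ 9 * u ^ 2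
      + 6 * a ^ 4 * x ^ 7 * u ^ 3 + 8 * a ^ 4 * x ^ 6 * u ^ 3 + a ^ 4 * x ^ 5 * u ^ 4
      + 7 * a ^ 4 * x ^ 5 * u ^ 3 - 7 * a ^ 4 * x ^ 4 * u ^ 4 + 2 * a ^ 4 * x ^ 3 * u ^ 5
      - 14 * a ^ 4 * x ^ 3 * u ^ 4 - 3 * a ^ 4 * x ^ 2 * u ^ 5 + 7 * a ^ 4 * x * u ^ 5
      + 2 * a ^ 4 * u ^ 6 - 3 * a ^ 3 * x ^ 11 * u - 1 * a ^ 3 * x ^ 10 * u ^ 2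
      + 8 * a ^ 3 * x ^ 9 * u ^ 2 + a ^ 3 * x ^ 8 * u ^ 3 - 14 * a ^ 3 * x ^ 7 * u ^ 3
      - 12 * a ^ 3 * x ^ 6 * u ^ 4 - 9 * a ^ 3 * x ^ 6 * u ^ 3 + 2 * a ^ 3 * x ^ 4 * u ^ 5
      + 18 * a ^ 3 * x ^ 4 * u ^ 4 + 15 * a ^ 3 * x ^ 3 * u ^ 5 - 9 * a ^ 3 * x ^ 2 * u ^ 5
      - 6 * a ^ 3 * x * u ^ 6 - 2 * a ^ 2 * x ^ 13 + 4 * a ^ 2 * x ^ 12 * u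
      + 7 * a ^ 2 * x ^ 11 * u - 7 * a ^ 2 * x ^ 10 * u ^ 2 + 2 * a ^ 2 * x ^ 9 * u ^ 3
      - 9 * a ^ 2 * x ^ 9 * u ^ 2 + 2 * a ^ 2 * x ^ 7 * u ^ 4 + 10 * a ^ 2 * x ^ 7 * u ^ 3
      + 18 * a ^ 2 * x ^ 6 * u ^ 4 - 11 * a ^ 2 * x ^ 5 * u ^ 4 - 21 * a ^ 2 * x ^ 4 * u ^ 5
      + 5 * a ^ 2 * x ^ 3 * u ^ 5 + 6 * a ^ 2 * x ^ 2 * u ^ 6 + 4 * a * x ^ 14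
      - 1 * a * x ^ 13 * u - 14 * a * x ^ 12 * u - 3 * a * x ^ 11 * u ^ 2
      + 18 * a * x ^ 10 * u ^ 2 + 15 * a * x ^ 9 * u ^ 3 - 11 * a * x ^ 8 * u ^ 3
      - 21 * a * x ^ 7 * u ^ 4 + 4 * a * x ^ 6 * u ^ 4 + 12 * a * x ^ 5 * u ^ 5
      - 1 * a * x ^ 4 * u ^ 5 - 2 * a * x ^ 3 * u ^ 6 - 2 * x ^ 15 + 7 * x ^ 13 * u
      + 2 * x ^ 12 * u ^ 2 - 9 * x ^ 11 * u ^ 2 - 6 * x ^ 10 * u ^ 3 + 5 * x ^ 9 * u ^ 3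
      + 6 * x ^ 8 * u ^ 4 - 1 * x ^ 7 * u ^ 4 - 2 * x ^ 6 * u ^ 5) * hu

/-- The Lagrange resolvent `∑ z⁻ⁱ s(R + i T)` of the function `s = u / x` on `E*_a`, where
`R = (x, u)` and `T = (0, 0)`. -/
def resolvent (z a x u : K) : K :=
  u / x + z ^ 4 * (a - 1 - u / x - ((a - 1) * x + a - u) / (x - a)) + z ^ 3 * (a * x / (x - a))
    + z * (((a - 1) * x + a - u) / x)
    + z ^ 2 * (a - 1 - ((a - 1) * x + a - u) / x - u / (x - a))

/-- Translation by T permutes the five values s(R + iT) cyclically: each `eᵢ` below says that the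
i-th summand becomes the (i+1)-st. With the weights z⁻ⁱ this multiplies the sum by z. -/
theorem resolvent_translate {z a x u : K} (hz : z ^ 5 = 1) (ha : a ≠ 0) (h0 : x ≠ 0) (h1 : x ≠ a)
    (hu : u ^ 2 - (a - 1) * x * u - a * u = x ^ 3 - a * x ^ 2) :
    resolvent z a (a * u / x ^ 2) (translateY a x u) = z * resolvent z a x u := by
  obtain ⟨h2, h3⟩ := translate_ne ha h0 h1 hu
  have hu0 : u ≠ 0 := by rintro rfl; simp at h2
  have h1' : x - a ≠ 0 := sub_ne_zero.mpr h1
  have h3' : u - x ^ 2 ≠ 0 := by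
    intro h; apply h3; rw [sub_eq_zero.mp h]; field_simp
  have h4 : a * u / x ^ 2 - a = a * (u - x ^ 2) / x ^ 2 := by field_simp
  have e0 : translateY a x u / (a * u / x ^ 2) =
      a - 1 - u / x - ((a - 1) * x + a - u) / (x - a) := by
    unfold translateY
    field_simp
    linear_combination (-x) * hu
  have e3 : ((a - 1) * (a * u / x ^ 2) + a - translateY a x u) / (a * u / x ^ 2) = u / x := by
    unfold translateY
    field_simp
    ring
  have e2 : a * (a * u / x ^ 2) / (a * u / x ^ 2 - a) =
      a - 1 - ((a - 1) * x + a - u) / x - u / (x - a) := by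
    rw [h4]
    field_simp
    linear_combination a * hu
  have e1 : a - 1 - translateY a x u / (a * u / x ^ 2) -
      ((a - 1) * (a * u / x ^ 2) + a - translateY a x u) / (a * u / x ^ 2 - a) =
        a * x / (x - a) := by
    rw [e0, h4]
    unfold translateY
    field_simp
    linear_combination (-x) * hu
  have e4 : a - 1 - ((a - 1) * (a * u / x ^ 2) + a - translateY a x u) / (a * u / x ^ 2) -
      translateY a x u / (a * u / x ^ 2 - a) = ((a - 1) * x + a - u) / x := by
    rw [e3, h4]
    unfold translateY
    field_simp
    linear_combination hu
  unfold resolvent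
  rw [e1, e4, e0, e2, e3]
  linear_combination (-(a - 1 - u / x - ((a - 1) * x + a - u) / (x - a))) * hz

/-- The slope `β` in the function `w (v + β) + …` with divisor `5 (S) - 5 (O)` on `E_a`, where `S`
generates the kernel of `φ`; here `e = z ^ 2 + z ^ 3`. -/
def kummerShift (e a : K) : K := (-2 * e - 3) * a ^ 2 + (-3 * e - 2) * a + (2 * e - 1)

/-- The part of the function with divisor `5 (S) - 5 (O)` on `E_a` not involving `w`. -/
def kummerEven (e a v : K) : K :=
  (((75 * e + 125) * a - 25 * e - 25) * v ^ 2
    + ((-35 * e - 55) * a ^ 3 + (-285 * e - 430) * a ^ 2 + (180 * e + 315) * a - 5 * e - 15) * v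
    + ((-10 * e - 16) * a ^ 5 + (-350 * e - 560) * a ^ 4 + (-85 * e - 95) * a ^ 3
      + (-360 * e - 635) * a ^ 2 + (5 * e + 85) * a - 2)) / 2

/-- The `v`-coordinate of the zero `S` of the function with divisor `5 (S) - 5 (O)` on `E_a`. -/
def kummerZero (e a : K) : K := ((-e - 3) * a ^ 2 + (11 * e + 8) * a + e - 2) / 5

/-- The function with divisor `5 (S) - 5 (O)` on `E_a`, where `S` generates the kernel of `φ`. -/
def kummerFun (z a v w : K) : K :=
  (z ^ 2 - z ^ 3) * ((5 * (z ^ 2 + z ^ 3) + 10) / 2) * (w * (v + kummerShift (z ^ 2 + z ^ 3) a))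
    + kummerEven (z ^ 2 + z ^ 3) a v

/-- The norm of the function with divisor `5 (S) - 5 (O)`. -/
theorem kummerEven_sq [CharZero K] {e a v : K} (he : e ^ 2 = 1 - e) :
    kummerEven e a v ^ 2
      - baseCubic a v * ((-e - 3) * ((5 * e + 10) / 2) ^ 2) * (v + kummerShift e a) ^ 2 =
      -4 * ((-e - 3) * ((5 * e + 10) / 2) ^ 2) * (v - kummerZero e a) ^ 5 := by
  unfold kummerEven baseCubic kummerShift kummerZero
  linear_combination ((-1/125) * e ^ 6 * a ^ 10 + 11/25 * e ^ 6 * a ^ 9 - 241/25 * e ^ 6 * a ^ 8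
      + 2618/25 * e ^ 6 * a ^ 7 - 13917/25 * e ^ 6 * a ^ 6 + 134761/125 * e ^ 6 * a ^ 5
      + 13917/25 * e ^ 6 * a ^ 4 + 2618/25 * e ^ 6 * a ^ 3 + 241/25 * e ^ 6 * a ^ 2
      + 11/25 * e ^ 6 * a + 1/125 * e ^ 6 - 21/125 * e ^ 5 * a ^ 10 + 206/25 * e ^ 5 * a ^ 9
      - 1/5 * e ^ 5 * a ^ 8 * v - 3966/25 * e ^ 5 * a ^ 8 + 44/5 * e ^ 5 * a ^ 7 * v
      + 37148/25 * e ^ 5 * a ^ 7 - 722/5 * e ^ 5 * a ^ 6 * v - 166067/25 * e ^ 5 * a ^ 6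
      + 5192/5 * e ^ 5 * a ^ 5 * v + 1310406/125 * e ^ 5 * a ^ 5 - 2639 * e ^ 5 * a ^ 4 * v
      + 96482/25 * e ^ 5 * a ^ 4 - 5192/5 * e ^ 5 * a ^ 3 * v + 10968/25 * e ^ 5 * a ^ 3
      - 722/5 * e ^ 5 * a ^ 2 * v + 351/25 * e ^ 5 * a ^ 2 - 44/5 * e ^ 5 * a * v
      - 14/25 * e ^ 5 * a - 1/5 * e ^ 5 * v - 4/125 * e ^ 5 - 191/125 * e ^ 4 * a ^ 10
      + 1651/25 * e ^ 4 * a ^ 9 - 18/5 * e ^ 4 * a ^ 8 * v - 27571/25 * e ^ 4 * a ^ 8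
      + 692/5 * e ^ 4 * a ^ 7 * v + 219848/25 * e ^ 4 * a ^ 7 - 2 * e ^ 4 * a ^ 6 * v ^ 2
      - 9716/5 * e ^ 4 * a ^ 6 * v - 820277/25 * e ^ 4 * a ^ 6 + 66 * e ^ 4 * a ^ 5 * v ^ 2
      + 58116/5 * e ^ 4 * a ^ 5 * v + 5401501/125 * e ^ 4 * a ^ 5
      - 720 * e ^ 4 * a ^ 4 * v ^ 2 - 23642 * e ^ 4 * a ^ 4 * v + 198697/25 * e ^ 4 * a ^ 4
      + 2530 * e ^ 4 * a ^ 3 * v ^ 2 - 32156/5 * e ^ 4 * a ^ 3 * v - 7642/25 * e ^ 4 * a ^ 3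
      + 720 * e ^ 4 * a ^ 2 * v ^ 2 - 2496/5 * e ^ 4 * a ^ 2 * v - 2999/25 * e ^ 4 * a ^ 2
      + 66 * e ^ 4 * a * v ^ 2 - 32/5 * e ^ 4 * a * v - 159/25 * e ^ 4 * a
      + 2 * e ^ 4 * v ^ 2 + 2/5 * e ^ 4 * v - 9/125 * e ^ 4 - 982/125 * e ^ 3 * a ^ 10
      + 4877/25 * e ^ 3 * a ^ 9 - 137/5 * e ^ 3 * a ^ 8 * v - 137897/25 * e ^ 3 * a ^ 8
      + 2028/5 * e ^ 3 * a ^ 7 * v + 645041/25 * e ^ 3 * a ^ 7 - 5 * e ^ 3 * a ^ 6 * v ^ 2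
      - 65714/5 * e ^ 3 * a ^ 6 * v - 2211089/25 * e ^ 3 * a ^ 6
      + 765 * e ^ 3 * a ^ 5 * v ^ 2 + 249579/5 * e ^ 3 * a ^ 5 * v
      + 12658527/125 * e ^ 3 * a ^ 5 + 90 * e ^ 3 * a ^ 4 * v ^ 3
      - 31795/4 * e ^ 3 * a ^ 4 * v ^ 2 - 167421/2 * e ^ 3 * a ^ 4 * v
      - 351599/100 * e ^ 3 * a ^ 4 + 520 * e ^ 3 * a ^ 3 * v ^ 3
      + 41445/2 * e ^ 3 * a ^ 3 * v ^ 2 - 74383/10 * e ^ 3 * a ^ 3 * v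
      + 48256/25 * e ^ 3 * a ^ 3 - 1165 * e ^ 3 * a ^ 2 * v ^ 3
      + 17645/4 * e ^ 3 * a ^ 2 * v ^ 2 - 7514/5 * e ^ 3 * a ^ 2 * v
      - 47733/25 * e ^ 3 * a ^ 2 - 520 * e ^ 3 * a * v ^ 3 - 45 * e ^ 3 * a * v ^ 2
      + 2822/5 * e ^ 3 * a * v + 2737/25 * e ^ 3 * a + 90 * e ^ 3 * v ^ 3
      + 25 * e ^ 3 * v ^ 2 + 13/5 * e ^ 3 * v + 57/125 * e ^ 3 - 3124/125 * e ^ 2 * a ^ 10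
      - 2411/25 * e ^ 2 * a ^ 9 - 571/5 * e ^ 2 * a ^ 8 * v - 528889/25 * e ^ 2 * a ^ 8
      - 6076/5 * e ^ 2 * a ^ 7 * v + 865452/25 * e ^ 2 * a ^ 7 + 41 * e ^ 2 * a ^ 6 * v ^ 2
      - 253752/5 * e ^ 2 * a ^ 6 * v - 3716318/25 * e ^ 2 * a ^ 6
      + 8069/2 * e ^ 2 * a ^ 5 * v ^ 2 + 524977/5 * e ^ 2 * a ^ 5 * v
      + 35946953/250 * e ^ 2 * a ^ 5 + 755 * e ^ 2 * a ^ 4 * v ^ 3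
      - 64875/2 * e ^ 2 * a ^ 4 * v ^ 2 - 156284 * e ^ 2 * a ^ 4 * v
      - 2135259/50 * e ^ 2 * a ^ 4 + 9405/2 * e ^ 2 * a ^ 3 * v ^ 3
      + 66480 * e ^ 2 * a ^ 3 * v ^ 2 + 288261/10 * e ^ 2 * a ^ 3 * v
      + 1382219/50 * e ^ 2 * a ^ 3 - 125 * e ^ 2 * a ^ 2 * v ^ 4
      - 8405 * e ^ 2 * a ^ 2 * v ^ 3 + 10475/2 * e ^ 2 * a ^ 2 * v ^ 2
      - 55462/5 * e ^ 2 * a ^ 2 * v - 219526/25 * e ^ 2 * a ^ 2 + 125 * e ^ 2 * a * v ^ 4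
      - 6155/2 * e ^ 2 * a * v ^ 3 - 2521/2 * e ^ 2 * a * v ^ 2 + 11946/5 * e ^ 2 * a * v
      + 13144/25 * e ^ 2 * a + 125 * e ^ 2 * v ^ 4 + 505 * e ^ 2 * v ^ 3 + 99 * e ^ 2 * v ^ 2
      - 31/5 * e ^ 2 * v - 26/125 * e ^ 2 - 6336/125 * e * a ^ 10 - 43704/25 * e * a ^ 9
      - 1411/5 * e * a ^ 8 * v - 1319431/25 * e * a ^ 8 - 41791/5 * e * a ^ 7 * v
      + 188268/25 * e * a ^ 7 + 765/4 * e * a ^ 6 * v ^ 2 - 1109159/10 * e * a ^ 6 * v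
      - 17981963/100 * e * a ^ 6 + 23965/2 * e * a ^ 5 * v ^ 2 + 1177099/10 * e * a ^ 5 * v
      + 13309121/125 * e * a ^ 5 + 4755/2 * e * a ^ 4 * v ^ 3 - 122685/2 * e * a ^ 4 * v ^ 2
      - 182009 * e * a ^ 4 * v - 8067027/100 * e * a ^ 4 + 16070 * e * a ^ 3 * v ^ 3
      + 226045/2 * e * a ^ 3 * v ^ 2 + 967151/10 * e * a ^ 3 * v + 1469413/25 * e * a ^ 3
      - 3875/4 * e * a ^ 2 * v ^ 4 - 43905/2 * e * a ^ 2 * v ^ 3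
      - 58405/4 * e * a ^ 2 * v ^ 2 - 146342/5 * e * a ^ 2 * v - 1081211/100 * e * a ^ 2
      + 1625/2 * e * a * v ^ 4 - 9765/2 * e * a * v ^ 3 - 905/2 * e * a * v ^ 2
      + 24757/10 * e * a * v + 12126/25 * e * a + 2625/4 * e * v ^ 4 + 1505/2 * e * v ^ 3
      + 565/4 * e * v ^ 2 - 36/5 * e * v - 189/125 * e - 5084/125 * a ^ 10 - 52276/25 * a ^ 9
      - 1228/5 * a ^ 8 * v - 1170584/25 * a ^ 8 - 46068/5 * a ^ 7 * v - 285828/25 * a ^ 7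
      + 867/4 * a ^ 6 * v ^ 2 - 872297/10 * a ^ 6 * v - 11703157/100 * a ^ 6
      + 12241 * a ^ 5 * v ^ 2 + 647497/10 * a ^ 5 * v + 7862023/250 * a ^ 5
      + 4535/2 * a ^ 4 * v ^ 3 - 39630 * a ^ 4 * v ^ 2 - 110267 * a ^ 4 * v
      - 5346563/100 * a ^ 4 + 31855/2 * a ^ 3 * v ^ 3 + 164225/2 * a ^ 3 * v ^ 2
      + 457124/5 * a ^ 3 * v + 1887889/50 * a ^ 3 - 5125/4 * a ^ 2 * v ^ 4
      - 34585/2 * a ^ 2 * v ^ 3 - 104405/4 * a ^ 2 * v ^ 2 - 124316/5 * a ^ 2 * v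
      + 129831/100 * a ^ 2 + 1625/2 * a * v ^ 4 - 2115 * a * v ^ 3 + 3796 * a * v ^ 2
      - 4119/10 * a * v - 6911/25 * a + 3875/4 * v ^ 4 + 285/2 * v ^ 3 + 143/4 * v ^ 2
      + 117/5 * v + 259/125) * he

/-- The Kummer function vanishes at S but its conjugate under w ↦ -w does not, so their half-sum is
nonzero there. At places where this value is a unit, the two conjugates cannot both be non-units
when v ≡ v(S). -/
theorem kummerEven_zero_ne [CharZero K] {e a : K} (he : e ^ 2 = 1 - e)
    (ha : a ^ 2 - 11 * a - 1 ≠ 0) : kummerEven e a (kummerZero e a) ≠ 0 := by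
  have h1 : kummerEven e a (kummerZero e a) = ((55 * e + 89) * a ^ 5 + (-590 * e - 955) * a ^ 4
      + (-220 * e - 350) * a ^ 3 + (-10 * e - 60) * a ^ 2 + (-55 * e + 30) * a - 5 * e
      + 3) / 2 := by
    unfold kummerEven kummerZero
    linear_combination (3/2 * e * a ^ 5 - 67/2 * e * a ^ 4 + 379/2 * e * a ^ 3
        - 53/2 * e * a ^ 2 - 19/2 * e * a
      - 1/2 * e + 27/2 * a ^ 5 - 158 * a ^ 4 + 86 * a ^ 3 + 63 * a ^ 2 + 43/2 * a + 3/2) * he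
  intro h0
  rw [h1] at h0
  apply pow_ne_zero 5 ha
  -- The factor is the conjugate under e ↦ -1 - e; the norm of the numerator over the subfield
  -- without √5 is exactly (a² - 11a - 1)⁵.
  linear_combination ((55 * (-1 - e) + 89) * a ^ 5 + (-590 * (-1 - e) - 955) * a ^ 4
      + (-220 * (-1 - e) - 350) * a ^ 3 + (-10 * (-1 - e) - 60) * a ^ 2 + (-55 * (-1 - e) + 30) * a
      - 5 * (-1 - e) + 3) * 2 * h0 + (3025 * a ^ 10 - 64900 * a ^ 9 + 323900 * a ^ 8
      + 258500 * a ^ 7 + 54150 * a ^ 6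
      + 68750 * a ^ 5 + 30200 * a ^ 4 + 3300 * a ^ 3 + 3125 * a ^ 2 + 550 * a + 25) * he

/-- The fifth power of the resolvent descends along `λ*`. -/
theorem resolvent_pow [CharZero K] {z a x u : K} (hz : z ^ 4 + z ^ 3 + z ^ 2 + z + 1 = 0)
    (h0 : x ≠ 0) (h1 : x ≠ a) (hu : u ^ 2 - (a - 1) * x * u - a * u = x ^ 3 - a * x ^ 2) :
    resolvent z a x u ^ 5 =
      kummerFun z a (lambdaX a x) ((2 * u - (a - 1) * x - a) * lambdaXDeriv a x) := by
  have h1' : x - a ≠ 0 := sub_ne_zero.mpr h1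
  have hz5 : z ^ 5 = 1 := by linear_combination (z - 1) * hz
  -- The resolvent is split into parts p and t q Y, even and odd in Y, with e = z² + z³ and t = z² -
  -- z³. The factor z³ disappears in the fifth power.
  have hr : resolvent z a x u = z ^ 3 * (((z ^ 2 + z ^ 3 + 2) * a - (z ^ 2 + z ^ 3)) * x ^ 2
      + (a ^ 2 + (3 * (z ^ 2 + z ^ 3) + 1) * a) * x - (2 * (z ^ 2 + z ^ 3) + 1) * a ^ 2
      + (z ^ 2 - z ^ 3) * (x - (z ^ 2 + z ^ 3 + 1) * a) * (2 * u - (a - 1) * x - a))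
      / (2 * (x * (x - a))) := by
    unfold resolvent
    field_simp
    linear_combination (z ^ 5 * a ^ 2 * x + z ^ 5 * a ^ 2 - 1 * z ^ 5 * a * x - 2 * z ^ 5 * a * u
      - 1 * z ^ 4 * a ^ 2 * x - 1 * z ^ 4 * a ^ 2 + z ^ 4 * a * x + 2 * z ^ 4 * a * u
      - 1 * z ^ 3 * a ^ 2 * x - 1 * z ^ 3 * a ^ 2 + z ^ 3 * a * x + 2 * z ^ 3 * a * u
      + 2 * z ^ 2 * a ^ 2 * x + 4 * z ^ 2 * a ^ 2 - 2 * z ^ 2 * a * x ^ 2 - 6 * z ^ 2 * a * x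
      - 4 * z ^ 2 * a * u + 2 * z ^ 2 * x ^ 2 + 2 * z ^ 2 * x * u - 2 * z * a ^ 2 * x
      - 2 * z * a ^ 2 + 2 * z * a * x ^ 2 + 4 * z * a * x + 4 * z * a * u - 2 * z * x ^ 2
      - 4 * z * x * u - 2 * a * u + 2 * x * u) * hz
  have he : (z ^ 2 + z ^ 3) ^ 2 = 1 - (z ^ 2 + z ^ 3) := by
    linear_combination (z ^ 2 + z - 1) * hz
  have ht : (z ^ 2 - z ^ 3) ^ 2 = -(z ^ 2 + z ^ 3) - 3 := by
    linear_combination (z ^ 2 - 3 * z + 3) * hz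
  have hY : (2 * u - (a - 1) * x - a) ^ 2 = starCubic a x := by
    unfold starCubic
    linear_combination 4 * hu
  rw [hr, div_pow, mul_pow, ← pow_mul, show 3 * 5 = 5 * 3 from rfl, pow_mul, hz5, one_pow, one_mul,
    kummerFun]
  generalize 2 * u - (a - 1) * x - a = Y at *
  generalize z ^ 2 + z ^ 3 = e at *
  generalize z ^ 2 - z ^ 3 = t at *
  -- Expand (p + t q Y)⁵ with t² = -e - 3 and Y² = F(x): `i1` is the coefficient of tY and must
  -- match the odd part of the Kummer function, while `i0` is the even part.
  have i1 : 5 * (((e + 2) * a - e) * x ^ 2 + (a ^ 2 + (3 * e + 1) * a) * x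
      - (2 * e + 1) * a ^ 2) ^ 4 * (x - (e + 1) * a)
      + 10 * (((e + 2) * a - e) * x ^ 2 + (a ^ 2 + (3 * e + 1) * a) * x
      - (2 * e + 1) * a ^ 2) ^ 2 * (x - (e + 1) * a) ^ 3 * (-e - 3) * starCubic a x
      + (x - (e + 1) * a) ^ 5 * (-e - 3) ^ 2 * starCubic a x ^ 2 =
      32 * ((5 * e + 10) / 2)
        * (lambdaNumDeriv a x * (x * (x - a)) - 2 * lambdaNum a x * (2 * x - a))
        * (lambdaNum a x + kummerShift e a * (x * (x - a)) ^ 2) := by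
    unfold starCubic lambdaNum lambdaNumDeriv kummerShift
    linear_combination ((-1) * e ^ 5 * a ^ 9 * x ^ 4 - 4 * e ^ 5 * a ^ 9 * x ^ 3
        - 6 * e ^ 5 * a ^ 9 * x ^ 2
      - 4 * e ^ 5 * a ^ 9 * x - 1 * e ^ 5 * a ^ 9 + 12 * e ^ 5 * a ^ 8 * x ^ 4
      + 28 * e ^ 5 * a ^ 8 * x ^ 3 + 20 * e ^ 5 * a ^ 8 * x ^ 2 + 4 * e ^ 5 * a ^ 8 * x
      - 8 * e ^ 5 * a ^ 7 * x ^ 5 - 54 * e ^ 5 * a ^ 7 * x ^ 4 - 36 * e ^ 5 * a ^ 7 * x ^ 3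
      - 6 * e ^ 5 * a ^ 7 * x ^ 2 + 48 * e ^ 5 * a ^ 6 * x ^ 5 + 28 * e ^ 5 * a ^ 6 * x ^ 4
      + 4 * e ^ 5 * a ^ 6 * x ^ 3 - 16 * e ^ 5 * a ^ 5 * x ^ 6 - 8 * e ^ 5 * a ^ 5 * x ^ 5
      - 1 * e ^ 5 * a ^ 5 * x ^ 4 - 10 * e ^ 4 * a ^ 9 * x ^ 4 - 40 * e ^ 4 * a ^ 9 * x ^ 3
      - 20 * e ^ 4 * a ^ 9 * x ^ 2 + 40 * e ^ 4 * a ^ 9 * x + 30 * e ^ 4 * a ^ 9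
      + 5 * e ^ 4 * a ^ 8 * x ^ 5 + 100 * e ^ 4 * a ^ 8 * x ^ 4 + 110 * e ^ 4 * a ^ 8 * x ^ 3
      - 300 * e ^ 4 * a ^ 8 * x ^ 2 - 155 * e ^ 4 * a ^ 8 * x + 10 * e ^ 4 * a ^ 7 * x ^ 6
      - 60 * e ^ 4 * a ^ 7 * x ^ 5 - 180 * e ^ 4 * a ^ 7 * x ^ 4
      + 820 * e ^ 4 * a ^ 7 * x ^ 3 + 330 * e ^ 4 * a ^ 7 * x ^ 2
      - 40 * e ^ 4 * a ^ 6 * x ^ 6 + 110 * e ^ 4 * a ^ 6 * x ^ 5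
      - 1100 * e ^ 4 * a ^ 6 * x ^ 4 - 370 * e ^ 4 * a ^ 6 * x ^ 3
      + 40 * e ^ 4 * a ^ 5 * x ^ 7 - 20 * e ^ 4 * a ^ 5 * x ^ 6 + 780 * e ^ 4 * a ^ 5 * x ^ 5
      + 230 * e ^ 4 * a ^ 5 * x ^ 4 - 280 * e ^ 4 * a ^ 4 * x ^ 6
      - 75 * e ^ 4 * a ^ 4 * x ^ 5 + 40 * e ^ 4 * a ^ 3 * x ^ 7 + 10 * e ^ 4 * a ^ 3 * x ^ 6
      - 40 * e ^ 3 * a ^ 9 * x ^ 4 - 200 * e ^ 3 * a ^ 9 * x ^ 3 - 80 * e ^ 3 * a ^ 9 * x ^ 2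
      + 280 * e ^ 3 * a ^ 9 * x + 120 * e ^ 3 * a ^ 9 + 65 * e ^ 3 * a ^ 8 * x ^ 5
      + 460 * e ^ 3 * a ^ 8 * x ^ 4 + 350 * e ^ 3 * a ^ 8 * x ^ 3
      - 2100 * e ^ 3 * a ^ 8 * x ^ 2 - 615 * e ^ 3 * a ^ 8 * x + 80 * e ^ 3 * a ^ 7 * x ^ 6
      - 300 * e ^ 3 * a ^ 7 * x ^ 5 - 100 * e ^ 3 * a ^ 7 * x ^ 4
      + 5940 * e ^ 3 * a ^ 7 * x ^ 3 + 1300 * e ^ 3 * a ^ 7 * x ^ 2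
      - 30 * e ^ 3 * a ^ 6 * x ^ 7 - 320 * e ^ 3 * a ^ 6 * x ^ 6
      - 750 * e ^ 3 * a ^ 6 * x ^ 5 - 8620 * e ^ 3 * a ^ 6 * x ^ 4
      - 1440 * e ^ 3 * a ^ 6 * x ^ 3 - 5 * e ^ 3 * a ^ 5 * x ^ 8
      + 460 * e ^ 3 * a ^ 5 * x ^ 7 + 850 * e ^ 3 * a ^ 5 * x ^ 6
      + 7120 * e ^ 3 * a ^ 5 * x ^ 5 + 855 * e ^ 3 * a ^ 5 * x ^ 4
      - 100 * e ^ 3 * a ^ 4 * x ^ 8 - 320 * e ^ 3 * a ^ 4 * x ^ 7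
      - 3420 * e ^ 3 * a ^ 4 * x ^ 6 - 215 * e ^ 3 * a ^ 4 * x ^ 5
      + 50 * e ^ 3 * a ^ 3 * x ^ 8 + 900 * e ^ 3 * a ^ 3 * x ^ 7 - 30 * e ^ 3 * a ^ 3 * x ^ 6
      - 100 * e ^ 3 * a ^ 2 * x ^ 8 + 30 * e ^ 3 * a ^ 2 * x ^ 7 - 5 * e ^ 3 * a * x ^ 8
      - 75 * e ^ 2 * a ^ 9 * x ^ 4 - 540 * e ^ 2 * a ^ 9 * x ^ 3
      - 410 * e ^ 2 * a ^ 9 * x ^ 2 + 660 * e ^ 2 * a ^ 9 * x + 285 * e ^ 2 * a ^ 9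
      + 295 * e ^ 2 * a ^ 8 * x ^ 5 + 1440 * e ^ 2 * a ^ 8 * x ^ 4
      + 1590 * e ^ 2 * a ^ 8 * x ^ 3 - 5160 * e ^ 2 * a ^ 8 * x ^ 2
      - 1685 * e ^ 2 * a ^ 8 * x + 180 * e ^ 2 * a ^ 7 * x ^ 6 - 1300 * e ^ 2 * a ^ 7 * x ^ 5
      - 910 * e ^ 2 * a ^ 7 * x ^ 4 + 15840 * e ^ 2 * a ^ 7 * x ^ 3
      + 4270 * e ^ 2 * a ^ 7 * x ^ 2 - 250 * e ^ 2 * a ^ 6 * x ^ 7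
      - 720 * e ^ 2 * a ^ 6 * x ^ 6 - 2650 * e ^ 2 * a ^ 6 * x ^ 5
      - 25880 * e ^ 2 * a ^ 6 * x ^ 4 - 6020 * e ^ 2 * a ^ 6 * x ^ 3
      - 10 * e ^ 2 * a ^ 5 * x ^ 8 + 1960 * e ^ 2 * a ^ 5 * x ^ 7
      + 4140 * e ^ 2 * a ^ 5 * x ^ 6 + 25140 * e ^ 2 * a ^ 5 * x ^ 5
      + 5095 * e ^ 2 * a ^ 5 * x ^ 4 + 5 * e ^ 2 * a ^ 4 * x ^ 9
      - 940 * e ^ 2 * a ^ 4 * x ^ 8 - 2230 * e ^ 2 * a ^ 4 * x ^ 7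
      - 15100 * e ^ 2 * a ^ 4 * x ^ 6 - 2560 * e ^ 2 * a ^ 4 * x ^ 5
      + 100 * e ^ 2 * a ^ 3 * x ^ 9 + 520 * e ^ 2 * a ^ 3 * x ^ 8
      + 5540 * e ^ 2 * a ^ 3 * x ^ 7 + 660 * e ^ 2 * a ^ 3 * x ^ 6
      - 50 * e ^ 2 * a ^ 2 * x ^ 9 - 1140 * e ^ 2 * a ^ 2 * x ^ 8
      - 20 * e ^ 2 * a ^ 2 * x ^ 7 + 100 * e ^ 2 * a * x ^ 9 - 30 * e ^ 2 * a * x ^ 8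
      + 5 * e ^ 2 * x ^ 9 - 60 * e * a ^ 9 * x ^ 4 - 760 * e * a ^ 9 * x ^ 3
      - 920 * e * a ^ 9 * x ^ 2 + 680 * e * a ^ 9 * x + 340 * e * a ^ 9
      + 600 * e * a ^ 8 * x ^ 5 + 2720 * e * a ^ 8 * x ^ 4 + 4040 * e * a ^ 8 * x ^ 3
      - 5760 * e * a ^ 8 * x ^ 2 - 2160 * e * a ^ 8 * x - 30 * e * a ^ 7 * x ^ 6
      - 3520 * e * a ^ 7 * x ^ 5 - 5460 * e * a ^ 7 * x ^ 4 + 19400 * e * a ^ 7 * x ^ 3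
      + 6050 * e * a ^ 7 * x ^ 2 - 710 * e * a ^ 6 * x ^ 7 + 400 * e * a ^ 6 * x ^ 6
      + 380 * e * a ^ 6 * x ^ 5 - 35280 * e * a ^ 6 * x ^ 4 - 9870 * e * a ^ 6 * x ^ 3
      + 100 * e * a ^ 5 * x ^ 8 + 3560 * e * a ^ 5 * x ^ 7 + 5020 * e * a ^ 5 * x ^ 6
      + 39000 * e * a ^ 5 * x ^ 5 + 10420 * e * a ^ 5 * x ^ 4 + 25 * e * a ^ 4 * x ^ 9
      - 3140 * e * a ^ 4 * x ^ 8 - 4150 * e * a ^ 4 * x ^ 7 - 27700 * e * a ^ 4 * x ^ 6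
      - 7435 * e * a ^ 4 * x ^ 5 + 780 * e * a ^ 3 * x ^ 9 + 1220 * e * a ^ 3 * x ^ 8
      + 12860 * e * a ^ 3 * x ^ 7 + 3590 * e * a ^ 3 * x ^ 6 - 40 * e * a ^ 2 * x ^ 10
      - 130 * e * a ^ 2 * x ^ 9 - 3780 * e * a ^ 2 * x ^ 8 - 1120 * e * a ^ 2 * x ^ 7
      + 620 * e * a * x ^ 9 + 200 * e * a * x ^ 8 - 40 * e * x ^ 10 - 15 * e * x ^ 9
      - 16 * a ^ 9 * x ^ 4 - 464 * a ^ 9 * x ^ 3 - 656 * a ^ 9 * x ^ 2 + 496 * a ^ 9 * x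
      + 304 * a ^ 9 + 440 * a ^ 8 * x ^ 5 + 2032 * a ^ 8 * x ^ 4 + 3248 * a ^ 8 * x ^ 3
      - 3760 * a ^ 8 * x ^ 2 - 1976 * a ^ 8 * x - 320 * a ^ 7 * x ^ 6 - 3448 * a ^ 7 * x ^ 5
      - 6064 * a ^ 7 * x ^ 4 + 11704 * a ^ 7 * x ^ 3 + 5184 * a ^ 7 * x ^ 2
      - 660 * a ^ 6 * x ^ 7 + 1920 * a ^ 6 * x ^ 6 + 5008 * a ^ 6 * x ^ 5
      - 19792 * a ^ 6 * x ^ 4 - 6796 * a ^ 6 * x ^ 3 + 205 * a ^ 5 * x ^ 8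
      + 2220 * a ^ 5 * x ^ 7 - 1026 * a ^ 5 * x ^ 6 + 20292 * a ^ 5 * x ^ 5
      + 4109 * a ^ 5 * x ^ 4 + 31 * a ^ 4 * x ^ 9 - 3376 * a ^ 4 * x ^ 8
      - 1194 * a ^ 4 * x ^ 7 - 13896 * a ^ 4 * x ^ 6 - 29 * a ^ 4 * x ^ 5
      + 1188 * a ^ 3 * x ^ 9 + 922 * a ^ 3 * x ^ 8 + 7600 * a ^ 3 * x ^ 7
      - 1374 * a ^ 3 * x ^ 6 - 72 * a ^ 2 * x ^ 10 - 286 * a ^ 2 * x ^ 9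
      - 3824 * a ^ 2 * x ^ 8 + 666 * a ^ 2 * x ^ 7 + 32 * a * x ^ 10 + 1412 * a * x ^ 9
      - 79 * a * x ^ 8 + 16 * x ^ 11 - 232 * x ^ 10 - 9 * x ^ 9) * he
  have i0 : (((e + 2) * a - e) * x ^ 2 + (a ^ 2 + (3 * e + 1) * a) * x
      - (2 * e + 1) * a ^ 2) ^ 5
      + 10 * (((e + 2) * a - e) * x ^ 2 + (a ^ 2 + (3 * e + 1) * a) * x
      - (2 * e + 1) * a ^ 2) ^ 3 * (x - (e + 1) * a) ^ 2 * (-e - 3) * starCubic a x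
      + 5 * (((e + 2) * a - e) * x ^ 2 + (a ^ 2 + (3 * e + 1) * a) * x
      - (2 * e + 1) * a ^ 2) * (x - (e + 1) * a) ^ 4 * (-e - 3) ^ 2 * starCubic a x ^ 2 =
      32 * (x * (x - a)) ^ 5 * kummerEven e a (lambdaX a x) := by
    have j0 (A B C N : K) : 32 * (x * (x - a)) ^ 5 * ((A * (N / (x ^ 2 * (x - a) ^ 2)) ^ 2
        + B * (N / (x ^ 2 * (x - a) ^ 2)) + C) / 2) = 16 * (x * (x - a)) *
          (A * N ^ 2 + B * N * (x * (x - a)) ^ 2 + C * (x * (x - a)) ^ 4) := by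
      field_simp
      ring
    unfold lambdaX kummerEven
    rw [j0]
    unfold starCubic lambdaNum
    linear_combination ((-10) * e ^ 5 * a ^ 10 * x ^ 4 - 40 * e ^ 5 * a ^ 10 * x ^ 3
      - 60 * e ^ 5 * a ^ 10 * x ^ 2 - 40 * e ^ 5 * a ^ 10 * x - 10 * e ^ 5 * a ^ 10
      + 5 * e ^ 5 * a ^ 9 * x ^ 6 + 35 * e ^ 5 * a ^ 9 * x ^ 5 + 210 * e ^ 5 * a ^ 9 * x ^ 4
      + 390 * e ^ 5 * a ^ 9 * x ^ 3 + 265 * e ^ 5 * a ^ 9 * x ^ 2 + 55 * e ^ 5 * a ^ 9 * x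
      - 65 * e ^ 5 * a ^ 8 * x ^ 6 - 420 * e ^ 5 * a ^ 8 * x ^ 5
      - 1090 * e ^ 5 * a ^ 8 * x ^ 4 - 700 * e ^ 5 * a ^ 8 * x ^ 3
      - 125 * e ^ 5 * a ^ 8 * x ^ 2 + 40 * e ^ 5 * a ^ 7 * x ^ 7
      + 450 * e ^ 5 * a ^ 7 * x ^ 6 + 1610 * e ^ 5 * a ^ 7 * x ^ 5
      + 950 * e ^ 5 * a ^ 7 * x ^ 4 + 150 * e ^ 5 * a ^ 7 * x ^ 3
      - 280 * e ^ 5 * a ^ 6 * x ^ 7 - 1290 * e ^ 5 * a ^ 6 * x ^ 6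
      - 700 * e ^ 5 * a ^ 6 * x ^ 5 - 100 * e ^ 5 * a ^ 6 * x ^ 4
      + 80 * e ^ 5 * a ^ 5 * x ^ 8 + 520 * e ^ 5 * a ^ 5 * x ^ 7
      + 265 * e ^ 5 * a ^ 5 * x ^ 6 + 35 * e ^ 5 * a ^ 5 * x ^ 5 - 80 * e ^ 5 * a ^ 4 * x ^ 8
      - 40 * e ^ 5 * a ^ 4 * x ^ 7 - 5 * e ^ 5 * a ^ 4 * x ^ 6 + 5 * e ^ 4 * a ^ 10 * x ^ 5
      - 75 * e ^ 4 * a ^ 10 * x ^ 4 - 350 * e ^ 4 * a ^ 10 * x ^ 3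
      - 470 * e ^ 4 * a ^ 10 * x ^ 2 - 215 * e ^ 4 * a ^ 10 * x - 15 * e ^ 4 * a ^ 10
      + 55 * e ^ 4 * a ^ 9 * x ^ 6 + 340 * e ^ 4 * a ^ 9 * x ^ 5
      + 1930 * e ^ 4 * a ^ 9 * x ^ 4 + 3260 * e ^ 4 * a ^ 9 * x ^ 3
      + 1335 * e ^ 4 * a ^ 9 * x ^ 2 + 40 * e ^ 4 * a ^ 9 * x - 20 * e ^ 4 * a ^ 8 * x ^ 7
      - 745 * e ^ 4 * a ^ 8 * x ^ 6 - 4250 * e ^ 4 * a ^ 8 * x ^ 5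
      - 9640 * e ^ 4 * a ^ 8 * x ^ 4 - 3250 * e ^ 4 * a ^ 8 * x ^ 3
      + 65 * e ^ 4 * a ^ 8 * x ^ 2 - 10 * e ^ 4 * a ^ 7 * x ^ 8 + 590 * e ^ 4 * a ^ 7 * x ^ 7
      + 5130 * e ^ 4 * a ^ 7 * x ^ 6 + 15320 * e ^ 4 * a ^ 7 * x ^ 5
      + 3820 * e ^ 4 * a ^ 7 * x ^ 4 - 410 * e ^ 4 * a ^ 7 * x ^ 3
      - 70 * e ^ 4 * a ^ 6 * x ^ 8 - 3680 * e ^ 4 * a ^ 6 * x ^ 7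
      - 13870 * e ^ 4 * a ^ 6 * x ^ 6 - 1915 * e ^ 4 * a ^ 6 * x ^ 5
      + 725 * e ^ 4 * a ^ 6 * x ^ 4 - 40 * e ^ 4 * a ^ 5 * x ^ 9
      + 1420 * e ^ 4 * a ^ 5 * x ^ 8 + 7060 * e ^ 4 * a ^ 5 * x ^ 7
      - 225 * e ^ 4 * a ^ 5 * x ^ 6 - 660 * e ^ 4 * a ^ 5 * x ^ 5
      - 200 * e ^ 4 * a ^ 4 * x ^ 9 - 1860 * e ^ 4 * a ^ 4 * x ^ 8
      + 700 * e ^ 4 * a ^ 4 * x ^ 7 + 335 * e ^ 4 * a ^ 4 * x ^ 6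
      + 200 * e ^ 4 * a ^ 3 * x ^ 9 - 290 * e ^ 4 * a ^ 3 * x ^ 8
      - 90 * e ^ 4 * a ^ 3 * x ^ 7 + 40 * e ^ 4 * a ^ 2 * x ^ 9 + 10 * e ^ 4 * a ^ 2 * x ^ 8
      + 45 * e ^ 3 * a ^ 10 * x ^ 5 - 175 * e ^ 3 * a ^ 10 * x ^ 4
      - 1270 * e ^ 3 * a ^ 10 * x ^ 3 - 1750 * e ^ 3 * a ^ 10 * x ^ 2
      - 615 * e ^ 3 * a ^ 10 * x + 53 * e ^ 3 * a ^ 10 + 225 * e ^ 3 * a ^ 9 * x ^ 6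
      + 1330 * e ^ 3 * a ^ 9 * x ^ 5 + 7510 * e ^ 3 * a ^ 9 * x ^ 4
      + 12840 * e ^ 3 * a ^ 9 * x ^ 3 + 3585 * e ^ 3 * a ^ 9 * x ^ 2
      - 450 * e ^ 3 * a ^ 9 * x - 230 * e ^ 3 * a ^ 8 * x ^ 7 - 3585 * e ^ 3 * a ^ 8 * x ^ 6
      - 18750 * e ^ 3 * a ^ 8 * x ^ 5 - 39800 * e ^ 3 * a ^ 8 * x ^ 4
      - 8340 * e ^ 3 * a ^ 8 * x ^ 3 + 1665 * e ^ 3 * a ^ 8 * x ^ 2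
      - 70 * e ^ 3 * a ^ 7 * x ^ 8 + 3740 * e ^ 3 * a ^ 7 * x ^ 7
      + 25910 * e ^ 3 * a ^ 7 * x ^ 6 + 68000 * e ^ 3 * a ^ 7 * x ^ 5
      + 9060 * e ^ 3 * a ^ 7 * x ^ 4 - 3520 * e ^ 3 * a ^ 7 * x ^ 3
      + 20 * e ^ 3 * a ^ 6 * x ^ 9 - 1060 * e ^ 3 * a ^ 6 * x ^ 8
      - 21580 * e ^ 3 * a ^ 6 * x ^ 7 - 69770 * e ^ 3 * a ^ 6 * x ^ 6
      - 2555 * e ^ 3 * a ^ 6 * x ^ 5 + 4675 * e ^ 3 * a ^ 6 * x ^ 4 + e ^ 3 * a ^ 5 * x ^ 10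
      - 325 * e ^ 3 * a ^ 5 * x ^ 9 + 10750 * e ^ 3 * a ^ 5 * x ^ 8
      + 43710 * e ^ 3 * a ^ 5 * x ^ 7 - 4690 * e ^ 3 * a ^ 5 * x ^ 6
      - 4027 * e ^ 3 * a ^ 5 * x ^ 5 + 75 * e ^ 3 * a ^ 4 * x ^ 10
      - 2820 * e ^ 3 * a ^ 4 * x ^ 9 - 16150 * e ^ 3 * a ^ 4 * x ^ 8
      + 5910 * e ^ 3 * a ^ 4 * x ^ 7 + 2230 * e ^ 3 * a ^ 4 * x ^ 6
      + 250 * e ^ 3 * a ^ 3 * x ^ 10 + 3170 * e ^ 3 * a ^ 3 * x ^ 9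
      - 3040 * e ^ 3 * a ^ 3 * x ^ 8 - 750 * e ^ 3 * a ^ 3 * x ^ 7
      - 250 * e ^ 3 * a ^ 2 * x ^ 10 + 760 * e ^ 3 * a ^ 2 * x ^ 9
      + 130 * e ^ 3 * a ^ 2 * x ^ 8 - 75 * e ^ 3 * a * x ^ 10 - 5 * e ^ 3 * a * x ^ 9
      - 1 * e ^ 3 * x ^ 10 + 155 * e ^ 2 * a ^ 10 * x ^ 5 - 15 * e ^ 2 * a ^ 10 * x ^ 4
      - 2330 * e ^ 2 * a ^ 10 * x ^ 3 - 3830 * e ^ 2 * a ^ 10 * x ^ 2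
      - 1425 * e ^ 2 * a ^ 10 * x + 117 * e ^ 2 * a ^ 10 + 390 * e ^ 2 * a ^ 9 * x ^ 6
      + 2495 * e ^ 2 * a ^ 9 * x ^ 5 + 15480 * e ^ 2 * a ^ 9 * x ^ 4
      + 29610 * e ^ 2 * a ^ 9 * x ^ 3 + 8890 * e ^ 2 * a ^ 9 * x ^ 2
      - 865 * e ^ 2 * a ^ 9 * x - 990 * e ^ 2 * a ^ 8 * x ^ 7 - 9030 * e ^ 2 * a ^ 8 * x ^ 6
      - 45230 * e ^ 2 * a ^ 8 * x ^ 5 - 96630 * e ^ 2 * a ^ 8 * x ^ 4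
      - 24260 * e ^ 2 * a ^ 8 * x ^ 3 + 3020 * e ^ 2 * a ^ 8 * x ^ 2
      - 70 * e ^ 2 * a ^ 7 * x ^ 8 + 12620 * e ^ 2 * a ^ 7 * x ^ 7
      + 72680 * e ^ 2 * a ^ 7 * x ^ 6 + 178550 * e ^ 2 * a ^ 7 * x ^ 5
      + 36890 * e ^ 2 * a ^ 7 * x ^ 4 - 6550 * e ^ 2 * a ^ 7 * x ^ 3
      + 165 * e ^ 2 * a ^ 6 * x ^ 9 - 6185 * e ^ 2 * a ^ 6 * x ^ 8
      - 71090 * e ^ 2 * a ^ 6 * x ^ 7 - 207230 * e ^ 2 * a ^ 6 * x ^ 6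
      - 32060 * e ^ 2 * a ^ 6 * x ^ 5 + 9640 * e ^ 2 * a ^ 6 * x ^ 4
      - 1 * e ^ 2 * a ^ 5 * x ^ 10 - 460 * e ^ 2 * a ^ 5 * x ^ 9
      + 44470 * e ^ 2 * a ^ 5 * x ^ 8 + 155700 * e ^ 2 * a ^ 5 * x ^ 7
      + 12825 * e ^ 2 * a ^ 5 * x ^ 6 - 9853 * e ^ 2 * a ^ 5 * x ^ 5
      + 615 * e ^ 2 * a ^ 4 * x ^ 10 - 17010 * e ^ 2 * a ^ 4 * x ^ 9
      - 74540 * e ^ 2 * a ^ 4 * x ^ 8 + 2500 * e ^ 2 * a ^ 4 * x ^ 7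
      + 6935 * e ^ 2 * a ^ 4 * x ^ 6 - 40 * e ^ 2 * a ^ 3 * x ^ 11
      + 3230 * e ^ 2 * a ^ 3 * x ^ 10 + 21500 * e ^ 2 * a ^ 3 * x ^ 9
      - 5400 * e ^ 2 * a ^ 3 * x ^ 8 - 3260 * e ^ 2 * a ^ 3 * x ^ 7
      - 200 * e ^ 2 * a ^ 2 * x ^ 11 - 3330 * e ^ 2 * a ^ 2 * x ^ 10
      + 2525 * e ^ 2 * a ^ 2 * x ^ 9 + 965 * e ^ 2 * a ^ 2 * x ^ 8 + 200 * e ^ 2 * a * x ^ 11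
      - 525 * e ^ 2 * a * x ^ 10 - 160 * e ^ 2 * a * x ^ 9 + 40 * e ^ 2 * x ^ 11
      + 11 * e ^ 2 * x ^ 10 + 260 * e * a ^ 10 * x ^ 5 + 500 * e * a ^ 10 * x ^ 4
      - 2160 * e * a ^ 10 * x ^ 3 - 4720 * e * a ^ 10 * x ^ 2 - 2020 * e * a ^ 10 * x
      + 76 * e * a ^ 10 + 180 * e * a ^ 9 * x ^ 6 + 2000 * e * a ^ 9 * x ^ 5
      + 17440 * e * a ^ 9 * x ^ 4 + 39360 * e * a ^ 9 * x ^ 3 + 14140 * e * a ^ 9 * x ^ 2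
      - 240 * e * a ^ 9 * x - 1990 * e * a ^ 8 * x ^ 7 - 12310 * e * a ^ 8 * x ^ 6
      - 61780 * e * a ^ 8 * x ^ 5 - 138540 * e * a ^ 8 * x ^ 4 - 46110 * e * a ^ 8 * x ^ 3
      - 230 * e * a ^ 8 * x ^ 2 + 480 * e * a ^ 7 * x ^ 8 + 23550 * e * a ^ 7 * x ^ 7
      + 117360 * e * a ^ 7 * x ^ 6 + 281140 * e * a ^ 7 * x ^ 5 + 91080 * e * a ^ 7 * x ^ 4
      + 2190 * e * a ^ 7 * x ^ 3 + 465 * e * a ^ 6 * x ^ 9 - 17495 * e * a ^ 6 * x ^ 8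
      - 136050 * e * a ^ 6 * x ^ 7 - 369090 * e * a ^ 6 * x ^ 6 - 117915 * e * a ^ 6 * x ^ 5
      - 4395 * e * a ^ 6 * x ^ 4 - 43 * e * a ^ 5 * x ^ 10 + 2450 * e * a ^ 5 * x ^ 9
      + 104750 * e * a ^ 5 * x ^ 8 + 325660 * e * a ^ 5 * x ^ 7 + 101505 * e * a ^ 5 * x ^ 6
      + 4386 * e * a ^ 5 * x ^ 5 + 1585 * e * a ^ 4 * x ^ 10 - 53370 * e * a ^ 4 * x ^ 9
      - 191860 * e * a ^ 4 * x ^ 8 - 56740 * e * a ^ 4 * x ^ 7 - 2275 * e * a ^ 4 * x ^ 6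
      - 280 * e * a ^ 3 * x ^ 11 + 15850 * e * a ^ 3 * x ^ 10 + 72680 * e * a ^ 3 * x ^ 9
      + 19210 * e * a ^ 3 * x ^ 8 + 410 * e * a ^ 3 * x ^ 7 - 2120 * e * a ^ 2 * x ^ 11
      - 16510 * e * a ^ 2 * x ^ 10 - 3255 * e * a ^ 2 * x ^ 9 + 155 * e * a ^ 2 * x ^ 8
      + 80 * e * a * x ^ 12 + 1960 * e * a * x ^ 11 + 65 * e * a * x ^ 10
      - 90 * e * a * x ^ 9 - 80 * e * x ^ 12 + 40 * e * x ^ 11 + 13 * e * x ^ 10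
      + 240 * a ^ 10 * x ^ 5 + 720 * a ^ 10 * x ^ 4 - 1280 * a ^ 10 * x ^ 3
      - 3840 * a ^ 10 * x ^ 2 - 1840 * a ^ 10 * x + 16 * a ^ 10 - 200 * a ^ 9 * x ^ 6
      + 360 * a ^ 9 * x ^ 5 + 12160 * a ^ 9 * x ^ 4 + 33280 * a ^ 9 * x ^ 3
      + 13400 * a ^ 9 * x ^ 2 + 200 * a ^ 9 * x - 2000 * a ^ 8 * x ^ 7 - 9360 * a ^ 8 * x ^ 6
      - 50600 * a ^ 8 * x ^ 5 - 122680 * a ^ 8 * x ^ 4 - 46600 * a ^ 8 * x ^ 3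
      - 1800 * a ^ 8 * x ^ 2 + 1340 * a ^ 7 * x ^ 8 + 24460 * a ^ 7 * x ^ 7
      + 110800 * a ^ 7 * x ^ 6 + 265640 * a ^ 7 * x ^ 5 + 100980 * a ^ 7 * x ^ 4
      + 5900 * a ^ 7 * x ^ 3 + 515 * a ^ 6 * x ^ 9 - 25235 * a ^ 6 * x ^ 8
      - 148730 * a ^ 6 * x ^ 7 - 381990 * a ^ 6 * x ^ 6 - 148065 * a ^ 6 * x ^ 5
      - 10815 * a ^ 6 * x ^ 4 - 138 * a ^ 5 * x ^ 10 + 8575 * a ^ 5 * x ^ 9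
      + 136640 * a ^ 5 * x ^ 8 + 380130 * a ^ 5 * x ^ 7 + 150450 * a ^ 5 * x ^ 6
      + 12591 * a ^ 5 * x ^ 5 + 1120 * a ^ 4 * x ^ 10 - 87690 * a ^ 4 * x ^ 9
      - 260410 * a ^ 4 * x ^ 8 - 105830 * a ^ 4 * x ^ 7 - 9790 * a ^ 4 * x ^ 6
      - 640 * a ^ 3 * x ^ 11 + 35660 * a ^ 3 * x ^ 10 + 118830 * a ^ 3 * x ^ 9
      + 50620 * a ^ 3 * x ^ 8 + 5130 * a ^ 3 * x ^ 7 - 7520 * a ^ 2 * x ^ 11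
      - 34160 * a ^ 2 * x ^ 10 - 15785 * a ^ 2 * x ^ 9 - 1755 * a ^ 2 * x ^ 8
      + 560 * a * x ^ 12 + 5600 * a * x ^ 11 + 2910 * a * x ^ 10 + 355 * a * x ^ 9
      - 400 * x ^ 12 - 240 * x ^ 11 - 32 * x ^ 10) * he
  have j1 : 32 * (x * (x - a)) ^ 5 * (((5 * e + 10) / 2)
      * (lambdaXDeriv a x * (lambdaX a x + kummerShift e a))) = 32 * ((5 * e + 10) / 2)
        * (lambdaNumDeriv a x * (x * (x - a)) - 2 * lambdaNum a x * (2 * x - a))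
        * (lambdaNum a x + kummerShift e a * (x * (x - a)) ^ 2) := by
    unfold lambdaXDeriv lambdaX
    field_simp
  rw [← j1] at i1
  generalize ((e + 2) * a - e) * x ^ 2 + (a ^ 2 + (3 * e + 1) * a) * x
    - (2 * e + 1) * a ^ 2 = p at *
  generalize x - (e + 1) * a = q at *
  have hne : (2 * (x * (x - a))) ^ 5 ≠ 0 :=
    pow_ne_zero 5 (mul_ne_zero two_ne_zero (mul_ne_zero h0 h1'))
  rw [div_eq_iff hne]
  have hT : t ^ 2 * Y ^ 2 = (-e - 3) * starCubic a x := by rw [ht, hY]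
  linear_combination i0 + t * Y * i1 + (10 * p ^ 3 * q ^ 2
    + 5 * p * q ^ 4 * (t ^ 2 * Y ^ 2 + (-e - 3) * starCubic a x) + t * Y * (10 * p ^ 2 * q ^ 3
    + q ^ 5 * (t ^ 2 * Y ^ 2 + (-e - 3) * starCubic a x))) * hT

end Algebra

/-! ### Models with completed square and the group law in their coordinates. -/

open WeierstrassCurve in
/-- `Y² = 4 X³ + B₂ X² + B₄ X + B₆` is a model of the curve `W`, by means of the substitution
`x = t² X + r`, `y = t³ Y / 2`. -/
structure IsModel {K : Type*} [Field K] (W : Affine K) (t r B₂ B₄ B₆ : K) : Prop where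
  a₁ : W.a₁ = 0
  a₃ : W.a₃ = 0
  a₂ : W.a₂ + 3 * r = t ^ 2 * B₂ / 4
  a₄ : W.a₄ + 2 * W.a₂ * r + 3 * r ^ 2 = t ^ 4 * B₄ / 4
  a₆ : W.a₆ + W.a₄ * r + W.a₂ * r ^ 2 + r ^ 3 = t ^ 6 * B₆ / 4
  t_ne : t ≠ 0
  Δ_ne : WeierstrassCurve.Δ W ≠ 0

/-- The point `P` has coordinates `(X, Y)` in the model with `x = t² X + r`, `y = t³ Y / 2`. -/
def HasCoords {K : Type*} [Field K] (W : WeierstrassCurve.Affine K) (t r : K) (P : W.Point)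
    (X Y : K) : Prop :=
  ∃ h, P = .some (t ^ 2 * X + r) (t ^ 3 * Y / 2) h

section Model

variable {K : Type*} [Field K] {W : WeierstrassCurve.Affine K} {t r B₂ B₄ B₆ : K}

theorem HasCoords.ne_zero {P : W.Point} {X Y : K} (h : HasCoords W t r P X Y) : P ≠ 0 := by
  obtain ⟨h, rfl⟩ := h
  exact WeierstrassCurve.Affine.Point.some_ne_zero h

theorem HasCoords.ext {P Q : W.Point} {X Y : K} (h : HasCoords W t r P X Y)
    (h' : HasCoords W t r Q X Y) : P = Q := by
  obtain ⟨_, rfl⟩ := h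
  obtain ⟨_, rfl⟩ := h'
  rfl

variable [CharZero K]

theorem IsModel.equation_iff (M : IsModel W t r B₂ B₄ B₆) (X Y : K) :
    W.Equation (t ^ 2 * X + r) (t ^ 3 * Y / 2) ↔
      Y ^ 2 = 4 * X ^ 3 + B₂ * X ^ 2 + B₄ * X + B₆ := by
  rw [WeierstrassCurve.Affine.equation_iff, M.a₁, M.a₃]
  have ht : t ^ 6 / 4 ≠ 0 := div_ne_zero (pow_ne_zero 6 M.t_ne) (by norm_num)
  constructor
  · intro h
    apply mul_left_cancel₀ ht
    linear_combination h + t ^ 4 * X ^ 2 * M.a₂ + t ^ 2 * X * M.a₄ + M.a₆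
  · intro h
    linear_combination t ^ 6 / 4 * h - t ^ 4 * X ^ 2 * M.a₂ - t ^ 2 * X * M.a₄ - M.a₆

theorem IsModel.exists_point (M : IsModel W t r B₂ B₄ B₆) {X Y : K}
    (h : Y ^ 2 = 4 * X ^ 3 + B₂ * X ^ 2 + B₄ * X + B₆) : ∃ P : W.Point, HasCoords W t r P X Y :=
  ⟨.some _ _ ((WeierstrassCurve.Affine.equation_iff_nonsingular_of_Δ_ne_zero M.Δ_ne).mp
    ((M.equation_iff X Y).mpr h)), _, rfl⟩

theorem HasCoords.equation {P : W.Point} {X Y : K} (h : HasCoords W t r P X Y)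
    (M : IsModel W t r B₂ B₄ B₆) : Y ^ 2 = 4 * X ^ 3 + B₂ * X ^ 2 + B₄ * X + B₆ := by
  obtain ⟨h, -⟩ := h
  exact (M.equation_iff X Y).mp h.1

theorem IsModel.exists_coords (M : IsModel W t r B₂ B₄ B₆) {P : W.Point} (hP : P ≠ 0) :
    ∃ X Y, HasCoords W t r P X Y := by
  match P, hP with
  | .zero, hP => exact absurd rfl hP
  | .some x y h, _ =>
    have ht := M.t_ne
    have e1 : t ^ 2 * ((x - r) / t ^ 2) + r = x := by field_simp; ring
    have e2 : t ^ 3 * (2 * y / t ^ 3) / 2 = y := by field_simp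
    refine ⟨(x - r) / t ^ 2, 2 * y / t ^ 3, ?_⟩
    unfold HasCoords
    rw [e1, e2]
    exact ⟨h, rfl⟩

theorem HasCoords.unique {P : W.Point} {X Y X' Y' : K} (h : HasCoords W t r P X Y)
    (h' : HasCoords W t r P X' Y') (ht : t ≠ 0) : X = X' ∧ Y = Y' := by
  obtain ⟨_, rfl⟩ := h
  obtain ⟨_, h⟩ := h'
  rw [WeierstrassCurve.Affine.Point.some.injEq] at h
  exact ⟨mul_left_cancel₀ (pow_ne_zero 2 ht) (add_right_cancel h.1),
    mul_left_cancel₀ (pow_ne_zero 3 ht) ((div_left_inj' two_ne_zero).mp h.2)⟩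

theorem HasCoords.neg {P : W.Point} {X Y : K} (h : HasCoords W t r P X Y)
    (M : IsModel W t r B₂ B₄ B₆) : HasCoords W t r (-P) X (-Y) := by
  obtain ⟨h, rfl⟩ := h
  rw [WeierstrassCurve.Affine.Point.neg_some]
  have e : W.negY (t ^ 2 * X + r) (t ^ 3 * Y / 2) = t ^ 3 * (-Y) / 2 := by
    rw [WeierstrassCurve.Affine.negY, M.a₁, M.a₃]; ring
  have h' := (WeierstrassCurve.Affine.nonsingular_neg _ _).mpr h
  rw [e] at h'
  exact ⟨h', by simp only [e]⟩

theorem HasCoords.eq_or_eq_neg {P Q : W.Point} {X Y Y' : K} (h : HasCoords W t r P X Y)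
    (h' : HasCoords W t r Q X Y') (M : IsModel W t r B₂ B₄ B₆) : Q = P ∨ Q = -P := by
  have e : Y' ^ 2 = Y ^ 2 := by rw [h.equation M, h'.equation M]
  rcases sq_eq_sq_iff_eq_or_eq_neg.mp e with rfl | rfl
  · exact .inl (h'.ext h)
  · exact .inr (h'.ext (h.neg M))

variable [DecidableEq K]

/-- Chord and tangent are treated together. Under x = t²X + r, y = t³Y/2, slopes scale by t/2, so m
is the slope in the model. -/
theorem HasCoords.add_of_slope {P Q : W.Point} {X₁ Y₁ X₂ Y₂ m : K} (h₁ : HasCoords W t r P X₁ Y₁)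
    (h₂ : HasCoords W t r Q X₂ Y₂) (M : IsModel W t r B₂ B₄ B₆)
    (hne : ¬(t ^ 2 * X₁ + r = t ^ 2 * X₂ + r ∧
      t ^ 3 * Y₁ / 2 = W.negY (t ^ 2 * X₂ + r) (t ^ 3 * Y₂ / 2)))
    (hm : W.slope (t ^ 2 * X₁ + r) (t ^ 2 * X₂ + r) (t ^ 3 * Y₁ / 2) (t ^ 3 * Y₂ / 2) =
      t * m / 2) :
    HasCoords W t r (P + Q) ((m ^ 2 - B₂) / 4 - X₁ - X₂)
      (-(m * ((m ^ 2 - B₂) / 4 - X₁ - X₂ - X₁) + Y₁)) := by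
  obtain ⟨h₁, rfl⟩ := h₁
  obtain ⟨h₂, rfl⟩ := h₂
  rw [WeierstrassCurve.Affine.Point.add_some hne]
  have hns := WeierstrassCurve.Affine.nonsingular_add h₁ h₂ hne
  rw [hm] at hns
  have e1 : W.addX (t ^ 2 * X₁ + r) (t ^ 2 * X₂ + r) (t * m / 2) =
      t ^ 2 * ((m ^ 2 - B₂) / 4 - X₁ - X₂) + r := by
    rw [WeierstrassCurve.Affine.addX, M.a₁]
    linear_combination -M.a₂
  have e2 : W.addY (t ^ 2 * X₁ + r) (t ^ 2 * X₂ + r) (t ^ 3 * Y₁ / 2) (t * m / 2) =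
      t ^ 3 * (-(m * ((m ^ 2 - B₂) / 4 - X₁ - X₂ - X₁) + Y₁)) / 2 := by
    rw [WeierstrassCurve.Affine.addY, WeierstrassCurve.Affine.negAddY,
      WeierstrassCurve.Affine.negY, e1, M.a₁, M.a₃]
    ring
  rw [e1, e2] at hns
  exact ⟨hns, by simp only [hm, e1, e2]⟩

theorem HasCoords.add {P Q : W.Point} {X₁ Y₁ X₂ Y₂ : K} (h₁ : HasCoords W t r P X₁ Y₁)
    (h₂ : HasCoords W t r Q X₂ Y₂) (M : IsModel W t r B₂ B₄ B₆) (hX : X₁ ≠ X₂) {m : K}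
    (hm : m = (Y₁ - Y₂) / (X₁ - X₂)) :
    HasCoords W t r (P + Q) ((m ^ 2 - B₂) / 4 - X₁ - X₂)
      (-(m * ((m ^ 2 - B₂) / 4 - X₁ - X₂ - X₁) + Y₁)) := by
  have ht := M.t_ne
  have hx : t ^ 2 * X₁ + r ≠ t ^ 2 * X₂ + r := fun h =>
    hX (mul_left_cancel₀ (pow_ne_zero 2 ht) (add_right_cancel h))
  refine h₁.add_of_slope h₂ M (fun h => hx h.1) ?_
  have h1 : X₁ - X₂ ≠ 0 := sub_ne_zero.mpr hX
  have h2 : t ^ 2 * X₁ + r - (t ^ 2 * X₂ + r) = t ^ 2 * (X₁ - X₂) := by ring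
  rw [WeierstrassCurve.Affine.slope_of_X_ne hx, hm, h2]
  field_simp

theorem HasCoords.add_self {P : W.Point} {X₁ Y₁ : K} (h₁ : HasCoords W t r P X₁ Y₁)
    (M : IsModel W t r B₂ B₄ B₆) (hY : Y₁ ≠ 0) {m : K}
    (hm : m = (12 * X₁ ^ 2 + 2 * B₂ * X₁ + B₄) / (2 * Y₁)) :
    HasCoords W t r (P + P) ((m ^ 2 - B₂) / 4 - X₁ - X₁)
      (-(m * ((m ^ 2 - B₂) / 4 - X₁ - X₁ - X₁) + Y₁)) := by
  have ht := M.t_ne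
  have hn : W.negY (t ^ 2 * X₁ + r) (t ^ 3 * Y₁ / 2) = -(t ^ 3 * Y₁ / 2) := by
    rw [WeierstrassCurve.Affine.negY, M.a₁, M.a₃]; ring
  have h2 : t ^ 3 * Y₁ / 2 - -(t ^ 3 * Y₁ / 2) = t ^ 3 * Y₁ := by ring
  have hy : t ^ 3 * Y₁ / 2 ≠ W.negY (t ^ 2 * X₁ + r) (t ^ 3 * Y₁ / 2) := by
    rw [← sub_ne_zero, hn, h2]
    exact mul_ne_zero (pow_ne_zero 3 ht) hY
  refine h₁.add_of_slope h₁ M (fun h => hy h.2) ?_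
  rw [WeierstrassCurve.Affine.slope_of_Y_ne rfl hy, hn, h2, hm, M.a₁]
  field_simp
  linear_combination 4 * M.a₄ + 8 * t ^ 2 * X₁ * M.a₂

end Model

/-! ### The curves `E*_{a,b}` and `E_{a,b}` as twists of `E*_a` and `E_a` by √d. -/

section Curves

theorem Estar_Δ (a b : ℚ) :
    (Estar a b).Δ = 2 ^ 12 * 5 ^ 12 * d a b ^ 6 * a ^ 5 * (a ^ 2 - 11 * a - 1) := by
  simp only [WeierstrassCurve.Δ, WeierstrassCurve.b₂, WeierstrassCurve.b₄, WeierstrassCurve.b₆,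
    WeierstrassCurve.b₈, Estar]
  generalize d a b = d
  ring

theorem starCubic_eq {K : Type*} [Field K] (a X : K) : starCubic a X =
    4 * X ^ 3 + ((a - 1) ^ 2 - 4 * a) * X ^ 2 + 2 * a * (a - 1) * X + a ^ 2 := by
  unfold starCubic; ring

theorem baseCubic_eq {K : Type*} [Field K] (a v : K) : baseCubic a v =
    4 * v ^ 3 + ((a - 1) ^ 2 - 4 * a) * v ^ 2
      + (2 * a * (a - 1) - 20 * a * (a ^ 2 + 2 * a - 1)) * v
      + (a ^ 2 - 4 * a * (a ^ 4 + 10 * a ^ 3 - 5 * a ^ 2 + 15 * a - 1)) := by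
  unfold baseCubic; ring

variable {K : Type*} [Field K] [Algebra ℚ K]

/-- The substitution for x inverts `twistX` and involves only δ² = d, whereas y = (10δ)³Y/2 is odd
in δ. Hence X is defined without √d, and an automorphism with δ ↦ -δ changes the sign of Y. -/
theorem Estar_isModel {a b : ℚ} (ha : a ≠ 0) (hd : d a b ≠ 0) {A D δ : K}
    (hA : algebraMap ℚ K a = A) (hD : algebraMap ℚ K (d a b) = D) (hδ : δ ^ 2 = D) :
    IsModel ((Estar a b).baseChange K).toAffine (10 * δ) (8 * D * (A ^ 2 - 5 * A + 1))
      ((A - 1) ^ 2 - 4 * A) (2 * A * (A - 1)) (A ^ 2) := by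
  have : CharZero K := algebraRat.charZero K
  have hD0 : D ≠ 0 := by rwa [← hD, _root_.map_ne_zero]
  have hδ0 : δ ≠ 0 := by rintro rfl; apply hD0; rw [← hδ]; simp
  refine ⟨?_, ?_, ?_, ?_, ?_, mul_ne_zero (by norm_num) hδ0, ?_⟩
  case refine_6 =>
    rw [WeierstrassCurve.baseChange, WeierstrassCurve.map_Δ, Estar_Δ, _root_.map_ne_zero]
    have := quadratic_ne_zero a
    positivity
  all_goals
    simp only [WeierstrassCurve.baseChange, WeierstrassCurve.map, Estar, map_mul, map_add,
      map_sub, map_neg, map_pow, map_ofNat, map_zero, map_one, hA, hD]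
  · subst hδ; ring
  · subst hδ; ring
  · subst hδ; ring

theorem E_isModel {a b : ℚ} (ha : a ≠ 0) (hd : d a b ≠ 0) {A D δ : K}
    (hA : algebraMap ℚ K a = A) (hD : algebraMap ℚ K (d a b) = D) (hδ : δ ^ 2 = D) :
    IsModel ((E a b).baseChange K).toAffine (2 * δ) (8 * D * A)
      ((A - 1) ^ 2 - 4 * A) (2 * A * (A - 1) - 20 * A * (A ^ 2 + 2 * A - 1))
      (A ^ 2 - 4 * A * (A ^ 4 + 10 * A ^ 3 - 5 * A ^ 2 + 15 * A - 1)) := by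
  have : CharZero K := algebraRat.charZero K
  have hD0 : D ≠ 0 := by rwa [← hD, _root_.map_ne_zero]
  have hδ0 : δ ≠ 0 := by rintro rfl; apply hD0; rw [← hδ]; simp
  refine ⟨?_, ?_, ?_, ?_, ?_, mul_ne_zero (by norm_num) hδ0, ?_⟩
  case refine_6 =>
    rw [WeierstrassCurve.baseChange, WeierstrassCurve.map_Δ, E_Δ, _root_.map_ne_zero]
    have := quadratic_ne_zero a
    positivity
  all_goals
    simp only [WeierstrassCurve.baseChange, WeierstrassCurve.map, E, map_mul, map_add,
      map_sub, map_neg, map_pow, map_ofNat, map_zero, map_one, hA, hD]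
  · subst hδ; ring
  · subst hδ; ring
  · subst hδ; ring

variable {a b : ℚ}

/-- The point `R` of `E*_{a,b}` has coordinates `(X, Y)` on the model `Y² = F(X)` of `E*_a`. -/
def StarCoords (a b : ℚ) (δ : K) (R : EstarPoint a b K) (X Y : K) : Prop :=
  HasCoords ((Estar a b).baseChange K).toAffine (10 * δ)
    (8 * algebraMap ℚ K (d a b) * (algebraMap ℚ K a ^ 2 - 5 * algebraMap ℚ K a + 1)) R X Y

/-- The point `P` of `E_{a,b}` has coordinates `(v, w)` on the model `w² = G(v)` of `E_a`. -/
def BaseCoords (a b : ℚ) (δ : K) (P : EPoint a b K) (v w : K) : Prop :=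
  HasCoords ((E a b).baseChange K).toAffine (2 * δ)
    (8 * algebraMap ℚ K (d a b) * algebraMap ℚ K a) P v w

theorem twistX_eq (hd : d a b ≠ 0) {δ : K} (hδ : δ ^ 2 = algebraMap ℚ K (d a b)) (X : K) :
    twistX (algebraMap ℚ K a) (algebraMap ℚ K (d a b)) ((10 * δ) ^ 2 * X +
      8 * algebraMap ℚ K (d a b) * (algebraMap ℚ K a ^ 2 - 5 * algebraMap ℚ K a + 1)) = X := by
  have : CharZero K := algebraRat.charZero K
  have hD0 : algebraMap ℚ K (d a b) ≠ 0 := by rwa [_root_.map_ne_zero]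
  rw [mul_pow, hδ]
  unfold twistX
  field_simp
  ring

theorem StarCoords.dualIsogeny_eq_zero (ha : a ≠ 0) (hd : d a b ≠ 0) {δ : K}
    (hδ : δ ^ 2 = algebraMap ℚ K (d a b)) {R : EstarPoint a b K} {X Y : K}
    (h : StarCoords a b δ R X Y) (hX : X = 0 ∨ X = algebraMap ℚ K a) :
    dualIsogeny ha hd K R = 0 := by
  obtain ⟨h, rfl⟩ := h
  unfold dualIsogeny
  simp only
  rw [dif_neg]
  rw [twistX_eq hd hδ]
  tauto

/-- In model coordinates φ* is simply (λ(X), Y λ'(X)): the factor 1/125 turns (10δ)³ into (2δ)³, so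
the same δ serves for both curves. -/
theorem StarCoords.dualIsogeny (ha : a ≠ 0) (hd : d a b ≠ 0) {δ : K}
    (hδ : δ ^ 2 = algebraMap ℚ K (d a b)) {R : EstarPoint a b K} {X Y : K}
    (h : StarCoords a b δ R X Y) (h0 : X ≠ 0) (h1 : X ≠ algebraMap ℚ K a) :
    BaseCoords a b δ (dualIsogeny ha hd K R) (lambdaX (algebraMap ℚ K a) X)
      (Y * lambdaXDeriv (algebraMap ℚ K a) X) := by
  have : CharZero K := algebraRat.charZero K
  obtain ⟨h, rfl⟩ := h
  have e := twistX_eq hd hδ X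
  have hX := e ▸ (⟨h0, h1⟩ : X ≠ 0 ∧ X ≠ algebraMap ℚ K a)
  have hns := dualIsogeny_nonsingular ha hd h hX
  unfold Brumer.dualIsogeny BaseCoords
  simp only
  rw [dif_pos hX]
  rw [e] at hns
  have e1 : 4 * algebraMap ℚ K (d a b) * (lambdaX (algebraMap ℚ K a) X + 2 * algebraMap ℚ K a) =
      (2 * δ) ^ 2 * lambdaX (algebraMap ℚ K a) X
        + 8 * algebraMap ℚ K (d a b) * algebraMap ℚ K a := by
    rw [← hδ]; ring
  have e2 : (10 * δ) ^ 3 * Y / 2 / 125 * lambdaXDeriv (algebraMap ℚ K a) X =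
      (2 * δ) ^ 3 * (Y * lambdaXDeriv (algebraMap ℚ K a) X) / 2 := by
    ring
  rw [e1, e2] at hns
  exact ⟨hns, by simp only [e, e1, e2]⟩

end Curves

/-- A map of abelian groups with finite fibres that is invariant under translation by its zeros and
additive on generic pairs is additive. -/
theorem map_add_of_generic {A B : Type*} [AddCommGroup A] [AddCommGroup B] [Infinite A] (f : A → B)
    (hneg : ∀ P, f (-P) = -f P) (hfib : ∀ Q, {R | f R = Q}.Finite)
    (htr : ∀ R T, f T = 0 → f (R + T) = f R)
    (hgen : ∀ P Q, f P ≠ 0 → f Q ≠ 0 → f (P + Q) ≠ 0 → f Q ≠ f P → f Q ≠ -f P →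
      f (P + Q) = f P + f Q) (P Q : A) : f (P + Q) = f P + f Q := by
  by_cases hP : f P = 0
  · rw [add_comm P, htr _ _ hP, hP, zero_add]
  by_cases hQ : f Q = 0
  · rw [htr _ _ hQ, hQ, add_zero]
  by_cases hPQ : f (P + Q) = 0
  -- Translating -P by the zero P + Q of f gives f Q = f (-P).
  · have := htr (-P) _ hPQ
    rw [neg_add_cancel_left, hneg] at this
    rw [hPQ, this, add_neg_cancel]
  have hfin (S : A) (Z : B) : {R | f (S + R) = Z}.Finite :=
    (hfib Z).preimage (add_right_injective S).injOn
  -- An auxiliary R off nine finite sets makes the pairs (P + Q, R), (Q, R) and (P, Q + R) generic.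
  -- Then f(P + Q + R) is computed in two ways and f R is cancelled.
  obtain ⟨R, hR⟩ := ((hfin 0 0).union <| (hfin Q 0).union <| (hfin (P + Q) 0).union <|
    (hfin 0 (f (P + Q))).union <| (hfin 0 (-f (P + Q))).union <| (hfin 0 (f Q)).union <|
    (hfin 0 (-f Q)).union <| (hfin Q (f P)).union (hfin Q (-f P))).exists_notMem
  simp only [Set.mem_union, Set.mem_ofPred_eq, not_or, zero_add] at hR
  obtain ⟨h1, h2, h3, h4, h5, h6, h7, h8, h9⟩ := hR
  have e1 := hgen (P + Q) R hPQ h1 h3 h4 h5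
  have e2 := hgen Q R hQ h1 h2 h6 h7
  have e3 := hgen P (Q + R) hP h2 (by rwa [← add_assoc]) h8 h9
  rw [← add_assoc, e2, e1, ← add_assoc] at e3
  exact add_right_cancel e3

/-! ### The kernel and fibres of φ*, and additivity on generic pairs. -/

section Hom

variable {K : Type*} [Field K] [Algebra ℚ K] {a b : ℚ} (ha : a ≠ 0) (hd : d a b ≠ 0) {δ : K}
  (hδ : δ ^ 2 = algebraMap ℚ K (d a b))

include ha hd hδ in
theorem exists_starCoords {R : EstarPoint a b K} (hR : R ≠ 0) : ∃ X Y, StarCoords a b δ R X Y :=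
  have : CharZero K := algebraRat.charZero K
  (Estar_isModel ha hd rfl rfl hδ).exists_coords hR

include ha hd hδ in
theorem exists_baseCoords {P : EPoint a b K} (hP : P ≠ 0) : ∃ v w, BaseCoords a b δ P v w :=
  have : CharZero K := algebraRat.charZero K
  (E_isModel ha hd rfl rfl hδ).exists_coords hP

include hδ

theorem dualIsogeny_eq_zero_iff {R : EstarPoint a b K} :
    dualIsogeny ha hd K R = 0 ↔
      R = 0 ∨ ∃ X Y, StarCoords a b δ R X Y ∧ (X = 0 ∨ X = algebraMap ℚ K a) := by
  have : CharZero K := algebraRat.charZero K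
  constructor
  · intro h
    by_contra! hc
    obtain ⟨X, Y, hR⟩ := exists_starCoords ha hd hδ hc.1
    have := hc.2 X Y hR
    exact (hR.dualIsogeny ha hd hδ this.1 this.2).ne_zero h
  · rintro (rfl | ⟨X, Y, h, hX⟩)
    · rfl
    · exact h.dualIsogeny_eq_zero ha hd hδ hX

theorem exists_coords_of_dualIsogeny_ne_zero {R : EstarPoint a b K}
    (h : dualIsogeny ha hd K R ≠ 0) :
    ∃ X Y, StarCoords a b δ R X Y ∧ X ≠ 0 ∧ X ≠ algebraMap ℚ K a := by
  have : CharZero K := algebraRat.charZero K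
  rw [ne_eq, dualIsogeny_eq_zero_iff ha hd hδ] at h
  push Not at h
  obtain ⟨X, Y, hR⟩ := exists_starCoords ha hd hδ h.1
  exact ⟨X, Y, hR, h.2 X Y hR⟩

theorem dualIsogeny_neg (R : EstarPoint a b K) :
    dualIsogeny ha hd K (-R) = -dualIsogeny ha hd K R := by
  have : CharZero K := algebraRat.charZero K
  have M := Estar_isModel (K := K) ha hd rfl rfl hδ
  have M' := E_isModel (K := K) ha hd rfl rfl hδ
  by_cases h : dualIsogeny ha hd K R = 0
  · rw [h, WeierstrassCurve.Affine.Point.neg_zero]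
    rw [dualIsogeny_eq_zero_iff ha hd hδ] at h ⊢
    rcases h with rfl | ⟨X, Y, h, hX⟩
    · exact .inl rfl
    · exact .inr ⟨X, -Y, HasCoords.neg h M, hX⟩
  · obtain ⟨X, Y, hR, h0, h1⟩ := exists_coords_of_dualIsogeny_ne_zero ha hd hδ h
    have h2 : StarCoords a b δ (-R) X (-Y) := HasCoords.neg hR M
    have h3 := h2.dualIsogeny ha hd hδ h0 h1
    rw [neg_mul] at h3
    exact h3.ext (HasCoords.neg (hR.dualIsogeny ha hd hδ h0 h1) M')

/-- Clearing denominators in λ(X) = v leaves a monic quintic for X, and at most two points share a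
given X. -/
theorem dualIsogeny_fibre_finite [DecidableEq K] (Q : EPoint a b K) :
    {R | dualIsogeny ha hd K R = Q}.Finite := by
  have : CharZero K := algebraRat.charZero K
  have M := Estar_isModel (K := K) ha hd rfl rfl hδ
  have M' := E_isModel (K := K) ha hd rfl rfl hδ
  have hX (X : K) : {R | ∃ Y, StarCoords a b δ R X Y}.Finite := by
    by_cases h : ∃ R Y, StarCoords a b δ R X Y
    · obtain ⟨R, Y, hR⟩ := h
      refine (Set.toFinite {R, -R}).subset ?_
      rintro R' ⟨Y', hR'⟩
      exact HasCoords.eq_or_eq_neg hR hR' M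
    · convert Set.finite_empty
      ext R
      simp only [Set.mem_ofPred_eq, Set.mem_empty_iff_false, iff_false]
      exact fun h' => h ⟨R, h'⟩
  by_cases hQ : Q = 0
  · subst hQ
    refine (((hX 0).union (hX (algebraMap ℚ K a))).insert 0).subset fun R hR => ?_
    rcases (dualIsogeny_eq_zero_iff ha hd hδ).mp hR with rfl | ⟨X, Y, h, rfl | rfl⟩
    · exact .inl rfl
    · exact .inr (.inl ⟨Y, h⟩)
    · exact .inr (.inr ⟨Y, h⟩)
  · obtain ⟨v, w, hv⟩ := exists_baseCoords ha hd hδ hQ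
    set A := algebraMap ℚ K a with hA
    let p : K[X] := X ^ 5 + (C (-2 * A - v) * X ^ 4 + C (A * (A ^ 2 + 3 * A - 1)
        + 2 * A * v) * X ^ 3
      + C (-3 * A ^ 2 * (A - 1) - v * A ^ 2) * X ^ 2 + C (A ^ 3 * (A - 3)) * X + C (A ^ 4))
    have hp : p ≠ 0 := (monic_X_pow_add (by compute_degree!)).ne_zero
    refine (p.roots.toFinset.finite_toSet.biUnion fun X _ => hX X).subset fun R hR => ?_
    obtain ⟨X, Y, h, h0, h1⟩ := exists_coords_of_dualIsogeny_ne_zero ha hd hδ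
      (show dualIsogeny ha hd K R ≠ 0 by rwa [hR])
    have h2 := h.dualIsogeny ha hd hδ h0 h1
    rw [hR] at h2
    have h3 := (HasCoords.unique hv h2 M'.t_ne).1
    have h1' : X - A ≠ 0 := sub_ne_zero.mpr h1
    rw [lambdaX, eq_div_iff (by positivity)] at h3
    simp only [Set.mem_iUnion]
    refine ⟨X, ?_, Y, h⟩
    simp only [Finset.mem_coe, Multiset.mem_toFinset, mem_roots hp, IsRoot.def]
    unfold lambdaNum at h3
    simp only [p, eval_add, eval_mul, eval_pow, eval_X, eval_C]
    linear_combination -h3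

variable [DecidableEq K]

/-- The points P, Q and -(P + Q) lie on a line Y = mX + c. By `lambda_line` their images lie on a
line, and by `lambda_sum` the third image has the abscissa required by the chord formula. The
hypotheses ensure that the two image abscissae differ, so only the chord case occurs. -/
theorem dualIsogeny_add_of_ne {P Q : EstarPoint a b K} (hP : dualIsogeny ha hd K P ≠ 0)
    (hQ : dualIsogeny ha hd K Q ≠ 0) (hPQ : dualIsogeny ha hd K (P + Q) ≠ 0)
    (h1 : dualIsogeny ha hd K Q ≠ dualIsogeny ha hd K P)
    (h2 : dualIsogeny ha hd K Q ≠ -dualIsogeny ha hd K P) :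
    dualIsogeny ha hd K (P + Q) = dualIsogeny ha hd K P + dualIsogeny ha hd K Q := by
  have : CharZero K := algebraRat.charZero K
  have M := Estar_isModel (K := K) ha hd rfl rfl hδ
  have M' := E_isModel (K := K) ha hd rfl rfl hδ
  obtain ⟨X₁, Y₁, hP, h10, h11⟩ := exists_coords_of_dualIsogeny_ne_zero ha hd hδ hP
  obtain ⟨X₂, Y₂, hQ, h20, h21⟩ := exists_coords_of_dualIsogeny_ne_zero ha hd hδ hQ
  obtain ⟨X₃, Y₃, hS, h30, h31⟩ := exists_coords_of_dualIsogeny_ne_zero ha hd hδ hPQ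
  have fP := hP.dualIsogeny ha hd hδ h10 h11
  have fQ := hQ.dualIsogeny ha hd hδ h20 h21
  have fS := hS.dualIsogeny ha hd hδ h30 h31
  have E₁ := HasCoords.equation hP M
  have E₂ := HasCoords.equation hQ M
  have E₃ := HasCoords.equation hS M
  set A := algebraMap ℚ K a
  have hl : lambdaX A X₁ ≠ lambdaX A X₂ := by
    intro h
    unfold BaseCoords at fP fQ
    rw [h] at fP
    rcases HasCoords.eq_or_eq_neg fP fQ M' with h | h
    exacts [h1 h, h2 h]
  have hX : X₁ ≠ X₂ := fun h => hl (by rw [h])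
  have hX' : X₁ - X₂ ≠ 0 := sub_ne_zero.mpr hX
  have hl' : lambdaX A X₁ - lambdaX A X₂ ≠ 0 := sub_ne_zero.mpr hl
  obtain ⟨m, hm⟩ : ∃ m, m = (Y₁ - Y₂) / (X₁ - X₂) := ⟨_, rfl⟩
  obtain ⟨eX, eY⟩ := HasCoords.unique hS (HasCoords.add hP hQ M hX hm) M.t_ne
  obtain ⟨c, hc⟩ : ∃ c, c = Y₁ - m * X₁ := ⟨_, rfl⟩
  rw [← eX] at eY
  rw [eq_div_iff hX'] at hm
  have l1 : Y₁ = m * X₁ + c := by rw [hc]; ring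
  have l2 : Y₂ = m * X₂ + c := by rw [hc]; linear_combination hm
  -- The third collinear point is -(P + Q), hence the sign.
  have l3 : -Y₃ = m * X₃ + c := by rw [eY, hc]; ring
  have e1 : 4 * (X₁ + X₂ + X₃) = 4 * A - (A - 1) ^ 2 + m ^ 2 := by rw [eX]; ring
  have e2 : 4 * (X₁ * X₂ + X₂ * X₃ + X₃ * X₁) = 2 * A * (A - 1) - 2 * m * c := by
    apply mul_left_cancel₀ hX'
    rw [l1] at E₁
    rw [l2] at E₂
    linear_combination E₁ - E₂ + (X₁ - X₂) * (X₁ + X₂) * e1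
  have e3 : 4 * (X₁ * X₂ * X₃) = c ^ 2 - A ^ 2 := by
    rw [l1] at E₁
    linear_combination -E₁ - X₁ ^ 2 * e1 + X₁ * e2
  obtain ⟨hden, hsum⟩ := lambda_sum A m c (by norm_num) h10 h11 h20 h21 h30 h31 e1 e2 e3
  rw [← starCubic_eq] at E₁ E₂ E₃
  have k1 := lambda_line A m c h10 h11 E₁ l1
  have k2 := lambda_line A m c h20 h21 E₂ l2
  have k3 := lambda_line A m c h30 h31 (by rw [neg_sq, E₃]) l3
  have hM : lineSlopeNum A m c / lineDen A m c =
      (Y₁ * lambdaXDeriv A X₁ - Y₂ * lambdaXDeriv A X₂) / (lambdaX A X₁ - lambdaX A X₂) := by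
    rw [div_eq_div_iff hden hl']
    linear_combination k2 - k1
  have fPQ := HasCoords.add fP fQ M' hl hM
  have v3 : ((lineSlopeNum A m c / lineDen A m c) ^ 2 - ((A - 1) ^ 2 - 4 * A)) / 4
      - lambdaX A X₁ - lambdaX A X₂ = lambdaX A X₃ := by
    rw [← hsum]; ring
  have w3 : -(lineSlopeNum A m c / lineDen A m c * (lambdaX A X₃ - lambdaX A X₁)
      + Y₁ * lambdaXDeriv A X₁) = Y₃ * lambdaXDeriv A X₃ := by
    apply mul_left_cancel₀ hden
    have : lineDen A m c * (lineSlopeNum A m c / lineDen A m c) = lineSlopeNum A m c :=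
      mul_div_cancel₀ _ hden
    linear_combination (lambdaX A X₁ - lambdaX A X₃) * this + k3 - k1
  rw [v3, w3] at fPQ
  exact HasCoords.ext fS fPQ

end Hom

/-! ### The kernel ⟨T⟩ of order 5 and invariance of φ* under it. -/

section Kernel

variable {K : Type*} [Field K] [Algebra ℚ K] {a b : ℚ} (ha : a ≠ 0) (hd : d a b ≠ 0) {δ : K}
  (hδ : δ ^ 2 = algebraMap ℚ K (d a b))

include ha hd hδ

theorem exists_kernel_point : ∃ T : EstarPoint a b K, StarCoords a b δ T 0 (-algebraMap ℚ K a) :=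
  have : CharZero K := algebraRat.charZero K
  (Estar_isModel ha hd rfl rfl hδ).exists_point (by ring)

variable [DecidableEq K] {T : EstarPoint a b K} (hT : StarCoords a b δ T 0 (-algebraMap ℚ K a))

include hT

theorem kernel_point_add_self : StarCoords a b δ (T + T) (algebraMap ℚ K a)
    (algebraMap ℚ K a ^ 2) := by
  have : CharZero K := algebraRat.charZero K
  have hA : algebraMap ℚ K a ≠ 0 := by rwa [_root_.map_ne_zero]
  have h := HasCoords.add_self hT (Estar_isModel ha hd rfl rfl hδ) (neg_ne_zero.mpr hA)
    (m := -(algebraMap ℚ K a - 1)) (by field_simp; ring)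
  unfold StarCoords
  convert h using 1 <;> ring

/-- Doubling the point 2T = (A, A²), where the tangent slope is A + 1, gives (0, A) = -T in the
coordinates (X, Y). -/
theorem kernel_point_four : T + T + (T + T) = -T := by
  have : CharZero K := algebraRat.charZero K
  have hA : algebraMap ℚ K a ≠ 0 := by rwa [_root_.map_ne_zero]
  have M := Estar_isModel (K := K) ha hd rfl rfl hδ
  have h := HasCoords.add_self (kernel_point_add_self ha hd hδ hT) M (pow_ne_zero 2 hA)
    (m := algebraMap ℚ K a + 1) (by field_simp; ring)
  have h' := HasCoords.neg hT M
  rw [neg_neg] at h'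
  refine HasCoords.ext ?_ h'
  convert h using 1 <;> ring

theorem kernel_point_five : 5 • T = 0 := by
  have h := kernel_point_four ha hd hδ hT
  rw [eq_neg_iff_add_eq_zero] at h
  rw [← h]
  abel

theorem mem_zmultiples_of_dualIsogeny_eq_zero {R : EstarPoint a b K}
    (h : dualIsogeny ha hd K R = 0) : R ∈ AddSubgroup.zmultiples T := by
  have : CharZero K := algebraRat.charZero K
  have M := Estar_isModel (K := K) ha hd rfl rfl hδ
  have hT1 := AddSubgroup.mem_zmultiples T
  rcases (dualIsogeny_eq_zero_iff ha hd hδ).mp h with rfl | ⟨X, Y, h, rfl | rfl⟩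
  · exact zero_mem _
  · rcases HasCoords.eq_or_eq_neg hT h M with rfl | rfl
    exacts [hT1, neg_mem hT1]
  · rcases HasCoords.eq_or_eq_neg (kernel_point_add_self ha hd hδ hT) h M with rfl | rfl
    exacts [add_mem hT1 hT1, neg_mem (add_mem hT1 hT1)]

/-- The coordinates of the translate by the generator of the kernel. -/
theorem StarCoords.add_kernel_point {R : EstarPoint a b K} {X Y : K} (h : StarCoords a b δ R X Y)
    (h0 : X ≠ 0) {u : K} (hu : u = (Y + (algebraMap ℚ K a - 1) * X + algebraMap ℚ K a) / 2) :
    u ^ 2 - (algebraMap ℚ K a - 1) * X * u - algebraMap ℚ K a * u = X ^ 3 - algebraMap ℚ K a * X ^ 2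
      ∧ Y = 2 * u - (algebraMap ℚ K a - 1) * X - algebraMap ℚ K a ∧
    StarCoords a b δ (R + T) (algebraMap ℚ K a * u / X ^ 2) (2 * translateY (algebraMap ℚ K a) X u
      - (algebraMap ℚ K a - 1) * (algebraMap ℚ K a * u / X ^ 2) - algebraMap ℚ K a) := by
  have : CharZero K := algebraRat.charZero K
  have M := Estar_isModel (K := K) ha hd rfl rfl hδ
  have E := HasCoords.equation h M
  set A := algebraMap ℚ K a
  have hY : Y = 2 * u - (A - 1) * X - A := by rw [hu]; ring
  have hu2 : u ^ 2 - (A - 1) * X * u - A * u = X ^ 3 - A * X ^ 2 := by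
    rw [hY] at E
    linear_combination E / 4
  refine ⟨hu2, hY, ?_⟩
  have h2 := HasCoords.add h hT M h0 rfl
  have e1 : (((Y - -A) / (X - 0)) ^ 2 - ((A - 1) ^ 2 - 4 * A)) / 4 - X - 0 = A * u / X ^ 2 := by
    rw [hY, sub_zero]
    field_simp
    linear_combination 4 * X ^ 2 * hu2
  rw [e1] at h2
  unfold StarCoords
  convert h2 using 1
  rw [hY, sub_zero]
  unfold translateY
  field_simp
  ring

/-- Off the kernel this is `lambda_translate`. On the kernel its formula has poles, so the points 0,
±T, ±2T are checked separately. -/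
theorem dualIsogeny_add_kernel_point (R : EstarPoint a b K) :
    dualIsogeny ha hd K (R + T) = dualIsogeny ha hd K R := by
  have : CharZero K := algebraRat.charZero K
  have M := Estar_isModel (K := K) ha hd rfl rfl hδ
  by_cases h : dualIsogeny ha hd K R = 0
  · rw [h]
    have hT0 : dualIsogeny ha hd K T = 0 := hT.dualIsogeny_eq_zero ha hd hδ (.inl rfl)
    have hT2 : dualIsogeny ha hd K (T + T) = 0 :=
      (kernel_point_add_self ha hd hδ hT).dualIsogeny_eq_zero ha hd hδ (.inr rfl)
    have hneg {S : EstarPoint a b K} (hS : dualIsogeny ha hd K S = 0) :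
        dualIsogeny ha hd K (-S) = 0 := by
      rw [dualIsogeny_neg ha hd hδ, hS, neg_zero]
    rcases (dualIsogeny_eq_zero_iff ha hd hδ).mp h with rfl | ⟨X, Y, h, rfl | rfl⟩
    · rwa [zero_add]
    · rcases HasCoords.eq_or_eq_neg hT h M with rfl | rfl
      · exact hT2
      · rw [neg_add_cancel]; rfl
    · rcases HasCoords.eq_or_eq_neg (kernel_point_add_self ha hd hδ hT) h M with rfl | rfl
      · have h4 := kernel_point_four ha hd hδ hT
        have h3 : T + T + T = -(T + T) := by
          rw [eq_neg_iff_add_eq_zero] at h4 ⊢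
          rw [← h4]; abel
        rw [h3]
        exact hneg hT2
      · rw [neg_add, neg_add_cancel_right]
        exact hneg hT0
  · obtain ⟨X, Y, hR, h0, h1⟩ := exists_coords_of_dualIsogeny_ne_zero ha hd hδ h
    obtain ⟨hu, hY, hRT⟩ := StarCoords.add_kernel_point ha hd hδ hT hR h0 rfl
    have hA : algebraMap ℚ K a ≠ 0 := by rwa [_root_.map_ne_zero]
    obtain ⟨h2, h3⟩ := translate_ne hA h0 h1 hu
    obtain ⟨h4, h5⟩ := lambda_translate hA h0 h1 hu
    have h6 := hRT.dualIsogeny ha hd hδ h2 h3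
    rw [h4, h5, ← hY] at h6
    exact HasCoords.ext h6 (hR.dualIsogeny ha hd hδ h0 h1)

theorem dualIsogeny_add_nsmul (R : EstarPoint a b K) (n : ℕ) :
    dualIsogeny ha hd K (R + n • T) = dualIsogeny ha hd K R := by
  induction n with
  | zero => rw [zero_smul, add_zero]
  | succ n ih =>
    rw [succ_nsmul, ← add_assoc, dualIsogeny_add_kernel_point ha hd hδ hT, ih]

theorem dualIsogeny_add_of_mem (R : EstarPoint a b K) {S : EstarPoint a b K}
    (hS : S ∈ AddSubgroup.zmultiples T) :
    dualIsogeny ha hd K (R + S) = dualIsogeny ha hd K R := by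
  have h5 : IsOfFinAddOrder T :=
    isOfFinAddOrder_iff_nsmul_eq_zero.mpr ⟨5, by norm_num, kernel_point_five ha hd hδ hT⟩
  obtain ⟨n, rfl⟩ := (IsOfFinAddOrder.mem_multiples_iff_mem_zmultiples h5).mpr hS
  exact dualIsogeny_add_nsmul ha hd hδ hT R n

theorem dualIsogeny_eq_zero_iff_mem {R : EstarPoint a b K} :
    dualIsogeny ha hd K R = 0 ↔ R ∈ AddSubgroup.zmultiples T := by
  refine ⟨mem_zmultiples_of_dualIsogeny_eq_zero ha hd hδ hT, fun h => ?_⟩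
  have := dualIsogeny_add_of_mem ha hd hδ hT 0 h
  rwa [zero_add] at this

theorem card_zmultiples_kernel_point : Nat.card (AddSubgroup.zmultiples T) = 5 := by
  rw [Nat.card_zmultiples]
  have : Fact (Nat.Prime 5) := ⟨by norm_num⟩
  exact addOrderOf_eq_prime (kernel_point_five ha hd hδ hT) (HasCoords.ne_zero hT)

end Kernel

/-! ### Surjectivity and full additivity over an algebraically closed field. -/

section AlgClosed

variable {K : Type*} [Field K] [Algebra ℚ K] [IsAlgClosed K] {a b : ℚ} (ha : a ≠ 0)
  (hd : d a b ≠ 0) {δ : K} (hδ : δ ^ 2 = algebraMap ℚ K (d a b))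

include ha hd hδ

theorem exists_star_point (X : K) : ∃ (R : EstarPoint a b K) (Y : K), StarCoords a b δ R X Y := by
  have : CharZero K := algebraRat.charZero K
  obtain ⟨Y, hY⟩ := IsAlgClosed.exists_pow_nat_eq (starCubic (algebraMap ℚ K a) X) two_pos
  rw [starCubic_eq] at hY
  obtain ⟨R, hR⟩ := (Estar_isModel ha hd rfl rfl hδ).exists_point hY
  exact ⟨R, Y, hR⟩

theorem infinite_star_points : Infinite (EstarPoint a b K) := by
  have : CharZero K := algebraRat.charZero K
  choose R Y hR using exists_star_point (K := K) ha hd hδ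
  refine Infinite.of_injective R fun X X' h => ?_
  have h1 := hR X
  rw [h] at h1
  exact (HasCoords.unique h1 (hR X') (Estar_isModel (K := K) ha hd rfl rfl hδ).t_ne).1

/-- A root X of the quintic N(X) = vX²(X - A)² gives a point R whose image has abscissa v; if the
ordinate has the wrong sign, -R works. -/
theorem dualIsogeny_surjective : Function.Surjective (dualIsogeny ha hd K) := by
  have : CharZero K := algebraRat.charZero K
  have M := Estar_isModel (K := K) ha hd rfl rfl hδ
  have M' := E_isModel (K := K) ha hd rfl rfl hδ
  intro P
  by_cases hP : P = 0
  · exact ⟨0, hP ▸ rfl⟩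
  obtain ⟨v, w, hv⟩ := exists_baseCoords ha hd hδ hP
  have hA : algebraMap ℚ K a ≠ 0 := by rwa [_root_.map_ne_zero]
  set A := algebraMap ℚ K a
  let q : K[X] := C (-2 * A - v) * X ^ 4 + C (A * (A ^ 2 + 3 * A - 1) + 2 * A * v) * X ^ 3
      + C (-3 * A ^ 2 * (A - 1) - v * A ^ 2) * X ^ 2 + C (A ^ 3 * (A - 3)) * X + C (A ^ 4)
  have hq : q.degree < 5 := lt_of_le_of_lt (b := 4) (by simp only [q]; compute_degree!)
      (by norm_num)
  have hp : (X ^ 5 + q).degree ≠ 0 := by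
    rw [degree_add_eq_left_of_degree_lt (by rw [degree_X_pow]; exact_mod_cast hq), degree_X_pow]
    norm_num
  obtain ⟨X, hX⟩ := IsAlgClosed.exists_root _ hp
  have hX' : lambdaNum A X = v * (X ^ 2 * (X - A) ^ 2) := by
    simp only [q, IsRoot.def, eval_add, eval_mul, eval_pow, eval_X, eval_C] at hX
    unfold lambdaNum
    linear_combination hX
  -- The numerator N takes the values A⁴ at 0 and A⁶ at A, so the roots avoid both poles.
  have h0 : X ≠ 0 := by
    rintro rfl
    apply pow_ne_zero 4 hA
    unfold lambdaNum at hX'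
    linear_combination hX'
  have h1 : X ≠ A := by
    rintro rfl
    apply pow_ne_zero 6 hA
    unfold lambdaNum at hX'
    linear_combination hX'
  have h1' : X - A ≠ 0 := sub_ne_zero.mpr h1
  obtain ⟨R, Y, hR⟩ := exists_star_point ha hd hδ X
  have hfR := hR.dualIsogeny ha hd hδ h0 h1
  have hl : lambdaX A X = v := by
    rw [lambdaX, hX', mul_div_cancel_right₀ _ (by positivity)]
  rw [hl] at hfR
  rcases HasCoords.eq_or_eq_neg hfR hv M' with h | h
  · exact ⟨R, h.symm⟩
  · exact ⟨-R, by rw [dualIsogeny_neg ha hd hδ, h]⟩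

variable [DecidableEq K]

theorem dualIsogeny_add (P Q : EstarPoint a b K) :
    dualIsogeny ha hd K (P + Q) = dualIsogeny ha hd K P + dualIsogeny ha hd K Q := by
  have := infinite_star_points (K := K) ha hd hδ
  obtain ⟨T, hT⟩ := exists_kernel_point (K := K) ha hd hδ
  exact map_add_of_generic _ (dualIsogeny_neg ha hd hδ) (dualIsogeny_fibre_finite ha hd hδ)
    (fun R S hS => dualIsogeny_add_of_mem ha hd hδ hT R
      ((dualIsogeny_eq_zero_iff_mem ha hd hδ hT).mp hS))
    (fun P Q => dualIsogeny_add_of_ne ha hd hδ) P Q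

end AlgClosed

/-! ### Finiteness of Selmer groups K(S, n), by way of K(∅, n), the units and the class group. -/

section Selmer

open IsDedekindDomain nonZeroDivisors

/-- If a function with finitely many values separates the cosets of `A` in `B`, then `A` has finite
index in `B`. -/
theorem relIndex_ne_zero_of_finite {G ι : Type*} [Group G] [Finite ι] {A B : Subgroup G}
    (c : G → ι) (h : ∀ x ∈ B, ∀ y ∈ B, c x = c y → x⁻¹ * y ∈ A) : A.relIndex B ≠ 0 := by
  have hinj : Function.Injective fun q : B ⧸ A.subgroupOf B => c (Quotient.out q : B) := by
    intro q q' hq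
    rw [← QuotientGroup.out_eq' q, ← QuotientGroup.out_eq' q', QuotientGroup.eq]
    exact h _ (Subtype.mem _) _ (Subtype.mem _) hq
  have := Finite.of_injective _ hinj
  exact Subgroup.index_ne_zero_of_finite

/-- The quotient of the finitely generated group Rˣ by n-th powers is finitely generated and
torsion, hence finite, and it surjects onto the quotient in question. -/
theorem powers_relIndex_units_ne_zero (R K : Type*) [CommRing R] [Field K] [Algebra R K]
    [Monoid.FG Rˣ] {n : ℕ} (hn : n ≠ 0) :
    (powMonoidHom n : Kˣ →* Kˣ).range.relIndex
      ((Units.map (algebraMap R K : R →* K)).range ⊔ (powMonoidHom n : Kˣ →* Kˣ).range) ≠ 0 := by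
  rw [Subgroup.relIndex_sup_right, ← Subgroup.index_comap]
  have : Group.FG Rˣ := Group.fg_iff_monoid_fg.mpr inferInstance
  have := CommGroup.finite_of_fg_isMulTorsion (Rˣ ⧸ (powMonoidHom n : Rˣ →* Rˣ).range)
    (CommGroup.isMulTorsion_quotient_range_powMonoidHom Rˣ hn)
  refine ne_zero_of_dvd_ne_zero
    (Subgroup.index_ne_zero_of_finite (H := (powMonoidHom n : Rˣ →* Rˣ).range))
    (Subgroup.index_dvd_of_le ?_)
  rintro _ ⟨u, rfl⟩
  exact ⟨Units.map (algebraMap R K : R →* K) u, (map_pow _ u n).symm⟩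

variable (R K : Type*) [CommRing R] [IsDedekindDomain R] [Field K] [Algebra R K]
  [IsFractionRing R K]

variable {K} in
theorem valuation_eq_exp_count (v : HeightOneSpectrum R) {x : K} (hx : x ≠ 0) :
    v.valuation K x =
      WithZero.exp (-FractionalIdeal.count K v (FractionalIdeal.spanSingleton R⁰ x)) := by
  classical
  obtain ⟨r, s, hs, rfl⟩ := IsFractionRing.div_surjective (A := R) x
  have hs0 : s ≠ 0 := nonZeroDivisors.ne_zero hs
  have hr0 : r ≠ 0 := by rintro rfl; simp at hx
  rw [map_div₀, HeightOneSpectrum.valuation_of_algebraMap,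
    HeightOneSpectrum.valuation_of_algebraMap, v.intValuation_if_neg hr0,
    v.intValuation_if_neg hs0, ← WithZero.exp_sub,
    FractionalIdeal.count_well_defined K v (a := s) (J := Ideal.span {r})]
  · congr 1; ring
  · rwa [ne_eq, FractionalIdeal.spanSingleton_eq_zero_iff]
  · rw [FractionalIdeal.coeIdeal_span_singleton, FractionalIdeal.spanSingleton_mul_spanSingleton,
      div_eq_inv_mul]

/-- The order at `v` of an element of `Kˣ`. -/
noncomputable def order (v : HeightOneSpectrum R) : Kˣ →* Multiplicative ℤ where
  toFun x := Multiplicative.ofAdd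
    (FractionalIdeal.count K v (FractionalIdeal.spanSingleton R⁰ (x : K)))
  map_one' := by
    rw [Units.val_one, FractionalIdeal.spanSingleton_one, FractionalIdeal.count_one]; rfl
  map_mul' x y := by
    rw [Units.val_mul, ← FractionalIdeal.spanSingleton_mul_spanSingleton,
      FractionalIdeal.count_mul]
    · rfl
    · exact (FractionalIdeal.spanSingleton_eq_zero_iff).not.mpr x.ne_zero
    · exact (FractionalIdeal.spanSingleton_eq_zero_iff).not.mpr y.ne_zero

/-- The elements of `Kˣ` whose order is divisible by `n` at all places outside `S`. -/
noncomputable def selmerSubgroup (S : Set (HeightOneSpectrum R)) (n : ℕ) : Subgroup Kˣ :=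
  ⨅ v ∉ S, (powMonoidHom n : Multiplicative ℤ →* Multiplicative ℤ).range.comap (order R K v)

theorem mem_selmerSubgroup_iff {S : Set (HeightOneSpectrum R)} {n : ℕ} {x : Kˣ} :
    x ∈ selmerSubgroup R K S n ↔ ∀ v ∉ S,
      (n : ℤ) ∣ FractionalIdeal.count K v (FractionalIdeal.spanSingleton R⁰ (x : K)) := by
  simp only [selmerSubgroup, Subgroup.mem_iInf, Subgroup.mem_comap, MonoidHom.mem_range,
    powMonoidHom_apply]
  refine forall₂_congr fun v _ => ⟨?_, ?_⟩
  · rintro ⟨m, hm⟩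
    exact ⟨m.toAdd, by simpa [order, mul_comm] using! (congrArg Multiplicative.toAdd hm).symm⟩
  · rintro ⟨m, hm⟩
    refine ⟨Multiplicative.ofAdd m, Multiplicative.toAdd.injective ?_⟩
    simpa [order, mul_comm] using! hm.symm

/-- The orders modulo n at the finitely many places of S separate the cosets. -/
theorem selmerSubgroup_relIndex_ne_zero {S : Set (HeightOneSpectrum R)} (hS : S.Finite) {n : ℕ}
    (hn : n ≠ 0) : (selmerSubgroup R K ∅ n).relIndex (selmerSubgroup R K S n) ≠ 0 := by
  have := hS.to_subtype
  have : NeZero n := ⟨hn⟩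
  refine relIndex_ne_zero_of_finite
    (fun x (v : S) => ((order R K v x).toAdd : ZMod n)) fun x hx y hy hxy => ?_
  rw [mem_selmerSubgroup_iff]
  intro v _
  by_cases hv : v ∈ S
  · have h := congrFun hxy ⟨v, hv⟩
    simp only at h
    rw [ZMod.intCast_eq_intCast_iff_dvd_sub] at h
    have e : FractionalIdeal.count K v (FractionalIdeal.spanSingleton R⁰ ((x⁻¹ * y : Kˣ) : K)) =
        (order R K v (x⁻¹ * y)).toAdd := rfl
    rw [e, map_mul, map_inv, toAdd_mul, toAdd_inv, neg_add_eq_sub]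
    exact h
  · have h := mul_mem (inv_mem hx) hy
    exact (mem_selmerSubgroup_iff R K).mp h v hv

/-- All exponents in the factorization of (x) are divisible by n; dividing them by n gives the ideal
J. -/
theorem exists_ideal_pow {n : ℕ} (hn : n ≠ 0) {x : Kˣ} (hx : x ∈ selmerSubgroup R K ∅ n) :
    ∃ J : (FractionalIdeal R⁰ K)ˣ, J ^ n = toPrincipalIdeal R K x := by
  rw [mem_selmerSubgroup_iff] at hx
  choose m hm using fun v => hx v (Set.notMem_empty v)
  have hI : FractionalIdeal.spanSingleton R⁰ (x : K) ≠ 0 :=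
    (FractionalIdeal.spanSingleton_eq_zero_iff).not.mpr x.ne_zero
  have hfin : (Function.mulSupport fun v : HeightOneSpectrum R =>
      (v.asIdeal : FractionalIdeal R⁰ K) ^ m v).Finite := by
    refine Set.Finite.subset
      (FractionalIdeal.finite_factors (FractionalIdeal.spanSingleton R⁰ (x : K))) ?_
    intro v hv hv'
    apply hv
    have h0 : FractionalIdeal.count K v (FractionalIdeal.spanSingleton R⁰ (x : K)) = 0 := hv'
    rw [hm v] at h0
    have : m v = 0 := by simpa [hn] using h0
    simp [this]
  have hJ : (∏ᶠ v : HeightOneSpectrum R, (v.asIdeal : FractionalIdeal R⁰ K) ^ m v) ^ n =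
      FractionalIdeal.spanSingleton R⁰ (x : K) := by
    rw [finprod_pow hfin, ← FractionalIdeal.finprod_heightOneSpectrum_factorization' K hI]
    refine finprod_congr fun v => ?_
    rw [hm v, mul_comm, zpow_mul, zpow_natCast]
  have hJ0 : (∏ᶠ v : HeightOneSpectrum R, (v.asIdeal : FractionalIdeal R⁰ K) ^ m v) ≠ 0 := by
    intro h
    rw [h, zero_pow hn] at hJ
    exact hI hJ.symm
  refine ⟨Units.mk0 _ hJ0, Units.ext ?_⟩
  rw [Units.val_pow_eq_pow_val, Units.val_mk0, hJ, coe_toPrincipalIdeal]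

/-- Attach to x the class of J with Jⁿ = (x). If x and y have the same class, then J⁻¹J' = (t), so
x⁻¹y t⁻ⁿ generates the unit ideal and is a unit of R. -/
theorem units_sup_relIndex_ne_zero [Finite (ClassGroup R)] {n : ℕ} (hn : n ≠ 0) :
    ((Units.map (algebraMap R K : R →* K)).range ⊔ (powMonoidHom n : Kˣ →* Kˣ).range).relIndex
      (selmerSubgroup R K ∅ n) ≠ 0 := by
  classical
  have := Finite.of_equiv _ (ClassGroup.equiv (R := R) K).toEquiv
  refine relIndex_ne_zero_of_finite (fun x : Kˣ => if hx : x ∈ selmerSubgroup R K ∅ n then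
    ((exists_ideal_pow R K hn hx).choose : (FractionalIdeal R⁰ K)ˣ ⧸ (toPrincipalIdeal R K).range)
      else 1) fun x hx y hy hxy => ?_
  simp only [dif_pos hx, dif_pos hy] at hxy
  have hJ := (exists_ideal_pow R K hn hx).choose_spec
  have hJ' := (exists_ideal_pow R K hn hy).choose_spec
  generalize (exists_ideal_pow R K hn hx).choose = J at *
  generalize (exists_ideal_pow R K hn hy).choose = J' at *
  rw [QuotientGroup.eq] at hxy
  obtain ⟨t, ht⟩ := hxy
  have h1 : toPrincipalIdeal R K (x⁻¹ * y * (t ^ n)⁻¹) = 1 := by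
    rw [map_mul, map_mul, map_inv, map_inv, map_pow, ht, ← hJ, ← hJ', mul_pow, inv_pow,
      mul_inv_cancel]
  rw [toPrincipalIdeal_eq_iff, Units.val_one, ← FractionalIdeal.spanSingleton_one, eq_comm,
    FractionalIdeal.spanSingleton_eq_spanSingleton] at h1
  obtain ⟨z, hz⟩ := h1
  have hz' : Units.map (algebraMap R K : R →* K) z = x⁻¹ * y * (t ^ n)⁻¹ := by
    rw [← Units.val_inj, ← hz, Units.smul_def, Algebra.smul_def, mul_one]
    rfl
  rw [← inv_mul_cancel_right (x⁻¹ * y) (t ^ n), ← hz']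
  exact Subgroup.mul_mem_sup ⟨z, rfl⟩ ⟨t, rfl⟩

/-- Finiteness of Selmer groups: the elements of `Kˣ` whose order is divisible by `n` outside a
finite set of places fall into finitely many classes modulo `n`-th powers. -/
theorem powers_relIndex_selmerSubgroup_ne_zero [Finite (ClassGroup R)] [Monoid.FG Rˣ]
    {S : Set (HeightOneSpectrum R)} (hS : S.Finite) {n : ℕ} (hn : n ≠ 0) :
    (powMonoidHom n : Kˣ →* Kˣ).range.relIndex (selmerSubgroup R K S n) ≠ 0 :=
  Subgroup.relIndex_ne_zero_trans (powers_relIndex_units_ne_zero R K hn)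
    (Subgroup.relIndex_ne_zero_trans (units_sup_relIndex_ne_zero R K hn)
      (selmerSubgroup_relIndex_ne_zero R K hS hn))

theorem mem_selmerSubgroup_of_valuation {S : Set (HeightOneSpectrum R)} {n : ℕ} (hn : n ≠ 0)
    {x : Kˣ} (h : ∀ v ∉ S, ∃ c : K, v.valuation K x = v.valuation K c ^ n) :
    x ∈ selmerSubgroup R K S n := by
  rw [mem_selmerSubgroup_iff]
  intro v hv
  obtain ⟨c, hc⟩ := h v hv
  have hc0 : c ≠ 0 := by
    rintro rfl
    rw [map_zero, zero_pow hn, map_eq_zero] at hc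
    exact x.ne_zero hc
  rw [valuation_eq_exp_count R v x.ne_zero, valuation_eq_exp_count R v hc0, ← WithZero.exp_nsmul,
    WithZero.exp_inj, smul_neg, neg_inj, nsmul_eq_mul] at hc
  exact ⟨_, hc⟩

end Selmer

/-! ### Abstract Galois descent for an isogeny whose kernel is a quadratic twist of ℤ/5. -/

section GaloisModule

variable {G A B : Type*} [Group G] [AddCommGroup A] [AddCommGroup B] [DistribMulAction G A]

variable (G) in
/-- The image under `f` of the fixed points of `G`. -/
def fixedImage (f : A →+ B) : AddSubgroup B where
  carrier := {P | ∃ S, (∀ σ : G, σ • S = S) ∧ f S = P}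
  zero_mem' := ⟨0, fun σ => smul_zero σ, map_zero f⟩
  add_mem' := by
    rintro _ _ ⟨S, hS, rfl⟩ ⟨S', hS', rfl⟩
    exact ⟨S + S', fun σ => by rw [smul_add, hS, hS'], map_add f S S'⟩
  neg_mem' := by
    rintro _ ⟨S, hS, rfl⟩
    exact ⟨-S, fun σ => by rw [smul_neg, hS], map_neg f S⟩

variable [DistribMulAction G B]

/-- A surjective homomorphism of `G`-modules whose kernel has order `5`, with `G` acting on the
kernel by a quadratic character. -/
structure IsDihedralIsogeny (G : Type*) [Group G] {A B : Type*} [AddCommGroup A] [AddCommGroup B]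
    [DistribMulAction G A] [DistribMulAction G B] (f : A →+ B) (T : A) : Prop where
  smul : ∀ (σ : G) (R : A), f (σ • R) = σ • f R
  surj : Function.Surjective f
  ker : ∀ R, f R = 0 ↔ R ∈ AddSubgroup.zmultiples T
  five : 5 • T = 0
  smul_gen : ∀ σ : G, σ • T = T ∨ σ • T = -T

namespace IsDihedralIsogeny

variable {f : A →+ B} {T : A} (h : IsDihedralIsogeny G f T)

include h

theorem five_nsmul {R : A} (hR : f R = 0) : 5 • R = 0 := by
  obtain ⟨n, rfl⟩ := AddSubgroup.mem_zmultiples_iff.mp ((h.ker R).mp hR)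
  rw [smul_comm, h.five, smul_zero]

theorem smul_of_map_eq_zero {σ : G} (hσ : σ • T = T) {R : A} (hR : f R = 0) : σ • R = R := by
  obtain ⟨n, rfl⟩ := AddSubgroup.mem_zmultiples_iff.mp ((h.ker R).mp hR)
  rw [smul_comm, hσ]

theorem map_smul_sub {R : A} (hR : ∀ σ : G, σ • f R = f R) (σ : G) : f (σ • R - R) = 0 := by
  rw [map_sub, h.smul, hR, sub_self]

/-- If f R is fixed, then σR - R lies in the kernel, which is killed by 5; hence 5R is fixed. -/
theorem five_nsmul_mem {P : B} (hP : ∀ σ : G, σ • P = P) : 5 • P ∈ fixedImage G f := by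
  obtain ⟨R, rfl⟩ := h.surj P
  refine ⟨5 • R, fun σ => ?_, map_nsmul f 5 R⟩
  rw [smul_comm, ← sub_eq_zero, ← nsmul_sub]
  exact h.five_nsmul (h.map_smul_sub hP σ)

theorem mem_of_nsmul_mem {P : B} (hP : ∀ σ : G, σ • P = P) {n : ℕ} (hn : n.Coprime 5)
    (hmem : n • P ∈ fixedImage G f) : P ∈ fixedImage G f := by
  have h1 := Nat.gcd_eq_gcd_ab n 5
  rw [hn.gcd_eq_one] at h1
  have h2 : P = Nat.gcdA n 5 • (n • P) + Nat.gcdB n 5 • (5 • P) := by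
    rw [← natCast_zsmul, ← natCast_zsmul, smul_smul, smul_smul, ← add_smul, mul_comm _ (n : ℤ),
      mul_comm _ ((5 : ℕ) : ℤ), ← h1]
    simp
  rw [h2]
  exact add_mem (zsmul_mem hmem _) (zsmul_mem (h.five_nsmul_mem hP) _)

/-- The stabilizer of T has index at most 2. If τ lies outside it, the trace S + τS is fixed by all
of G and maps to 2 f S, and 2 is prime to 5. -/
theorem map_mem_of_smul_eq {S : A} (hS : ∀ σ : G, σ • T = T → σ • S = S)
    (hfS : ∀ σ : G, σ • f S = f S) : f S ∈ fixedImage G f := by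
  by_cases hall : ∀ σ : G, σ • T = T
  · exact ⟨S, fun σ => hS σ (hall σ), rfl⟩
  push Not at hall
  obtain ⟨τ, hτ⟩ := hall
  replace hτ : τ • T = -T := (h.smul_gen τ).resolve_left hτ
  have hτi : τ⁻¹ • T = -T := by rw [inv_smul_eq_iff, smul_neg, hτ, neg_neg]
  refine h.mem_of_nsmul_mem hfS (n := 2) (by norm_num) ⟨S + τ • S, fun σ => ?_, ?_⟩
  · rcases h.smul_gen σ with hσ | hσ
    · rw [smul_add, hS σ hσ]
      have := hS (τ⁻¹ * σ * τ) (by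
        rw [mul_smul, mul_smul, hτ, smul_neg, hσ, smul_neg, hτi, neg_neg])
      rw [mul_smul, mul_smul, inv_smul_eq_iff] at this
      rw [this]
    · have h1 := hS (τ⁻¹ * σ) (by rw [mul_smul, hσ, smul_neg, hτi, neg_neg])
      have h2 := hS (σ * τ) (by rw [mul_smul, hτ, smul_neg, hσ, neg_neg])
      rw [mul_smul, inv_smul_eq_iff] at h1
      rw [mul_smul] at h2
      rw [smul_add, h1, h2, add_comm]
  · rw [map_add, h.smul, hfS, two_nsmul]

/-- When σ fixes T it moves S by some t in the kernel that it fixes, so σ⁴S = S + 4t. From 4t = 0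
and 5t = 0 follows t = 0. This brings the Kummer descent down from ℚ(√d, ζ₅), whose Galois group has
exponent dividing 4. -/
theorem smul_eq_of_pow {S : A} (hfS : ∀ σ : G, σ • f S = f S) {H : Subgroup G}
    (hH : ∀ σ ∈ H, σ • S = S) {σ : G} (hσ : σ ^ 4 ∈ H) (hT : σ • T = T) : σ • S = S := by
  obtain ⟨t, ht⟩ : ∃ t, t = σ • S - S := ⟨_, rfl⟩
  have hft : f t = 0 := ht ▸ h.map_smul_sub hfS σ
  have hσt := h.smul_of_map_eq_zero hT hft
  have h1 : σ • S = S + t := by rw [ht]; abel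
  have h4 := hH _ hσ
  simp only [pow_succ, pow_zero, one_mul, mul_smul] at h4
  simp only [h1, smul_add, hσt] at h4
  have h5 := h.five_nsmul hft
  have h6 : 4 • t = 0 := by
    rw [← sub_eq_zero] at h4
    rw [← h4]
    abel
  have h7 : t = 5 • t - 4 • t := by abel
  rw [h1, h7, h5, h6, sub_zero, add_zero]

/-- The sum over a stable subset s of the fibre is fixed and maps to |s|·P. -/
theorem mem_of_finset {P : B} (hP : ∀ σ : G, σ • P = P) (s : Finset A) (hs : ∀ R ∈ s, f R = P)
    (hG : ∀ (σ : G), ∀ R ∈ s, σ • R ∈ s) (hc : s.card.Coprime 5) : P ∈ fixedImage G f := by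
  refine h.mem_of_nsmul_mem hP hc ⟨∑ R ∈ s, R, fun σ => ?_, ?_⟩
  · rw [Finset.smul_sum]
    refine Finset.sum_bij (fun R _ => σ • R) (hG σ)
      (fun R _ R' _ e => smul_left_cancel σ e) (fun R hR => ⟨σ⁻¹ • R, hG _ R hR, ?_⟩)
      (fun _ _ => rfl)
    rw [smul_inv_smul]
  · rw [map_sum, Finset.sum_congr rfl hs, Finset.sum_const]

/-- The fibre is the coset R + ⟨T⟩, and the difference of its points R and R + T is T. -/
theorem smul_fibre_iff {R : A} {σ : G} :
    (∀ R', f R' = f R → σ • R' = R') ↔ σ • T = T ∧ σ • R = R := by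
  constructor
  · intro hσ
    have hT0 : f T = 0 := (h.ker T).mpr (AddSubgroup.mem_zmultiples T)
    have h1 := hσ R rfl
    have h2 := hσ (R + T) (by rw [map_add, hT0, add_zero])
    rw [smul_add, h1] at h2
    exact ⟨add_left_cancel h2, h1⟩
  · rintro ⟨hT, hR⟩ R' hR'
    have := h.smul_of_map_eq_zero hT (R := R' - R) (by rw [map_sub, hR', sub_self])
    rwa [smul_sub, hR, sub_left_inj] at this

/-- If the pointwise stabilizer of the fibre over `P` fixes the fibre over `Q` then `Q` is a
multiple of `P` modulo the image of the fixed points. -/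
theorem exists_zsmul_sub_mem (hT5 : T ≠ 0) {P Q : B} (hP : ∀ σ : G, σ • P = P)
    (hQ : ∀ σ : G, σ • Q = Q)
    (hPI : P ∉ fixedImage G f)
    (hPQ : ∀ σ : G, (∀ R, f R = P → σ • R = R) → ∀ R, f R = Q → σ • R = R) :
    ∃ k : ℤ, Q - k • P ∈ fixedImage G f := by
  obtain ⟨R, rfl⟩ := h.surj P
  obtain ⟨S, rfl⟩ := h.surj Q
  have hstab : ∀ σ : G, σ • T = T → σ • R = R → σ • S = S := fun σ h1 h2 =>
    hPQ σ (h.smul_fibre_iff.mpr ⟨h1, h2⟩) S rfl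
  -- Since P is not in the image, some τ fixes T but moves R; then τR - R generates the kernel, of
  -- prime order, and k is defined by τS - S = k(τR - R).
  obtain ⟨τ, hτT, hτR⟩ : ∃ τ : G, τ • T = T ∧ τ • R ≠ R := by
    by_contra! hc
    exact hPI (h.map_mem_of_smul_eq hc hP)
  have : Fact (Nat.Prime 5) := ⟨by norm_num⟩
  have hker (x : A) (hx : f x = 0) : ∃ k : ℤ, x = k • (τ • R - R) := by
    have h1 := (h.ker _).mp (h.map_smul_sub hP τ)
    have h2 := (h.ker _).mp hx
    have hc : Nat.card (AddSubgroup.zmultiples T) = 5 := by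
      rw [Nat.card_zmultiples]
      exact addOrderOf_eq_prime h.five hT5
    have h3 := mem_zmultiples_of_prime_card (p := 5) hc
      (g := (⟨τ • R - R, h1⟩ : AddSubgroup.zmultiples T)) (g' := ⟨x, h2⟩)
      (by rw [ne_eq, AddSubgroup.mk_eq_zero, sub_eq_zero]; exact hτR)
    obtain ⟨k, hk⟩ := AddSubgroup.mem_zmultiples_iff.mp h3
    exact ⟨k, (congrArg Subtype.val hk).symm⟩
  obtain ⟨k, hk⟩ := hker (τ • S - S) (h.map_smul_sub hQ τ)
  have hpow (U : A) (hU : ∀ σ : G, σ • f U = f U) (j : ℤ) : τ ^ j • U = U + j • (τ • U - U) := by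
    obtain ⟨u, hu⟩ : ∃ u, u = τ • U - U := ⟨_, rfl⟩
    have hτu : τ ∈ MulAction.stabilizer G u :=
      h.smul_of_map_eq_zero hτT (hu ▸ h.map_smul_sub hU τ)
    have hzu (j : ℤ) : τ ^ j • u = u := zpow_mem hτu j
    have h1 : τ • U = U + u := by rw [hu]; abel
    have h2 : τ⁻¹ • U = U - u := by
      rw [inv_smul_eq_iff, smul_sub, h1, show τ • u = u from hτu, add_sub_cancel_right]
    rw [← hu]
    induction j with
    | zero => simp
    | succ n ih => rw [zpow_add_one, mul_smul, h1, smul_add, ih, hzu, add_smul, one_smul, add_assoc]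
    | pred n ih => rw [zpow_sub_one, mul_smul, h2, smul_sub, ih, hzu, sub_smul, one_smul, add_sub]
  refine ⟨k, ?_⟩
  have key : f (S - k • R) ∈ fixedImage G f := by
    refine h.map_mem_of_smul_eq (fun σ hσ => ?_) (fun σ => ?_)
    -- Here σ and τʲ move R alike, so τ⁻ʲσ fixes T and R and therefore S. Thus σS - S = jk(τR - R) =
    -- k(σR - R), and S - kR is fixed by σ.
    · obtain ⟨j, hj⟩ := hker (σ • R - R) (h.map_smul_sub hP σ)
      have hτj : τ ^ (-j) • T = T := zpow_mem (show τ ∈ MulAction.stabilizer G T from hτT) _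
      have h1 := hstab (τ ^ (-j) * σ) (by rw [mul_smul, hσ, hτj]) (by
        rw [mul_smul, zpow_neg, inv_smul_eq_iff, hpow R hP, ← hj]
        abel)
      rw [mul_smul, zpow_neg, inv_smul_eq_iff, hpow S hQ, hk] at h1
      have h2 : σ • R = R + j • (τ • R - R) := by rw [← hj]; abel
      rw [smul_sub, smul_comm σ k, h1, h2, smul_add, smul_comm j k]
      abel
    · rw [map_sub, map_zsmul, smul_sub, smul_comm σ k, hP, hQ]
  rwa [map_sub, map_zsmul] at key

/-- The converse of `exists_zsmul_sub_mem`: a fixed point plus k times a point over P lies over Q,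
so an automorphism fixing the fibre over P fixes it. -/
theorem smul_fibre_of_sub_mem {P Q : B} {k : ℤ} (hPQ : Q - k • P ∈ fixedImage G f) {σ : G}
    (hσ : ∀ R, f R = P → σ • R = R) : ∀ R, f R = Q → σ • R = R := by
  obtain ⟨R, rfl⟩ := h.surj P
  obtain ⟨S, hS, hSQ⟩ := hPQ
  rw [h.smul_fibre_iff] at hσ
  have hQ : Q = f (S + k • R) := by rw [map_add, map_zsmul, hSQ]; abel
  rw [hQ, h.smul_fibre_iff]
  exact ⟨hσ.1, by rw [smul_add, smul_comm σ k, hS, hσ.2]⟩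

end IsDihedralIsogeny

end GaloisModule

/-- A complete invariant of the cyclic subgroups of order `5` of a quotient of exponent `5`. -/
theorem exists_bijOn_of_zmultiples {C F : Type*} [Nonempty F] [AddCommGroup C] (N : AddSubgroup C)
    (L : C → F)
    (h5 : ∀ P : C, 5 • P ∈ N) (hL : ∀ P ∉ N, ∀ Q ∉ N, L P = L Q ↔
      AddSubgroup.zmultiples (P : C ⧸ N) = AddSubgroup.zmultiples (Q : C ⧸ N)) :
    ∃ Φ : AddSubgroup (C ⧸ N) → F,
      Set.BijOn Φ {S | Nat.card S = 5} {l | ∃ P, P ∉ N ∧ l = L P} ∧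
      ∀ P, P ∉ N → Nat.card (AddSubgroup.zmultiples (P : C ⧸ N)) = 5 ∧
        Φ (AddSubgroup.zmultiples (P : C ⧸ N)) = L P := by
  classical
  have : Fact (Nat.Prime 5) := ⟨by norm_num⟩
  have hcard (P : C) (hP : P ∉ N) : Nat.card (AddSubgroup.zmultiples (P : C ⧸ N)) = 5 := by
    rw [Nat.card_zmultiples]
    refine addOrderOf_eq_prime ?_ ((QuotientAddGroup.eq_zero_iff P).not.mpr hP)
    rw [← QuotientAddGroup.mk_nsmul]
    exact (QuotientAddGroup.eq_zero_iff _).mpr (h5 P)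
  have hgen (S : AddSubgroup (C ⧸ N)) (hS : Nat.card S = 5) :
      ∃ P, P ∉ N ∧ S = AddSubgroup.zmultiples (P : C ⧸ N) := by
    have hne : S ≠ ⊥ := by
      rintro rfl
      rw [AddSubgroup.card_bot] at hS
      norm_num at hS
    obtain ⟨⟨x, hx⟩, hx0⟩ := AddSubgroup.ne_bot_iff_exists_ne_zero.mp hne
    rw [ne_eq, AddSubgroup.mk_eq_zero] at hx0
    obtain ⟨P, rfl⟩ := QuotientAddGroup.mk_surjective x
    have hP : P ∉ N := fun h => hx0 ((QuotientAddGroup.eq_zero_iff P).mpr h)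
    have : Finite S := Nat.finite_of_card_ne_zero (by rw [hS]; norm_num)
    refine ⟨P, hP, (AddSubgroup.eq_of_le_of_card_ge ?_ ?_).symm⟩
    · rwa [AddSubgroup.zmultiples_le]
    · rw [hS, hcard P hP]
  -- A generator is chosen, and `hL` makes its value independent of the choice. Subgroups not
  -- generated by the class of a point outside N, in particular the trivial one, get an arbitrary
  -- value.
  let Φ : AddSubgroup (C ⧸ N) → F := fun S =>
    if h : ∃ P, P ∉ N ∧ S = AddSubgroup.zmultiples (P : C ⧸ N) then L h.choose
    else Classical.arbitrary F
  have hΦ (P : C) (hP : P ∉ N) : Φ (AddSubgroup.zmultiples (P : C ⧸ N)) = L P := by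
    have h : ∃ P', P' ∉ N ∧
      AddSubgroup.zmultiples (P : C ⧸ N) = AddSubgroup.zmultiples (P' : C ⧸ N) := ⟨P, hP, rfl⟩
    simp only [Φ, dif_pos h]
    exact (hL _ h.choose_spec.1 _ hP).mpr h.choose_spec.2.symm
  refine ⟨Φ, ⟨fun S hS => ?_, fun S hS S' hS' e => ?_, ?_⟩, fun P hP => ⟨hcard P hP, hΦ P hP⟩⟩
  · obtain ⟨P, hP, rfl⟩ := hgen S hS
    exact ⟨P, hP, hΦ P hP⟩
  · obtain ⟨P, hP, rfl⟩ := hgen S hS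
    obtain ⟨Q, hQ, rfl⟩ := hgen S' hS'
    rw [hΦ P hP, hΦ Q hQ] at e
    exact (hL P hP Q hQ).mp e
  · rintro _ ⟨P, hP, rfl⟩
    exact ⟨_, hcard P hP, hΦ P hP⟩

/-! ### Compatibility of φ* with field homomorphisms. -/

section Maps

variable {F K : Type*} [Field F] [Field K]

theorem map_lambdaX (f : F →+* K) (A X : F) : f (lambdaX A X) = lambdaX (f A) (f X) := by
  simp [lambdaX, lambdaNum, _root_.map_ofNat f]

theorem map_lambdaXDeriv (f : F →+* K) (A X : F) :
    f (lambdaXDeriv A X) = lambdaXDeriv (f A) (f X) := by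
  simp [lambdaXDeriv, lambdaNum, lambdaNumDeriv, _root_.map_ofNat f]

theorem map_twistX (f : F →+* K) (A D x : F) : f (twistX A D x) = twistX (f A) (f D) (f x) := by
  simp [twistX, _root_.map_ofNat f]

variable [Algebra ℚ F] [Algebra ℚ K] {a b : ℚ} (ha : a ≠ 0) (hd : d a b ≠ 0)
  [DecidableEq F] [DecidableEq K]

theorem map_dualIsogeny (f : F →ₐ[ℚ] K) (R : EstarPoint a b F) :
    WeierstrassCurve.Affine.Point.map f (dualIsogeny ha hd F R) =
      dualIsogeny ha hd K (WeierstrassCurve.Affine.Point.map f R) := by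
  have hA : algebraMap ℚ K a = f (algebraMap ℚ F a) := (f.commutes a).symm
  have hD : algebraMap ℚ K (d a b) = f (algebraMap ℚ F (d a b)) := (f.commutes _).symm
  match R with
  | .zero => rfl
  | .some x y h =>
    rw [WeierstrassCurve.Affine.Point.map_some]
    unfold dualIsogeny
    simp only
    have e : twistX (algebraMap ℚ K a) (algebraMap ℚ K (d a b)) (f x) =
        f (twistX (algebraMap ℚ F a) (algebraMap ℚ F (d a b)) x) := by
      rw [hA, hD]; exact (map_twistX (f : F →+* K) _ _ _).symm
    by_cases hX : twistX (algebraMap ℚ F a) (algebraMap ℚ F (d a b)) x ≠ 0 ∧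
        twistX (algebraMap ℚ F a) (algebraMap ℚ F (d a b)) x ≠ algebraMap ℚ F a
    · rw [dif_pos hX, dif_pos (by
        rw [e, hA]
        exact ⟨(map_ne_zero f).mpr hX.1, f.injective.ne hX.2⟩),
        WeierstrassCurve.Affine.Point.map_some]
      have e1 : ∀ X, f (lambdaX (algebraMap ℚ F a) X) = lambdaX (algebraMap ℚ K a) (f X) :=
        fun X => by rw [hA]; exact map_lambdaX (f : F →+* K) _ _
      have e2 : ∀ X, f (lambdaXDeriv (algebraMap ℚ F a) X) =
          lambdaXDeriv (algebraMap ℚ K a) (f X) :=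
        fun X => by rw [hA]; exact map_lambdaXDeriv (f : F →+* K) _ _
      rw [WeierstrassCurve.Affine.Point.some.injEq]
      simp only [map_mul, map_add, map_div₀, map_ofNat, e1, e2, e, ← hA, ← hD, and_self]
    · rw [dif_neg hX, dif_neg (by
        rw [e, hA, _root_.map_ne_zero,
          show ∀ u v, (f u ≠ f v ↔ u ≠ v) from fun _ _ => f.injective.ne_iff]
        exact hX)]
      exact map_zero _

end Maps

/-! ### The Galois action on points and descent of fixed points to ℚ. -/

section Action

variable {K : Type*} [Field K] [Algebra ℚ K] [DecidableEq K] {W : WeierstrassCurve ℚ}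

/-- The action of the automorphisms of `K` on the points over `K` of a curve over `ℚ`. -/
noncomputable instance : DistribMulAction (K ≃ₐ[ℚ] K) (W.baseChange K).toAffine.Point where
  smul σ P := WeierstrassCurve.Affine.Point.map (W' := W) σ.toAlgHom P
  one_smul P := WeierstrassCurve.Affine.Point.map_id P
  mul_smul σ τ P := (WeierstrassCurve.Affine.Point.map_map τ.toAlgHom σ.toAlgHom P).symm
  smul_zero _ := map_zero _
  smul_add _ := map_add _

theorem smul_some (σ : K ≃ₐ[ℚ] K) {x y : K} (h : (W.baseChange K).toAffine.Nonsingular x y)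
    {x' y' : K} (hx : σ x = x') (hy : σ y = y') :
    ∃ h', σ • WeierstrassCurve.Affine.Point.some x y h = .some x' y' h' := by
  subst hx hy
  exact ⟨_, WeierstrassCurve.Affine.Point.map_some σ.toAlgHom h⟩

theorem smul_baseChange (σ : K ≃ₐ[ℚ] K) (P : (W.baseChange ℚ).toAffine.Point) :
    σ • WeierstrassCurve.Affine.Point.baseChange (W' := W) ℚ K P =
      WeierstrassCurve.Affine.Point.baseChange (W' := W) ℚ K P :=
  WeierstrassCurve.Affine.Point.map_baseChange (W' := W) σ.toAlgHom P

theorem exists_baseChange_eq [IsGalois ℚ K] {P : (W.baseChange K).toAffine.Point}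
    (hP : ∀ σ : K ≃ₐ[ℚ] K, σ • P = P) :
    ∃ P₀, WeierstrassCurve.Affine.Point.baseChange (W' := W) ℚ K P₀ = P := by
  match P with
  | .zero => exact ⟨0, map_zero _⟩
  | .some x y h =>
    have hfix (σ : K ≃ₐ[ℚ] K) : σ x = x ∧ σ y = y := by
      obtain ⟨h', e⟩ := smul_some σ h rfl rfl
      have := e.symm.trans (hP σ)
      rwa [WeierstrassCurve.Affine.Point.some.injEq] at this
    obtain ⟨x, rfl⟩ := (InfiniteGalois.mem_range_algebraMap_iff_fixed x).mpr fun σ => (hfix σ).1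
    obtain ⟨y, rfl⟩ := (InfiniteGalois.mem_range_algebraMap_iff_fixed y).mpr fun σ => (hfix σ).2
    exact ⟨.some x y ((WeierstrassCurve.Affine.baseChange_nonsingular W (f := Algebra.ofId ℚ K)
      (Algebra.ofId ℚ K).injective x y).mp h), rfl⟩

end Action

/-! ### φ* as a Galois-equivariant isogeny over the algebraic closure, and its dual. -/

section Geometric

variable {K : Type*} [Field K] [Algebra ℚ K] {a b : ℚ}
  (ha : a ≠ 0) (hd : d a b ≠ 0)

variable (a b) in
theorem exists_sqrt [IsAlgClosed K] : ∃ δ : K, δ ^ 2 = algebraMap ℚ K (d a b) :=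
  IsAlgClosed.exists_pow_nat_eq _ two_pos

theorem apply_sqrt {δ : K} (hδ : δ ^ 2 = algebraMap ℚ K (d a b)) (σ : K ≃ₐ[ℚ] K) :
    σ δ = δ ∨ σ δ = -δ := by
  rw [← sq_eq_sq_iff_eq_or_eq_neg, ← map_pow, hδ, σ.commutes]

variable [DecidableEq K]

theorem StarCoords.smul {δ : K} {R : EstarPoint a b K} {X Y : K}
    (h : StarCoords a b δ R X Y) (σ : K ≃ₐ[ℚ] K) (hσ : σ δ = δ) :
    StarCoords a b δ (σ • R) (σ X) (σ Y) := by
  obtain ⟨h, rfl⟩ := h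
  have e1 : σ ((10 * δ) ^ 2 * X + 8 * algebraMap ℚ K (d a b) *
      (algebraMap ℚ K a ^ 2 - 5 * algebraMap ℚ K a + 1)) = (10 * δ) ^ 2 * σ X +
      8 * algebraMap ℚ K (d a b) * (algebraMap ℚ K a ^ 2 - 5 * algebraMap ℚ K a + 1) := by
    simp [hσ, _root_.map_ofNat σ]
  have e2 : σ ((10 * δ) ^ 3 * Y / 2) = (10 * δ) ^ 3 * σ Y / 2 := by
    simp [hσ, _root_.map_ofNat σ]
  exact smul_some σ h e1 e2

/-- The factor (10δ)³ in the ordinate is odd in δ, which produces the sign; the abscissa involves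
only δ². -/
theorem StarCoords.smul_neg {δ : K} {R : EstarPoint a b K} {X Y : K}
    (h : StarCoords a b δ R X Y) (σ : K ≃ₐ[ℚ] K) (hσ : σ δ = -δ) :
    StarCoords a b δ (σ • R) (σ X) (-σ Y) := by
  obtain ⟨h, rfl⟩ := h
  have e1 : σ ((10 * δ) ^ 2 * X + 8 * algebraMap ℚ K (d a b) *
      (algebraMap ℚ K a ^ 2 - 5 * algebraMap ℚ K a + 1)) = (10 * δ) ^ 2 * σ X +
      8 * algebraMap ℚ K (d a b) * (algebraMap ℚ K a ^ 2 - 5 * algebraMap ℚ K a + 1) := by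
    simp [hσ, _root_.map_ofNat σ]
  have e2 : σ ((10 * δ) ^ 3 * Y / 2) = (10 * δ) ^ 3 * (-σ Y) / 2 := by
    simp [hσ, _root_.map_ofNat σ]; ring
  exact smul_some σ h e1 e2

theorem smul_kernel_point {δ : K} {T : EstarPoint a b K}
    (hT : StarCoords a b δ T 0 (-algebraMap ℚ K a)) {σ : K ≃ₐ[ℚ] K}
    (hσ : σ δ = δ) : σ • T = T := by
  have := hT.smul σ hσ
  rw [map_zero, map_neg, σ.commutes] at this
  exact HasCoords.ext this hT

variable [IsAlgClosed K]

variable (K) in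
/-- The dual isogeny over an algebraically closed field, as a homomorphism. -/
noncomputable def dualIsogenyHom : EstarPoint a b K →+ EPoint a b K :=
  AddMonoidHom.mk' (dualIsogeny ha hd K) fun P Q => by
    obtain ⟨δ, hδ⟩ := IsAlgClosed.exists_pow_nat_eq (algebraMap ℚ K (d a b)) two_pos
    exact dualIsogeny_add ha hd hδ P Q

theorem dualIsogenyHom_apply (R : EstarPoint a b K) :
    dualIsogenyHom K ha hd R = dualIsogeny ha hd K R := rfl

/-- The quadratic character on the kernel is that of ℚ(√d): in the coordinates (X, Y) the generator
is (0, -a), with rational entries, so only the sign of σδ matters. -/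
theorem isDihedralIsogeny {δ : K} (hδ : δ ^ 2 = algebraMap ℚ K (d a b))
    {T : EstarPoint a b K} (hT : StarCoords a b δ T 0 (-algebraMap ℚ K a)) :
    IsDihedralIsogeny (K ≃ₐ[ℚ] K) (dualIsogenyHom K ha hd) T where
  smul σ R := (map_dualIsogeny ha hd σ.toAlgHom R).symm
  surj := dualIsogeny_surjective ha hd hδ
  ker _ := dualIsogeny_eq_zero_iff_mem ha hd hδ hT
  five := kernel_point_five ha hd hδ hT
  smul_gen σ := by
    have : CharZero K := algebraRat.charZero K
    rcases apply_sqrt hδ σ with hσ | hσ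
    · exact .inl (smul_kernel_point hT hσ)
    · have := hT.smul_neg σ hσ
      rw [map_zero, map_neg, σ.commutes] at this
      exact .inr (HasCoords.ext this (HasCoords.neg hT (Estar_isModel ha hd rfl rfl hδ)))

theorem card_ker_dualIsogenyHom : Nat.card (dualIsogenyHom K ha hd).ker = 5 := by
  obtain ⟨δ, hδ⟩ := exists_sqrt (K := K) a b
  obtain ⟨T, hT⟩ := exists_kernel_point ha hd hδ
  rw [← card_zmultiples_kernel_point ha hd hδ hT]
  congr 2
  ext R
  exact dualIsogeny_eq_zero_iff_mem ha hd hδ hT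

/-- The isogeny `φ` whose dual is `φ*`. -/
theorem exists_isogeny : ∃ φ : EPoint a b K →+ EstarPoint a b K,
    (∀ P, dualIsogenyHom K ha hd (φ P) = 5 • P) ∧ (∀ R, φ (dualIsogenyHom K ha hd R) = 5 • R) ∧
    ∀ (σ : K →ₐ[ℚ] K) (P), φ (WeierstrassCurve.Affine.Point.map σ P) =
      WeierstrassCurve.Affine.Point.map σ (φ P) := by
  obtain ⟨δ, hδ⟩ := exists_sqrt (K := K) a b
  obtain ⟨T, hT⟩ := exists_kernel_point ha hd hδ
  have H := isDihedralIsogeny ha hd hδ hT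
  -- Multiplication by 5 kills ker φ*, so it factors through the surjection φ*; the factor is φ.
  have key : (dualIsogenyHom K ha hd).ker ≤ (nsmulAddMonoidHom (α := EstarPoint a b K) 5).ker :=
    fun R hR => H.five_nsmul hR
  obtain ⟨φ, hφ⟩ : ∃ φ : EPoint a b K →+ EstarPoint a b K,
      ∀ R, φ (dualIsogenyHom K ha hd R) = 5 • R :=
    ⟨AddMonoidHom.liftOfSurjective (dualIsogenyHom K ha hd) H.surj ⟨_, key⟩, fun R =>
      AddMonoidHom.liftOfRightInverse_comp_apply _ _ _ _ R⟩
  refine ⟨φ, fun P => ?_, hφ, fun σ P => ?_⟩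
  · obtain ⟨R, rfl⟩ := H.surj P
    rw [hφ, map_nsmul]
  · obtain ⟨R, rfl⟩ := H.surj P
    rw [hφ, dualIsogenyHom_apply, map_dualIsogeny, ← dualIsogenyHom_apply, hφ, map_nsmul]

end Geometric

/-! ### φ* on rational points. -/

section Rational

variable {a b : ℚ} (ha : a ≠ 0) (hd : d a b ≠ 0)

theorem baseChange_dualIsogeny (K : Type*) [Field K] [Algebra ℚ K] [DecidableEq K]
    (R : EstarPoint a b ℚ) :
    WeierstrassCurve.Affine.Point.baseChange (W' := E a b) ℚ K (dualIsogeny ha hd ℚ R) =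
      dualIsogeny ha hd K (WeierstrassCurve.Affine.Point.baseChange (W' := Estar a b) ℚ K R) :=
  map_dualIsogeny ha hd (Algebra.ofId ℚ K) R

theorem baseChange_injective (W : WeierstrassCurve ℚ) (K : Type*) [Field K] [Algebra ℚ K]
    [DecidableEq K] : Function.Injective (WeierstrassCurve.Affine.Point.baseChange (W' := W) ℚ K) :=
  WeierstrassCurve.Affine.Point.map_injective _

/-- The dual isogeny over `ℚ`, as a homomorphism. -/
noncomputable def ratDualIsogeny : EstarPoint a b ℚ →+ EPoint a b ℚ :=
  AddMonoidHom.mk' (dualIsogeny ha hd ℚ) fun P Q => by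
    classical
    refine baseChange_injective (E a b) (AlgebraicClosure ℚ) ?_
    simp only [map_add, baseChange_dualIsogeny]
    exact map_add (dualIsogenyHom (AlgebraicClosure ℚ) ha hd) _ _

/-- Galois-fixed points over K are rational, so the image of `E*(ℚ)` is what `fixedImage` describes
over K. This makes the abstract descent applicable. -/
theorem mem_range_ratDualIsogeny (K : Type*) [Field K] [Algebra ℚ K] [DecidableEq K]
    [IsAlgClosed K] [IsGalois ℚ K] {P : EPoint a b ℚ} :
    P ∈ (ratDualIsogeny ha hd).range ↔
      WeierstrassCurve.Affine.Point.baseChange (W' := E a b) ℚ K P ∈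
        fixedImage (K ≃ₐ[ℚ] K) (dualIsogenyHom K ha hd) := by
  constructor
  · rintro ⟨R, rfl⟩
    exact ⟨_, fun σ => smul_baseChange σ R, (baseChange_dualIsogeny ha hd K R).symm⟩
  · rintro ⟨R, hR, e⟩
    obtain ⟨R, rfl⟩ := exists_baseChange_eq hR
    exact ⟨R, baseChange_injective _ K ((baseChange_dualIsogeny ha hd K R).trans e)⟩

end Rational

/-- The algebraic closure of `ℚ` is Galois over `ℚ`. -/
instance : IsGalois ℚ (AlgebraicClosure ℚ) := by
  -- The available instance concerns `AlgebraicClosure.instAlgebra`; all ℚ-algebra structures on a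
  -- given ring agree.
  convert @IsAlgClosure.isGalois ℚ (AlgebraicClosure ℚ) _ _ (AlgebraicClosure.instAlgebra ℚ) _ _
  exact Subsingleton.elim _ _

/-! ### Brumer's quintic as the equation of a fibre of λ. -/

section Quintic

theorem natDegree_quintic (a b : ℚ) : (quintic a b).natDegree = 5 := by
  unfold quintic
  compute_degree!

theorem quintic_ne_zero (a b : ℚ) : quintic a b ≠ 0 := fun h => by
  have := natDegree_quintic a b
  rw [h, natDegree_zero] at this
  norm_num at this

theorem aeval_quintic {K : Type*} [Field K] [Algebra ℚ K] (a b : ℚ) (z : K) :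
    aeval z (quintic a b) = z ^ 5 + (algebraMap ℚ K a - 3) * z ^ 4
      - (algebraMap ℚ K a - algebraMap ℚ K b - 3) * z ^ 3
      + (algebraMap ℚ K a ^ 2 - algebraMap ℚ K a - 2 * algebraMap ℚ K b - 1) * z ^ 2
      + algebraMap ℚ K b * z + algebraMap ℚ K a := by
  simp [quintic, _root_.map_ofNat (algebraMap ℚ K)]

/-- The link between the polynomial and the isogeny: under z = a/X the quintic becomes, up to
nonzero factors, the numerator of λ(X) + b + 2a. -/
theorem aeval_quintic_div {K : Type*} [Field K] [Algebra ℚ K] (a b : ℚ) {X : K} (h0 : X ≠ 0) :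
    X ^ 5 * aeval (algebraMap ℚ K a / X) (quintic a b) = algebraMap ℚ K a *
      (lambdaNum (algebraMap ℚ K a) X + (algebraMap ℚ K b + 2 * algebraMap ℚ K a) *
        (X ^ 2 * (X - algebraMap ℚ K a) ^ 2)) := by
  rw [aeval_quintic]
  unfold lambdaNum
  field_simp
  ring

theorem aeval_quintic_div_eq_zero_iff {K : Type*} [Field K] [Algebra ℚ K] {a : ℚ} (ha : a ≠ 0)
    (b : ℚ) {X : K} (h0 : X ≠ 0) : aeval (algebraMap ℚ K a / X) (quintic a b) = 0 ↔
      X ≠ algebraMap ℚ K a ∧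
        algebraMap ℚ K b = -(lambdaX (algebraMap ℚ K a) X + 2 * algebraMap ℚ K a) := by
  have hA : algebraMap ℚ K a ≠ 0 := (_root_.map_ne_zero _).mpr ha
  have key := aeval_quintic_div a b h0
  rw [← mul_right_inj' (pow_ne_zero 5 h0), mul_zero, key, mul_eq_zero, or_iff_right hA]
  by_cases h1 : X = algebraMap ℚ K a
  · refine iff_of_false (fun h => ?_) (fun h => h.1 h1)
    apply pow_ne_zero 6 hA
    rw [← h, h1]
    unfold lambdaNum
    ring
  · have h1' : X - algebraMap ℚ K a ≠ 0 := sub_ne_zero.mpr h1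
    rw [and_iff_right h1]
    unfold lambdaX
    constructor
    · intro h
      field_simp
      linear_combination h
    · intro h
      rw [h]
      field_simp
      ring

end Quintic

/-! ### Roots of B(P; X) as the fibre of φ* over P: irreducibility and splitting fields. -/

section Roots

variable {K : Type*} [Field K] [Algebra ℚ K] {a b : ℚ}

/-- The root `a / X` of the quintic polynomial attached to a point of `E*_{a,b}` whose
normalized first coordinate is `X`. -/
noncomputable def fibreRoot : EstarPoint a b K → K
  | .zero => 0
  | .some x _ _ => algebraMap ℚ K a / twistX (algebraMap ℚ K a) (algebraMap ℚ K (d a b)) x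

theorem StarCoords.fibreRoot (hd : d a b ≠ 0) {δ : K} (hδ : δ ^ 2 = algebraMap ℚ K (d a b))
    {R : EstarPoint a b K} {X Y : K} (h : StarCoords a b δ R X Y) :
    fibreRoot R = algebraMap ℚ K a / X := by
  obtain ⟨h, rfl⟩ := h
  change _ / _ = _
  rw [twistX_eq hd hδ]

theorem fibreRoot_smul [DecidableEq K] (σ : K ≃ₐ[ℚ] K) (R : EstarPoint a b K) :
    fibreRoot (σ • R) = σ (fibreRoot R) := by
  match R with
  | .zero => exact (map_zero σ).symm
  | .some x y h =>
    obtain ⟨h', e⟩ := smul_some σ h rfl rfl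
    rw [e]
    have := map_twistX (σ : K →+* K) (algebraMap ℚ K a) (algebraMap ℚ K (d a b)) x
    simp only [RingHom.coe_coe, AlgEquiv.commutes] at this
    change _ / _ = σ (_ / _)
    rw [map_div₀, σ.commutes, this]

theorem quinticAt_ne_zero {P : EPoint a b ℚ} (hP : P ≠ 0) : quinticAt a b P ≠ 0 := by
  match P, hP with
  | .zero, hP => exact absurd rfl hP
  | .some x y h, _ => exact quintic_ne_zero _ _

theorem natDegree_quinticAt {P : EPoint a b ℚ} (hP : P ≠ 0) : (quinticAt a b P).natDegree = 5 := by
  match P, hP with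
  | .zero, hP => exact absurd rfl hP
  | .some x y h, _ => exact natDegree_quintic _ _

variable (ha : a ≠ 0) (hd : d a b ≠ 0)

include ha hd in
/-- The coordinates of a rational point of `E_{a,b}` and its quintic polynomial. -/
theorem exists_baseCoords_quinticAt [DecidableEq K] {δ : K} (hδ : δ ^ 2 = algebraMap ℚ K (d a b))
    {P : EPoint a b ℚ} (hP : P ≠ 0) : ∃ v w b',
      BaseCoords a b δ (WeierstrassCurve.Affine.Point.baseChange (W' := E a b) ℚ K P) v w ∧
      quinticAt a b P = quintic a b' ∧ algebraMap ℚ K b' = -(v + 2 * algebraMap ℚ K a) := by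
  have : CharZero K := algebraRat.charZero K
  match P, hP with
  | .zero, hP => exact absurd rfl hP
  | .some x y h, _ =>
    obtain ⟨v, w, hvw⟩ := exists_baseCoords ha hd hδ (P :=
      WeierstrassCurve.Affine.Point.baseChange (W' := E a b) ℚ K (.some x y h)) (by
        rw [ne_eq, _root_.map_eq_zero_iff _ (baseChange_injective (E a b) K)]
        exact WeierstrassCurve.Affine.Point.some_ne_zero h)
    refine ⟨v, w, _, hvw, rfl, ?_⟩
    obtain ⟨h', e⟩ := hvw
    have e1 : algebraMap ℚ K x = (2 * δ) ^ 2 * v + 8 * algebraMap ℚ K (d a b) * algebraMap ℚ K a :=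
      (WeierstrassCurve.Affine.Point.some.inj e).1
    have hD : algebraMap ℚ K (d a b) ≠ 0 := (_root_.map_ne_zero _).mpr hd
    rw [map_div₀, e1, mul_pow, hδ, _root_.map_mul, _root_.map_neg,
      _root_.map_ofNat (algebraMap ℚ K)]
    field_simp
    ring

theorem not_irreducible_quinticAt {P : EPoint a b ℚ} (hP : P ≠ 0)
    (h : P ∈ (ratDualIsogeny ha hd).range) : ¬ Irreducible (quinticAt a b P) := by
  obtain ⟨R, rfl⟩ := h
  suffices ∃ z, IsRoot (quinticAt a b (ratDualIsogeny ha hd R)) z by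
    obtain ⟨z, hz⟩ := this
    intro hirr
    have := degree_eq_one_of_irreducible_of_root hirr hz
    rw [degree_eq_natDegree (quinticAt_ne_zero hP), natDegree_quinticAt hP] at this
    norm_num at this
  change dualIsogeny ha hd ℚ R ≠ 0 at hP
  change ∃ z, IsRoot (quinticAt a b (dualIsogeny ha hd ℚ R)) z
  match R with
  | .zero => exact absurd rfl hP
  | .some x y h =>
    unfold dualIsogeny at hP ⊢
    dsimp only at hP ⊢
    split_ifs at hP ⊢ with hX
    · have := (aeval_quintic_div_eq_zero_iff (K := ℚ) ha
        (-(lambdaX a (twistX a (d a b) x) + 2 * a)) hX.1).mpr ⟨hX.2, rfl⟩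
      refine ⟨a / twistX a (d a b) x, ?_⟩
      change IsRoot (quintic a (4 * d a b * (lambdaX a (twistX a (d a b) x) + 2 * a) /
        (-4 * d a b))) _
      rw [show 4 * d a b * (lambdaX a (twistX a (d a b) x) + 2 * a) / (-4 * d a b) =
        -(lambdaX a (twistX a (d a b) x) + 2 * a) by field_simp, IsRoot.def, ← coe_aeval_eq_eval]
      exact this
    · exact absurd rfl hP

theorem five_nsmul_mem_range (P : EPoint a b ℚ) : 5 • P ∈ (ratDualIsogeny ha hd).range := by
  classical
  obtain ⟨δ, hδ⟩ := exists_sqrt (K := AlgebraicClosure ℚ) a b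
  obtain ⟨T, hT⟩ := exists_kernel_point ha hd hδ
  have h5 := (isDihedralIsogeny ha hd hδ hT).five_nsmul_mem (fun σ => smul_baseChange σ P)
  rwa [← map_nsmul, ← mem_range_ratDualIsogeny] at h5

/-- If 2P = 0 then P = 5P, which always lies in the image. -/
theorem add_self_ne_zero {P : EPoint a b ℚ} (h : P ∉ (ratDualIsogeny ha hd).range) :
    P + P ≠ 0 := by
  intro h2
  apply h
  convert five_nsmul_mem_range ha hd P using 1
  rw [show 5 • P = P + P + (P + P) + P by abel, h2, zero_add, zero_add]

variable [DecidableEq K] [IsAlgClosed K]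

/-- Equal roots mean equal X, so R' = ±R, and R' = -R would give P = -P. -/
theorem fibreRoot_injOn {P : EPoint a b K} (hP : P + P ≠ 0) :
    Set.InjOn fibreRoot {R : EstarPoint a b K | dualIsogenyHom K ha hd R = P} := by
  intro R hR R' hR' e
  obtain ⟨δ, hδ⟩ := exists_sqrt (K := K) a b
  have : CharZero K := algebraRat.charZero K
  have hA : algebraMap ℚ K a ≠ 0 := (_root_.map_ne_zero _).mpr ha
  have hne : P ≠ 0 := by rintro rfl; exact hP (add_zero 0)
  obtain ⟨X, Y, h, h0, h1⟩ := exists_coords_of_dualIsogeny_ne_zero ha hd hδ (R := R)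
    (by rw [← dualIsogenyHom_apply, hR]; exact hne)
  obtain ⟨X', Y', h', h0', h1'⟩ := exists_coords_of_dualIsogeny_ne_zero ha hd hδ (R := R')
    (by rw [← dualIsogenyHom_apply, hR']; exact hne)
  rw [h.fibreRoot hd hδ, h'.fibreRoot hd hδ, div_eq_div_iff h0 h0', mul_right_inj' hA] at e
  subst e
  rcases HasCoords.eq_or_eq_neg h h' (Estar_isModel ha hd rfl rfl hδ) with rfl | rfl
  · rfl
  · refine absurd ?_ hP
    rw [Set.mem_ofPred_eq, map_neg, hR] at hR'
    nth_rewrite 1 [← hR']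
    exact neg_add_cancel P

theorem aeval_quinticAt_eq_zero_iff {P : EPoint a b ℚ} (hP : P ≠ 0) (z : K) :
    aeval z (quinticAt a b P) = 0 ↔ ∃ R, dualIsogenyHom K ha hd R =
      WeierstrassCurve.Affine.Point.baseChange (W' := E a b) ℚ K P ∧ fibreRoot R = z := by
  have : CharZero K := algebraRat.charZero K
  have hA : algebraMap ℚ K a ≠ 0 := (_root_.map_ne_zero _).mpr ha
  obtain ⟨δ, hδ⟩ := exists_sqrt (K := K) a b
  obtain ⟨v, w, b', hvw, e, hb⟩ := exists_baseCoords_quinticAt ha hd hδ hP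
  have M := E_isModel (K := K) ha hd rfl rfl hδ
  rw [e]
  constructor
  · intro h
    have hz : z ≠ 0 := by
      rintro rfl
      rw [aeval_quintic] at h
      apply hA
      linear_combination h
    have hX : algebraMap ℚ K a / z ≠ 0 := div_ne_zero hA hz
    have hzz : z = algebraMap ℚ K a / (algebraMap ℚ K a / z) := by field_simp
    rw [hzz, aeval_quintic_div_eq_zero_iff ha b' hX, hb] at h
    obtain ⟨R, Y, hR⟩ := exists_star_point ha hd hδ (algebraMap ℚ K a / z)
    have h1 := hR.dualIsogeny ha hd hδ hX h.1
    rw [show lambdaX (algebraMap ℚ K a) (algebraMap ℚ K a / z) = v by linear_combination h.2] at h1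
    rcases HasCoords.eq_or_eq_neg h1 hvw M with h2 | h2
    · exact ⟨R, h2.symm, by rw [hR.fibreRoot hd hδ, ← hzz]⟩
    · refine ⟨-R, by rw [map_neg]; exact h2.symm, ?_⟩
      rw [StarCoords.fibreRoot hd hδ (HasCoords.neg hR (Estar_isModel ha hd rfl rfl hδ)), ← hzz]
  · rintro ⟨R, hR, rfl⟩
    obtain ⟨X, Y, h, h0, h1⟩ := exists_coords_of_dualIsogeny_ne_zero ha hd hδ (R := R) (by
      rw [← dualIsogenyHom_apply, hR]; exact hvw.ne_zero)
    have h2 := h.dualIsogeny ha hd hδ h0 h1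
    rw [← dualIsogenyHom_apply, hR] at h2
    rw [h.fibreRoot hd hδ, aeval_quintic_div_eq_zero_iff ha b' h0, hb]
    exact ⟨h1, by rw [(hvw.unique h2 M.t_ne).1]⟩

/-- A proper factor p selects the Galois-stable set of those R over P at which a/X(R) is a root of
p. Its size lies strictly between 0 and 5, hence is prime to 5, and `mem_of_finset` applies. -/
theorem irreducible_quinticAt {P : EPoint a b ℚ} (h : P ∉ (ratDualIsogeny ha hd).range) :
    Irreducible (quinticAt a b P) := by
  classical
  have hP : P ≠ 0 := by rintro rfl; exact h (zero_mem _)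
  by_contra hirr
  apply h
  obtain ⟨δ, hδ⟩ := exists_sqrt (K := AlgebraicClosure ℚ) a b
  obtain ⟨T, hT⟩ := exists_kernel_point ha hd hδ
  have H := isDihedralIsogeny ha hd hδ hT
  have hdeg := natDegree_quinticAt hP
  have hq0 := quinticAt_ne_zero hP
  have hinj := fibreRoot_injOn (K := AlgebraicClosure ℚ) ha hd (P :=
    WeierstrassCurve.Affine.Point.baseChange (W' := E a b) ℚ (AlgebraicClosure ℚ) P) (by
      rw [← map_add, ne_eq, _root_.map_eq_zero_iff _ (baseChange_injective _ _)]
      exact add_self_ne_zero ha hd h)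
  have hroot := aeval_quinticAt_eq_zero_iff (K := AlgebraicClosure ℚ) ha hd hP
  rw [irreducible_iff] at hirr
  push Not at hirr
  obtain ⟨p, q, hpq, hp, hq⟩ := hirr fun hu => by
    rw [natDegree_eq_zero_of_isUnit hu] at hdeg
    norm_num at hdeg
  have hp0 : p ≠ 0 := by rintro rfl; rw [zero_mul] at hpq; exact hq0 hpq
  have hq0' : q ≠ 0 := by rintro rfl; rw [mul_zero] at hpq; exact hq0 hpq
  rw [hpq, natDegree_mul hp0 hq0'] at hdeg
  have hp1 : p.natDegree ≠ 0 := fun h' => hp (isUnit_iff_degree_eq_zero.mpr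
    (by rw [degree_eq_natDegree hp0, h']; rfl))
  have hq1 : q.natDegree ≠ 0 := fun h' => hq (isUnit_iff_degree_eq_zero.mpr
    (by rw [degree_eq_natDegree hq0', h']; rfl))
  have hfin := dualIsogeny_fibre_finite ha hd hδ
    (WeierstrassCurve.Affine.Point.baseChange (W' := E a b) ℚ (AlgebraicClosure ℚ) P)
  let s : Finset (EstarPoint a b (AlgebraicClosure ℚ)) :=
    hfin.toFinset.filter fun R => aeval (fibreRoot R) p = 0
  have hs (R) : R ∈ s ↔ dualIsogenyHom (AlgebraicClosure ℚ) ha hd R =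
      WeierstrassCurve.Affine.Point.baseChange (W' := E a b) ℚ (AlgebraicClosure ℚ) P ∧
        aeval (fibreRoot R) p = 0 := by
    simp only [s, Finset.mem_filter, Set.Finite.mem_toFinset]
    rfl
  rw [mem_range_ratDualIsogeny ha hd (AlgebraicClosure ℚ)]
  refine H.mem_of_finset (fun σ => smul_baseChange σ P) s (fun R hR => ((hs R).mp hR).1)
    (fun σ R hR => ?_) ?_
  · rw [hs] at hR ⊢
    refine ⟨by rw [H.smul, hR.1, smul_baseChange], ?_⟩
    have := aeval_algHom_apply σ (fibreRoot R) p
    rw [fibreRoot_smul, this, hR.2, map_zero]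
  · have hne : s.Nonempty := by
      obtain ⟨z, hz⟩ := IsAlgClosed.exists_aeval_eq_zero (AlgebraicClosure ℚ) p (by
        rw [degree_eq_natDegree hp0]; exact_mod_cast hp1)
      obtain ⟨R, hR, rfl⟩ := (hroot z).mp (by rw [hpq, map_mul, hz, zero_mul])
      exact ⟨R, (hs R).mpr ⟨hR, hz⟩⟩
    -- Injectivity of the roots on the fibre is what bounds the number of points by the number of
    -- roots of p.
    have hle : s.card ≤ p.natDegree := by
      rw [← Finset.card_image_of_injOn (f := fibreRoot) (s := s)
        (hinj.mono fun R hR => ((hs R).mp hR).1)]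
      refine (Finset.card_le_card (t := (p.aroots (AlgebraicClosure ℚ)).toFinset)
        fun z hz => ?_).trans
        ((Multiset.toFinset_card_le _).trans ((card_roots' _).trans (natDegree_map_le)))
      obtain ⟨R, hR, rfl⟩ := Finset.mem_image.mp hz
      rw [Multiset.mem_toFinset, mem_aroots]
      exact ⟨hp0, ((hs R).mp hR).2⟩
    have h1 := hne.card_pos
    have h4 : s.card < 5 := by omega
    exact (Nat.coprime_of_lt_prime (p := 5) h1.ne' h4 (by norm_num)).symm

variable [IsGalois ℚ K]

/-- The automorphisms fixing the splitting field are those fixing the fibre of `φ*`. -/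
theorem forall_root_iff {P : EPoint a b ℚ} (h : P ∉ (ratDualIsogeny ha hd).range)
    (σ : K ≃ₐ[ℚ] K) : (∀ z ∈ (quinticAt a b P).rootSet K, σ z = z) ↔
      ∀ R, dualIsogenyHom K ha hd R =
        WeierstrassCurve.Affine.Point.baseChange (W' := E a b) ℚ K P → σ • R = R := by
  have hP : P ≠ 0 := by rintro rfl; exact h (zero_mem _)
  have hinj := fibreRoot_injOn (K := K) ha hd (P :=
    WeierstrassCurve.Affine.Point.baseChange (W' := E a b) ℚ K P) (by
      rw [← map_add, ne_eq, _root_.map_eq_zero_iff _ (baseChange_injective _ K)]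
      exact add_self_ne_zero ha hd h)
  obtain ⟨δ, hδ⟩ := exists_sqrt (K := K) a b
  obtain ⟨T, hT⟩ := exists_kernel_point ha hd hδ
  have H := isDihedralIsogeny ha hd hδ hT
  simp only [mem_rootSet, and_iff_right (quinticAt_ne_zero hP),
    aeval_quinticAt_eq_zero_iff (K := K) ha hd hP]
  constructor
  · intro hσ R hR
    refine hinj ?_ hR ?_
    · rw [Set.mem_ofPred_eq, H.smul, hR, smul_baseChange]
    · rw [fibreRoot_smul, hσ _ ⟨R, hR, rfl⟩]
  · rintro hσ _ ⟨R, hR, rfl⟩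
    rw [← fibreRoot_smul, hσ R hR]

theorem mem_fixingSubgroup_adjoin_iff {F L : Type*} [Field F] [Field L] [Algebra F L] (s : Set L)
    (σ : L ≃ₐ[F] L) :
    σ ∈ (IntermediateField.adjoin F s).fixingSubgroup ↔ ∀ z ∈ s, σ z = z := by
  rw [← Subgroup.zpowers_le, ← IntermediateField.le_iff_le, IntermediateField.adjoin_le_iff]
  simp only [Set.subset_def, SetLike.mem_coe, IntermediateField.mem_fixedField_iff]
  refine ⟨fun h z hz => h z hz σ (Subgroup.mem_zpowers σ), fun h z hz τ hτ => ?_⟩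
  have : Subgroup.zpowers σ ≤ MulAction.stabilizer (L ≃ₐ[F] L) z := by
    rw [Subgroup.zpowers_le]
    exact h z hz
  exact this hτ

/-- The Galois correspondence turns an inclusion of splitting fields into an inclusion of pointwise
stabilizers of fibres, which means that one class is a multiple of the other. Equality is obtained
from the two inclusions. -/
theorem adjoin_rootSet_eq_iff {P Q : EPoint a b ℚ} (hP : P ∉ (ratDualIsogeny ha hd).range)
    (hQ : Q ∉ (ratDualIsogeny ha hd).range) :
    IntermediateField.adjoin ℚ ((quinticAt a b P).rootSet K) =
      IntermediateField.adjoin ℚ ((quinticAt a b Q).rootSet K) ↔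
    AddSubgroup.zmultiples (P : EPoint a b ℚ ⧸ (ratDualIsogeny ha hd).range) =
      AddSubgroup.zmultiples (Q : EPoint a b ℚ ⧸ (ratDualIsogeny ha hd).range) := by
  obtain ⟨δ, hδ⟩ := exists_sqrt (K := K) a b
  obtain ⟨T, hT⟩ := exists_kernel_point ha hd hδ
  have H := isDihedralIsogeny ha hd hδ hT
  have hT0 : T ≠ 0 := HasCoords.ne_zero hT
  have key {P Q : EPoint a b ℚ} (hP : P ∉ (ratDualIsogeny ha hd).range)
      (hQ : Q ∉ (ratDualIsogeny ha hd).range) :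
      IntermediateField.adjoin ℚ ((quinticAt a b Q).rootSet K) ≤
        IntermediateField.adjoin ℚ ((quinticAt a b P).rootSet K) ↔
      AddSubgroup.zmultiples (Q : EPoint a b ℚ ⧸ (ratDualIsogeny ha hd).range) ≤
        AddSubgroup.zmultiples (P : EPoint a b ℚ ⧸ (ratDualIsogeny ha hd).range) := by
    have e1 : IntermediateField.adjoin ℚ ((quinticAt a b Q).rootSet K) ≤
        IntermediateField.adjoin ℚ ((quinticAt a b P).rootSet K) ↔
        ∀ σ : K ≃ₐ[ℚ] K, (∀ z ∈ (quinticAt a b P).rootSet K, σ z = z) →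
          ∀ z ∈ (quinticAt a b Q).rootSet K, σ z = z := by
      rw [IntermediateField.adjoin_le_iff, ← InfiniteGalois.fixedField_fixingSubgroup
        (IntermediateField.adjoin ℚ ((quinticAt a b P).rootSet K))]
      simp only [Set.subset_def, SetLike.mem_coe, IntermediateField.mem_fixedField_iff,
        mem_fixingSubgroup_adjoin_iff]
      exact ⟨fun h σ hσ z hz => h z hz σ hσ, fun h z hz σ hσ => h σ hσ z hz⟩
    rw [e1]
    simp only [forall_root_iff ha hd hP, forall_root_iff ha hd hQ]
    rw [AddSubgroup.zmultiples_le]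
    have e2 (k : ℤ) : k • (P : EPoint a b ℚ ⧸ (ratDualIsogeny ha hd).range) = Q ↔
        WeierstrassCurve.Affine.Point.baseChange (W' := E a b) ℚ K Q -
          k • WeierstrassCurve.Affine.Point.baseChange (W' := E a b) ℚ K P ∈
          fixedImage (K ≃ₐ[ℚ] K) (dualIsogenyHom K ha hd) := by
      rw [← map_zsmul, ← map_sub, ← mem_range_ratDualIsogeny, ← QuotientAddGroup.mk_zsmul,
        QuotientAddGroup.eq, neg_add_eq_sub]
    simp only [AddSubgroup.mem_zmultiples_iff, e2]
    constructor
    · exact H.exists_zsmul_sub_mem hT0 (fun σ => smul_baseChange σ P)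
        (fun σ => smul_baseChange σ Q) ((mem_range_ratDualIsogeny ha hd K).not.mp hP)
    · rintro ⟨k, hk⟩ σ hσ
      exact H.smul_fibre_of_sub_mem hk hσ
  rw [le_antisymm_iff, le_antisymm_iff, key hP hQ, key hQ hP]

end Roots

/-! ### Values of the Kummer function at places of good reduction. -/

section Valuation

/-- The value of a function with divisor `5 (S) - 5 (O)` on an elliptic curve has valuation
divisible by `5` at a place of good reduction. -/
theorem exists_valuation_eq_pow {L Γ₀ : Type*} [Field L] [LinearOrderedCommGroupWithZero Γ₀]
    (ν : Valuation L Γ₀) {κ α β γ ε c₂ c₁ c₀ v₀ v w : L} (h2 : ν 2 = 1) (hκ : ν κ = 1)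
    (hα : ν α ≤ 1) (hβ : ν β ≤ 1) (hγ : ν γ ≤ 1) (hε : ν ε ≤ 1) (h₂ : ν c₂ ≤ 1) (h₁ : ν c₁ ≤ 1)
    (h₀ : ν c₀ ≤ 1) (hv₀ : ν v₀ ≤ 1) (hev : ν (α * v₀ ^ 2 + γ * v₀ + ε) = 1)
    (hw : w ^ 2 = 4 * v ^ 3 + c₂ * v ^ 2 + c₁ * v + c₀)
    (hid : (α * v ^ 2 + γ * v + ε) ^ 2 - w ^ 2 * κ ^ 2 * (v + β) ^ 2 =
      -4 * κ ^ 2 * (v - v₀) ^ 5) :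
    ∃ c, ν (κ * (w * (v + β)) + (α * v ^ 2 + γ * v + ε)) = ν c ^ 5 := by
  have h4 : ν 4 = 1 := by rw [show (4 : L) = 2 * 2 by norm_num, map_mul, h2, mul_one]
  have hm1 : ν (-1) = 1 := by rw [Valuation.map_neg, map_one]
  rcases lt_or_ge 1 (ν v) with hv | hv
  · have hv0 : v ≠ 0 := by rintro rfl; simp at hv
    have hνv0 : ν v ≠ 0 := (Valuation.ne_zero_iff ν).mpr hv0
    have hlow : ν (c₂ * v ^ 2 + c₁ * v + c₀) ≤ ν v ^ 2 := by
      refine ν.map_add_le (ν.map_add_le ?_ ?_) ?_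
      · rw [map_mul, map_pow]
        exact mul_le_of_le_one_left' h₂
      · rw [map_mul, sq]
        exact mul_le_mul' (h₁.trans hv.le) le_rfl
      · exact h₀.trans (one_le_pow₀ hv.le)
    have hev' : ν (α * v ^ 2 + γ * v + ε) ≤ ν v ^ 2 := by
      refine ν.map_add_le (ν.map_add_le ?_ ?_) ?_
      · rw [map_mul, map_pow]
        exact mul_le_of_le_one_left' hα
      · rw [map_mul, sq]
        exact mul_le_mul' (hγ.trans hv.le) le_rfl
      · exact hε.trans (one_le_pow₀ hv.le)
    have hw2 : ν w ^ 2 = ν v ^ 3 := by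
      rw [← map_pow, hw, add_assoc, add_assoc, ← add_assoc (c₂ * v ^ 2)]
      rw [Valuation.map_add_eq_of_lt_left]
      · rw [map_mul, h4, one_mul, map_pow]
      · rw [map_mul, h4, one_mul, map_pow]
        exact hlow.trans_lt (pow_lt_pow_right₀ hv (by norm_num))
    have hvβ : ν (v + β) = ν v := Valuation.map_add_eq_of_lt_left _ (hβ.trans_lt hv)
    have hlt : ν v ^ 2 < ν w * ν v := by
      refine lt_of_pow_lt_pow_left₀ 2 zero_le ?_
      rw [mul_pow, hw2, ← pow_mul, ← pow_add]
      exact pow_lt_pow_right₀ hv (by norm_num)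
    -- When v is not integral, ν(w)² = ν(v)³ and the term κwv dominates. Its valuation is that of
    -- (w/v)⁵, reflecting the pole of order 5 at O.
    refine ⟨w / v, ?_⟩
    rw [Valuation.map_add_eq_of_lt_left, map_mul, hκ, one_mul, map_mul, hvβ, map_div₀, div_pow]
    · rw [eq_div_iff (pow_ne_zero 5 hνv0)]
      calc ν w * ν v * ν v ^ 5 = ν w * (ν v ^ 3) ^ 2 := by
            rw [mul_assoc, ← pow_succ', ← pow_mul]
        _ = ν w ^ 5 := by rw [← hw2, ← pow_mul, ← pow_succ']
    · rw [map_mul, hκ, one_mul, map_mul, hvβ]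
      exact hev'.trans_lt hlt
  · have hO {x : L} : x ∈ ν.integer ↔ ν x ≤ 1 := Iff.rfl
    rw [← hO] at hα hβ hγ hε h₂ h₁ h₀ hv₀ hv
    have hκO : κ ∈ ν.integer := hκ.le
    have hwO : w ∈ ν.integer := by
      have : w ^ 2 ∈ ν.integer := by
        rw [hw]
        exact add_mem (add_mem (add_mem (mul_mem h4.le (pow_mem hv 3)) (mul_mem h₂ (pow_mem hv 2)))
          (mul_mem h₁ hv)) h₀
      rw [hO, map_pow] at this
      exact (pow_le_one_iff two_ne_zero).mp this
    have hevO : α * v ^ 2 + γ * v + ε ∈ ν.integer :=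
      add_mem (add_mem (mul_mem hα (pow_mem hv 2)) (mul_mem hγ hv)) hε
    have hoddO : κ * (w * (v + β)) ∈ ν.integer := mul_mem hκO (mul_mem hwO (add_mem hv hβ))
    have hg := add_mem hoddO hevO
    have hg' := sub_mem hevO hoddO
    have hprod : ν (κ * (w * (v + β)) + (α * v ^ 2 + γ * v + ε)) *
        ν (α * v ^ 2 + γ * v + ε - κ * (w * (v + β))) = ν (v - v₀) ^ 5 := by
      rw [← map_mul, show (κ * (w * (v + β)) + (α * v ^ 2 + γ * v + ε)) *
        (α * v ^ 2 + γ * v + ε - κ * (w * (v + β))) = -1 * 4 * κ ^ 2 * (v - v₀) ^ 5 by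
          linear_combination hid]
      simp only [map_mul, map_pow, hm1, h4, hκ, one_mul, one_pow]
    -- The product of the function and its conjugate is a unit times (v - v₀)⁵. If v ≡ v₀, the
    -- conjugates cannot both be non-units, because their sum is twice the even part, a unit.
    -- Otherwise the product itself is a unit.
    have hone : ν (κ * (w * (v + β)) + (α * v ^ 2 + γ * v + ε)) = 1 ∨
        ν (α * v ^ 2 + γ * v + ε - κ * (w * (v + β))) = 1 := by
      rcases (hO.mp (sub_mem hv hv₀)).lt_or_eq with hlt | heq
      · have hev1 : ν (α * v ^ 2 + γ * v + ε) = 1 := by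
          rw [← hev, show α * v ^ 2 + γ * v + ε =
            (α * v₀ ^ 2 + γ * v₀ + ε) + (v - v₀) * (α * (v + v₀) + γ) by ring]
          refine Valuation.map_add_eq_of_lt_left _ ?_
          rw [hev, map_mul]
          exact mul_lt_one_of_lt_of_le hlt (hO.mp (add_mem (mul_mem hα (add_mem hv hv₀)) hγ))
        by_contra! hc
        have h3 := ν.map_add_lt (lt_of_le_of_ne (hO.mp hg) hc.1) (lt_of_le_of_ne (hO.mp hg') hc.2)
        rw [show κ * (w * (v + β)) + (α * v ^ 2 + γ * v + ε) +
          (α * v ^ 2 + γ * v + ε - κ * (w * (v + β))) = 2 * (α * v ^ 2 + γ * v + ε) by ring,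
          map_mul, h2, hev1, one_mul] at h3
        exact lt_irrefl _ h3
      · left
        rw [heq, one_pow] at hprod
        exact eq_one_of_one_le_mul_left (hO.mp hg) (hO.mp hg') hprod.ge
    rcases hone with h | h
    · exact ⟨1, by rw [h, map_one, one_pow]⟩
    · exact ⟨v - v₀, by rw [← hprod, h, mul_one]⟩

theorem kummer_coeff_mem {L : Type*} [Field L] (O : Subring L) {a e : L} (h2 : 2⁻¹ ∈ O)
    (h5 : 5⁻¹ ∈ O) (ha : a ∈ O) (he : e ∈ O) :
    ((75 * e + 125) * a - 25 * e - 25) * 2⁻¹ ∈ O ∧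
    ((-35 * e - 55) * a ^ 3 + (-285 * e - 430) * a ^ 2 + (180 * e + 315) * a - 5 * e - 15)
        * 2⁻¹ ∈ O ∧
    ((-10 * e - 16) * a ^ 5 + (-350 * e - 560) * a ^ 4 + (-85 * e - 95) * a ^ 3
        + (-360 * e - 635) * a ^ 2 + (5 * e + 85) * a - 2) * 2⁻¹ ∈ O ∧
    kummerShift e a ∈ O ∧ kummerZero e a ∈ O ∧
    (a - 1) ^ 2 - 4 * a ∈ O ∧
    2 * a * (a - 1) - 20 * a * (a ^ 2 + 2 * a - 1) ∈ O ∧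
    a ^ 2 - 4 * a * (a ^ 4 + 10 * a ^ 3 - 5 * a ^ 2 + 15 * a - 1) ∈ O := by
  unfold kummerShift kummerZero
  rw [div_eq_mul_inv]
  have hnum (n : ℕ) [n.AtLeastTwo] : (OfNat.ofNat n : L) ∈ O := ofNat_mem O n
  refine ⟨?_, ?_, ?_, ?_, ?_, ?_, ?_, ?_⟩
  all_goals
    repeat'
      with_reducible first
        | assumption
        | exact hnum _
        | exact one_mem _
        | refine add_mem ?_ ?_
        | refine sub_mem ?_ ?_
        | refine mul_mem ?_ ?_
        | refine neg_mem ?_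
        | refine pow_mem ?_ _

/-- The hypotheses describe a good place: a and z are integral there, and 2, 5, the leading factor
and the even part at S are units. -/
theorem valuation_kummerFun {L Γ₀ : Type*} [Field L] [CharZero L]
    [LinearOrderedCommGroupWithZero Γ₀] (ν : Valuation L Γ₀) {z a v w : L}
    (hz : z ^ 4 + z ^ 3 + z ^ 2 + z + 1 = 0) (h2 : ν 2⁻¹ ≤ 1) (h5 : ν 5⁻¹ ≤ 1) (ha : ν a ≤ 1)
    (hz1 : ν z ≤ 1)
    (hκ : ν ((z ^ 2 - z ^ 3) * ((5 * (z ^ 2 + z ^ 3) + 10) / 2))⁻¹ ≤ 1)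
    (hκ0 : (z ^ 2 - z ^ 3) * ((5 * (z ^ 2 + z ^ 3) + 10) / 2) ≠ 0)
    (hev : ν (kummerEven (z ^ 2 + z ^ 3) a (kummerZero (z ^ 2 + z ^ 3) a))⁻¹ ≤ 1)
    (ha0 : a ^ 2 - 11 * a - 1 ≠ 0) (hw : w ^ 2 = baseCubic a v) :
    ∃ c, ν (kummerFun z a v w) = ν c ^ 5 := by
  have he : (z ^ 2 + z ^ 3) ^ 2 = 1 - (z ^ 2 + z ^ 3) := by linear_combination (z ^ 2 + z - 1) * hz
  have hsq : (z ^ 2 - z ^ 3) ^ 2 = -(z ^ 2 + z ^ 3) - 3 := by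
    linear_combination (z ^ 2 - 3 * z + 3) * hz
  have h2O : (2 : L)⁻¹ ∈ ν.integer := h2
  have h5O : (5 : L)⁻¹ ∈ ν.integer := h5
  have haO : a ∈ ν.integer := ha
  have hzO : z ∈ ν.integer := hz1
  have heO : z ^ 2 + z ^ 3 ∈ ν.integer := add_mem (pow_mem hzO 2) (pow_mem hzO 3)
  have hone {x : L} (hx : x ∈ ν.integer) (hx0 : x ≠ 0) (hx1 : ν x⁻¹ ≤ 1) : ν x = 1 := by
    refine le_antisymm hx ?_
    rw [map_inv₀] at hx1
    exact (inv_le_one₀ (zero_lt_iff.mpr ((Valuation.ne_zero_iff ν).mpr hx0))).mp hx1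
  have hev0 := kummerEven_zero_ne he ha0
  have hid := kummerEven_sq (v := v) (a := a) he
  have hd (x y : L) : x / y = x * y⁻¹ := div_eq_mul_inv x y
  have hκO : (z ^ 2 - z ^ 3) * ((5 * (z ^ 2 + z ^ 3) + 10) / 2) ∈ ν.integer := by
    simp only [hd]
    exact mul_mem (sub_mem (pow_mem hzO 2) (pow_mem hzO 3))
      (mul_mem (add_mem (mul_mem (ofNat_mem _ 5) heO) (ofNat_mem _ 10)) h2O)
  have hκ2 : ((z ^ 2 - z ^ 3) * ((5 * (z ^ 2 + z ^ 3) + 10) / 2)) ^ 2 =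
      (-(z ^ 2 + z ^ 3) - 3) * ((5 * (z ^ 2 + z ^ 3) + 10) / 2) ^ 2 := by rw [mul_pow, hsq]
  have h22 : ν 2 = 1 := hone (ofNat_mem _ 2) two_ne_zero h2
  have hκ1 := hone hκO hκ0 hκ
  rw [← hκ2, ← hw, mul_assoc (-4 : L), ← mul_assoc (-4 : L)] at hid
  unfold kummerFun
  generalize (z ^ 2 - z ^ 3) * ((5 * (z ^ 2 + z ^ 3) + 10) / 2) = κ at *
  generalize z ^ 2 + z ^ 3 = e at *
  rw [baseCubic_eq] at hw
  have hE (v : L) : kummerEven e a v = ((75 * e + 125) * a - 25 * e - 25) * 2⁻¹ * v ^ 2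
      + ((-35 * e - 55) * a ^ 3 + (-285 * e - 430) * a ^ 2 + (180 * e + 315) * a - 5 * e - 15)
        * 2⁻¹ * v
      + ((-10 * e - 16) * a ^ 5 + (-350 * e - 560) * a ^ 4 + (-85 * e - 95) * a ^ 3
        + (-360 * e - 635) * a ^ 2 + (5 * e + 85) * a - 2) * 2⁻¹ := by
    unfold kummerEven
    ring
  obtain ⟨hα, hγ, hε, hβ, hv₀, h₂, h₁, h₀⟩ := kummer_coeff_mem ν.integer h2O h5O haO heO
  have hev1 := hone (by
    rw [hE]
    exact add_mem (add_mem (mul_mem hα (pow_mem hv₀ 2)) (mul_mem hγ hv₀)) hε) hev0 hev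
  rw [hE] at hid hev1 ⊢
  exact exists_valuation_eq_pow ν h22 hκ1 hα hβ hγ hε h₂ h₁ h₀ hv₀ hev1 hw hid

theorem kummer_leading_ne_zero {L : Type*} [Field L] [CharZero L] {z : L}
    (hz : z ^ 4 + z ^ 3 + z ^ 2 + z + 1 = 0) :
    (z ^ 2 - z ^ 3) * ((5 * (z ^ 2 + z ^ 3) + 10) / 2) ≠ 0 := by
  intro h
  have he : (z ^ 2 + z ^ 3) ^ 2 = 1 - (z ^ 2 + z ^ 3) := by
    linear_combination (z ^ 2 + z - 1) * hz
  have hsq : (z ^ 2 - z ^ 3) ^ 2 = -(z ^ 2 + z ^ 3) - 3 := by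
    linear_combination (z ^ 2 - 3 * z + 3) * hz
  rcases mul_eq_zero.mp h with h | h
  · rw [h] at hsq
    have : (5 : L) = 0 := by linear_combination he - (z ^ 2 + z ^ 3 - 2) * hsq
    norm_num at this
  · have : (5 : L) = 0 := by linear_combination 5 * he - 2 * (z ^ 2 + z ^ 3 - 1) * h
    norm_num at this

open IsDedekindDomain in
/-- The values of the function with divisor `5 (S) - 5 (O)` lie in a Selmer group of a number
field. -/
theorem exists_kummerFun_mem_selmerSubgroup (R : Type*) {L : Type*} [CommRing R]
    [IsDedekindDomain R] [Field L] [CharZero L] [Algebra R L] [IsFractionRing R L] {z a : L}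
    (hz : z ^ 4 + z ^ 3 + z ^ 2 + z + 1 = 0) (ha : a ^ 2 - 11 * a - 1 ≠ 0) :
    ∃ S : Set (HeightOneSpectrum R), S.Finite ∧ ∀ (v w : L) (g : Lˣ), w ^ 2 = baseCubic a v →
      kummerFun z a v w = g → g ∈ selmerSubgroup R L S 5 := by
  have hκ0 := kummer_leading_ne_zero hz
  -- The bad places are those where one of these six elements has a pole; for an integral element,
  -- integrality of its inverse makes it a unit.
  let f : Fin 6 → L := ![2⁻¹, 5⁻¹, a, z,
    ((z ^ 2 - z ^ 3) * ((5 * (z ^ 2 + z ^ 3) + 10) / 2))⁻¹,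
    (kummerEven (z ^ 2 + z ^ 3) a (kummerZero (z ^ 2 + z ^ 3) a))⁻¹]
  refine ⟨⋃ i, HeightOneSpectrum.Support R (f i),
    Set.finite_iUnion fun i => HeightOneSpectrum.Support.finite R (f i), fun v w g hw hg => ?_⟩
  refine mem_selmerSubgroup_of_valuation R L (by norm_num) fun p hp => ?_
  have hp' (i : Fin 6) : p.valuation L (f i) ≤ 1 :=
    not_lt.mp fun h => hp (Set.mem_iUnion.mpr ⟨i, h⟩)
  rw [← hg]
  exact valuation_kummerFun (p.valuation L) hz (hp' 0) (hp' 1) (hp' 2) (hp' 3) (hp' 4) hκ0 (hp' 5)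
    ha hw

/-- By the norm identity a zero forces (v - v(S))⁵ = 0. Thus at most two rational points have to be
set aside because the function vanishes. -/
theorem eq_kummerZero_of_kummerFun_eq_zero {L : Type*} [Field L] [CharZero L] {z a v w : L}
    (hz : z ^ 4 + z ^ 3 + z ^ 2 + z + 1 = 0) (hw : w ^ 2 = baseCubic a v)
    (h : kummerFun z a v w = 0) : v = kummerZero (z ^ 2 + z ^ 3) a := by
  have hκ0 := kummer_leading_ne_zero hz
  have he : (z ^ 2 + z ^ 3) ^ 2 = 1 - (z ^ 2 + z ^ 3) := by
    linear_combination (z ^ 2 + z - 1) * hz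
  have hsq : (z ^ 2 - z ^ 3) ^ 2 = -(z ^ 2 + z ^ 3) - 3 := by
    linear_combination (z ^ 2 - 3 * z + 3) * hz
  have hid := kummerEven_sq (v := v) (a := a) he
  unfold kummerFun at h
  have key : ((z ^ 2 - z ^ 3) * ((5 * (z ^ 2 + z ^ 3) + 10) / 2)) ^ 2 *
      (v - kummerZero (z ^ 2 + z ^ 3) a) ^ 5 = 0 := by
    rw [mul_pow, hsq]
    rw [← hw, ← hsq] at hid
    rw [eq_neg_of_add_eq_zero_right h] at hid
    rw [← hsq]
    linear_combination hid / 4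
  have := (mul_eq_zero.mp key).resolve_left (pow_ne_zero 2 hκ0)
  exact sub_eq_zero.mp (pow_eq_zero_iff (by norm_num) |>.mp this)

end Valuation
-- The resolvent as a fifth root of the Kummer function on `E*_{a,b}`.
theorem map_resolvent {F K : Type*} [Field F] [Field K] (f : F →+* K) (z a x u : F) :
    f (resolvent z a x u) = resolvent (f z) (f a) (f x) (f u) := by
  simp [resolvent]

/-- An automorphism acts on fifth roots of unity by an exponent i, and i⁴ ≡ 1 modulo 5 when 5 does
not divide i. -/
theorem pow_four_apply {K : Type*} [Field K] [Algebra ℚ K] {z : K} (hz : IsPrimitiveRoot z 5)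
    (σ : K ≃ₐ[ℚ] K) : (σ ^ 4) z = z := by
  have h1 : σ z ^ 5 = 1 := by rw [← map_pow, hz.pow_eq_one, map_one]
  obtain ⟨i, hi, e⟩ := hz.eq_pow_of_pow_eq_one h1
  have hpow (k : ℕ) : (σ ^ k) z = z ^ (i ^ k) := by
    induction k with
    | zero => simp
    | succ k ih => rw [pow_succ, AlgEquiv.mul_apply, ← e, map_pow, ih, ← pow_mul, pow_succ]
  rw [hpow]
  have hz1 : z ^ (i ^ 4 % 5) = z ^ (i ^ 4) := by
    conv_rhs => rw [← Nat.mod_add_div (i ^ 4) 5, pow_add, pow_mul, hz.pow_eq_one, one_pow, mul_one]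
  rw [← hz1]
  rcases Nat.eq_zero_or_pos i with rfl | hi0
  · rw [pow_zero, eq_comm, map_eq_one_iff σ σ.injective] at e
    rw [e, one_pow]
  · interval_cases i <;> exact pow_one z

theorem pow_four_apply_sqrt {K : Type*} [Field K] [Algebra ℚ K] {a b : ℚ} {δ : K}
    (hδ : δ ^ 2 = algebraMap ℚ K (d a b)) (σ : K ≃ₐ[ℚ] K) : (σ ^ 4) δ = δ := by
  have : (σ ^ 4) δ = σ (σ (σ (σ δ))) := rfl
  rw [this]
  rcases apply_sqrt hδ σ with h | h
  · simp only [h]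
  · simp only [h, map_neg, neg_neg]

section KummerRoot

variable {K : Type*} [Field K] [Algebra ℚ K] {a b : ℚ}

theorem BaseCoords.map {F : Type*} [Field F] [Algebra ℚ F] [DecidableEq F] [DecidableEq K]
    {δ v w : F} {P : EPoint a b F} (h : BaseCoords a b δ P v w) (f : F →ₐ[ℚ] K) :
    BaseCoords a b (f δ) (WeierstrassCurve.Affine.Point.map (W' := E a b) f P) (f v) (f w) := by
  obtain ⟨h, rfl⟩ := h
  have e1 : f ((2 * δ) ^ 2 * v + 8 * algebraMap ℚ F (d a b) * algebraMap ℚ F a) =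
      (2 * f δ) ^ 2 * f v + 8 * algebraMap ℚ K (d a b) * algebraMap ℚ K a := by
    simp [_root_.map_ofNat f]
  have e2 : f ((2 * δ) ^ 3 * w / 2) = (2 * f δ) ^ 3 * f w / 2 := by
    simp [_root_.map_ofNat f]
  unfold BaseCoords HasCoords
  rw [← e1, ← e2]
  exact ⟨_, WeierstrassCurve.Affine.Point.map_some f h⟩

/-- A function on `E*_{a,b}` multiplied by `z` under translation by the generator of the kernel
of `φ*`. -/
noncomputable def kummerRoot (δ z : K) : EstarPoint a b K → K
  | .zero => 0
  | .some x y _ => resolvent z (algebraMap ℚ K a)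
      (twistX (algebraMap ℚ K a) (algebraMap ℚ K (d a b)) x)
      ((2 * y / (10 * δ) ^ 3 + (algebraMap ℚ K a - 1) *
        twistX (algebraMap ℚ K a) (algebraMap ℚ K (d a b)) x + algebraMap ℚ K a) / 2)

variable (ha : a ≠ 0) (hd : d a b ≠ 0) {δ : K} (hδ : δ ^ 2 = algebraMap ℚ K (d a b))

include ha hd hδ in
theorem StarCoords.kummerRoot {R : EstarPoint a b K} {X Y : K} (h : StarCoords a b δ R X Y)
    (z : K) : kummerRoot δ z R = resolvent z (algebraMap ℚ K a) X
      ((Y + (algebraMap ℚ K a - 1) * X + algebraMap ℚ K a) / 2) := by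
  have : CharZero K := algebraRat.charZero K
  have hδ0 := right_ne_zero_of_mul (Estar_isModel (K := K) ha hd rfl rfl hδ).t_ne
  obtain ⟨h, rfl⟩ := h
  change resolvent z (algebraMap ℚ K a) (twistX _ _ _) _ = _
  rw [twistX_eq hd hδ, show 2 * ((10 * δ) ^ 3 * Y / 2) / (10 * δ) ^ 3 = Y by field_simp]

variable [DecidableEq K]

include ha hd hδ

theorem kummerRoot_smul {z : K} {σ : K ≃ₐ[ℚ] K} (h1 : σ δ = δ) (h2 : σ z = z)
    {R : EstarPoint a b K} (hR : R ≠ 0) : kummerRoot δ z (σ • R) = σ (kummerRoot δ z R) := by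
  obtain ⟨X, Y, h⟩ := exists_starCoords ha hd hδ hR
  rw [(h.smul σ h1).kummerRoot ha hd hδ, h.kummerRoot ha hd hδ]
  have := map_resolvent (σ : K →+* K) z (algebraMap ℚ K a) X
    ((Y + (algebraMap ℚ K a - 1) * X + algebraMap ℚ K a) / 2)
  simp only [RingHom.coe_coe, h2, map_div₀, map_add, _root_.map_mul, map_sub, map_one,
    AlgEquiv.commutes, _root_.map_ofNat σ] at this
  exact this.symm

theorem kummerRoot_pow {z : K} (hz : z ^ 4 + z ^ 3 + z ^ 2 + z + 1 = 0) {R : EstarPoint a b K}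
    {v w : K} (h : BaseCoords a b δ (dualIsogeny ha hd K R) v w) :
    kummerRoot δ z R ^ 5 = kummerFun z (algebraMap ℚ K a) v w := by
  have : CharZero K := algebraRat.charZero K
  obtain ⟨T, hT⟩ := exists_kernel_point ha hd hδ
  obtain ⟨X, Y, hX, h0, h1⟩ := exists_coords_of_dualIsogeny_ne_zero ha hd hδ h.ne_zero
  obtain ⟨hu, hY, -⟩ := StarCoords.add_kernel_point ha hd hδ hT hX h0 rfl
  rw [hX.kummerRoot ha hd hδ, resolvent_pow hz h0 h1 hu, ← hY]
  obtain ⟨rfl, rfl⟩ := h.unique (hX.dualIsogeny ha hd hδ h0 h1)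
    (E_isModel (K := K) ha hd rfl rfl hδ).t_ne
  rfl

theorem kummerRoot_add_nsmul {z : K} (hz : z ^ 5 = 1) {T : EstarPoint a b K}
    (hT : StarCoords a b δ T 0 (-algebraMap ℚ K a)) {R : EstarPoint a b K}
    (hR : dualIsogeny ha hd K R ≠ 0) (n : ℕ) :
    kummerRoot δ z (R + n • T) = z ^ n * kummerRoot δ z R := by
  have : CharZero K := algebraRat.charZero K
  have hA : algebraMap ℚ K a ≠ 0 := (_root_.map_ne_zero _).mpr ha
  induction n with
  | zero => simp
  | succ n ih =>
    have hn := (dualIsogeny_add_nsmul ha hd hδ hT R n).symm ▸ hR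
    obtain ⟨X, Y, hX, h0, h1⟩ := exists_coords_of_dualIsogeny_ne_zero ha hd hδ hn
    obtain ⟨hu, hY, hadd⟩ := StarCoords.add_kernel_point ha hd hδ hT hX h0 rfl
    rw [succ_nsmul, ← add_assoc, hadd.kummerRoot ha hd hδ, pow_succ' z n, mul_assoc, ← ih,
      hX.kummerRoot ha hd hδ, ← resolvent_translate hz hA h0 h1 hu]
    congr 1
    ring

end KummerRoot

/-! ### Injectivity of the Kummer map modulo the image of φ*. -/

section Descent

variable {K : Type*} [Field K] [Algebra ℚ K] [DecidableEq K] [IsAlgClosed K] [IsGalois ℚ K]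
  {a b : ℚ} (ha : a ≠ 0) (hd : d a b ≠ 0) {δ : K} (hδ : δ ^ 2 = algebraMap ℚ K (d a b))

include hδ in
-- For R over P and a suitable S over Q, the fifth roots satisfy ρ(R) = t ρ(S). An automorphism
-- fixing √d, z and t multiplies both roots by powers of z that record its translations of R and S
-- by multiples of T. These powers agree, so R - S is fixed. The last two steps, to the stabilizer
-- of T and then to the full Galois group, are `smul_eq_of_pow` and `map_mem_of_smul_eq`.
theorem sub_mem_range_of_kummerFun_eq {z t : K} (hz : z ^ 4 + z ^ 3 + z ^ 2 + z + 1 = 0)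
    (ht0 : t ≠ 0) (ht : ∀ σ : K ≃ₐ[ℚ] K, σ δ = δ → σ z = z → σ t = t) {P Q : EPoint a b ℚ}
    {v w v' w' : K}
    (hP : BaseCoords a b δ (WeierstrassCurve.Affine.Point.baseChange (W' := E a b) ℚ K P) v w)
    (hQ : BaseCoords a b δ (WeierstrassCurve.Affine.Point.baseChange (W' := E a b) ℚ K Q) v' w')
    (hQ0 : kummerFun z (algebraMap ℚ K a) v' w' ≠ 0)
    (hPQ : kummerFun z (algebraMap ℚ K a) v w = t ^ 5 * kummerFun z (algebraMap ℚ K a) v' w') :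
    P - Q ∈ (ratDualIsogeny ha hd).range := by
  have : CharZero K := algebraRat.charZero K
  have hz5 : z ^ 5 = 1 := by linear_combination (z - 1) * hz
  have hprim : IsPrimitiveRoot z 5 := by
    have : Fact (Nat.Prime 5) := ⟨by norm_num⟩
    rw [← orderOf_eq_prime hz5 (by rintro rfl; norm_num at hz)]
    exact IsPrimitiveRoot.orderOf z
  obtain ⟨T, hT⟩ := exists_kernel_point ha hd hδ
  have H := isDihedralIsogeny ha hd hδ hT
  obtain ⟨R, hR⟩ := H.surj (WeierstrassCurve.Affine.Point.baseChange (W' := E a b) ℚ K P)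
  obtain ⟨S₀, hS₀⟩ := H.surj (WeierstrassCurve.Affine.Point.baseChange (W' := E a b) ℚ K Q)
  rw [← hR] at hP
  rw [← hS₀] at hQ
  have hρR := kummerRoot_pow ha hd hδ hz hP
  have hρS := kummerRoot_pow ha hd hδ hz hQ
  have hS0 : kummerRoot δ z S₀ ≠ 0 := by
    intro h
    rw [h, zero_pow (by norm_num)] at hρS
    exact hQ0 hρS.symm
  -- The ratio of the two fifth roots is a fifth root of unity zⁱ, absorbed by replacing S₀ with S₀
  -- + iT.
  obtain ⟨i, -, hi⟩ := hprim.eq_pow_of_pow_eq_one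
    (ξ := kummerRoot δ z R / (t * kummerRoot δ z S₀)) (by
      rw [div_pow, mul_pow, hρR, hρS, ← hPQ, div_self]
      rw [hPQ]
      exact mul_ne_zero (pow_ne_zero 5 ht0) hQ0)
  obtain ⟨S, hS⟩ : ∃ S, S = S₀ + i • T := ⟨_, rfl⟩
  have hRS : kummerRoot δ z R = t * kummerRoot δ z S := by
    rw [hS, kummerRoot_add_nsmul ha hd hδ hz5 hT hQ.ne_zero, hi]
    field_simp
  have hSQ : dualIsogenyHom K ha hd S =
      WeierstrassCurve.Affine.Point.baseChange (W' := E a b) ℚ K Q := by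
    rw [← hS₀, hS]
    exact dualIsogeny_add_nsmul ha hd hδ hT S₀ i
  have hS0' : kummerRoot δ z S ≠ 0 := by
    rw [hS, kummerRoot_add_nsmul ha hd hδ hz5 hT hQ.ne_zero]
    exact mul_ne_zero (pow_ne_zero _ (hprim.ne_zero (by norm_num))) hS0
  have hfix : ∀ σ : K ≃ₐ[ℚ] K, σ • dualIsogenyHom K ha hd (R - S) =
      dualIsogenyHom K ha hd (R - S) := fun σ => by
    rw [map_sub, hR, hSQ, smul_sub, smul_baseChange, smul_baseChange]
  have key : dualIsogenyHom K ha hd (R - S) ∈ fixedImage (K ≃ₐ[ℚ] K) (dualIsogenyHom K ha hd) := by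
    refine H.map_mem_of_smul_eq (fun σ hσ => H.smul_eq_of_pow hfix
      (H := MulAction.stabilizer (K ≃ₐ[ℚ] K) δ ⊓ MulAction.stabilizer (K ≃ₐ[ℚ] K) z)
      (fun τ hτ => ?_) ⟨pow_four_apply_sqrt hδ σ, pow_four_apply hprim σ⟩ hσ) hfix
    have h1 : τ δ = δ := hτ.1
    have h2 : τ z = z := hτ.2
    have hker {U : EstarPoint a b K} (hU : dualIsogenyHom K ha hd U ≠ 0)
        (hUfix : ∀ σ : K ≃ₐ[ℚ] K, σ • dualIsogenyHom K ha hd U = dualIsogenyHom K ha hd U) :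
        ∃ n : ℕ, τ • U = U + n • T ∧ τ (kummerRoot δ z U) = z ^ n * kummerRoot δ z U := by
      have hmem := (H.ker _).mp (H.map_smul_sub hUfix τ)
      have hfin : IsOfFinAddOrder T := isOfFinAddOrder_iff_nsmul_eq_zero.mpr
        ⟨5, by norm_num, H.five⟩
      obtain ⟨n, hn⟩ := hfin.mem_multiples_iff_mem_zmultiples.mpr hmem
      have hn' : τ • U = U + n • T := by
        change n • T = _ at hn
        rw [hn]
        abel
      refine ⟨n, hn', ?_⟩
      rw [← kummerRoot_smul ha hd hδ h1 h2 (by rintro rfl; exact hU (map_zero _)), hn',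
        kummerRoot_add_nsmul ha hd hδ hz5 hT hU]
    obtain ⟨m, hm, hm'⟩ := hker (U := R) hP.ne_zero fun σ => by rw [hR, smul_baseChange]
    obtain ⟨n, hn, hn'⟩ := hker (U := S) (by rw [hSQ, ← hS₀]; exact hQ.ne_zero)
      fun σ => by rw [hSQ, smul_baseChange]
    rw [hRS, map_mul, ht τ h1 h2, hn'] at hm'
    have e : z ^ n = z ^ m := by
      apply mul_right_cancel₀ (mul_ne_zero ht0 hS0')
      linear_combination hm'
    have e' : n • T = m • T := by
      have hmod : n ≡ m [MOD 5] := by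
        have := (hprim.isOfFinOrder (by norm_num)).pow_eq_pow_iff_modEq.mp e
        rwa [← hprim.eq_orderOf] at this
      have := (nsmul_eq_nsmul_iff_modEq (x := T) (n := n) (m := m)).mpr
        (hmod.of_dvd (addOrderOf_dvd_of_nsmul_eq_zero H.five))
      exact this
    rw [smul_sub, hm, hn, e']
    abel
  rwa [map_sub, hR, hSQ, ← map_sub, ← mem_range_ratDualIsogeny] at key

end Descent

/-! ### Finiteness of E(ℚ)/φ*(E*(ℚ)). -/

section Finiteness

variable {a b : ℚ} (ha : a ≠ 0) (hd : d a b ≠ 0)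

theorem map_kummerFun {F K : Type*} [Field F] [Field K] (f : F →+* K) (z a v w : F) :
    f (kummerFun z a v w) = kummerFun (f z) (f a) (f v) (f w) := by
  simp [kummerFun, kummerShift, kummerEven, _root_.map_ofNat f]

theorem finite_quotient_of_setoid {C β : Type*} [AddCommGroup C] (N : AddSubgroup C) [Finite β]
    (f : C → β) (hf : ∀ P Q, f P = f Q → P - Q ∈ N) : Finite (C ⧸ N) := by
  refine Finite.of_injective (fun q : C ⧸ N => f q.out) fun q q' h => ?_
  rw [← QuotientAddGroup.out_eq' q, ← QuotientAddGroup.out_eq' q', QuotientAddGroup.eq]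
  have := neg_mem (hf _ _ h)
  rwa [neg_sub, ← neg_add_eq_sub] at this

include ha hd in
theorem finite_baseCoords {L : Type*} [Field L] [Algebra ℚ L] [DecidableEq L] {δ : L}
    (hδ : δ ^ 2 = algebraMap ℚ L (d a b)) (v : L) :
    {P : EPoint a b ℚ | ∃ w, BaseCoords a b δ
      (WeierstrassCurve.Affine.Point.baseChange (W' := E a b) ℚ L P) v w}.Finite := by
  have : CharZero L := algebraRat.charZero L
  rcases Set.eq_empty_or_nonempty {P : EPoint a b ℚ | ∃ w, BaseCoords a b δ
      (WeierstrassCurve.Affine.Point.baseChange (W' := E a b) ℚ L P) v w} with h | ⟨P, w, hP⟩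
  · rw [h]
    exact Set.finite_empty
  · refine Set.Finite.subset (Set.toFinite {P, -P}) ?_
    rintro Q ⟨w', hQ⟩
    rcases HasCoords.eq_or_eq_neg hP hQ (E_isModel (K := L) ha hd rfl rfl hδ) with h | h
    · exact .inl (baseChange_injective (E a b) L h)
    · exact .inr (baseChange_injective (E a b) L (h.trans (map_neg _ P).symm))

/-- P is sent to the class of its Kummer value in the finite Selmer group modulo fifth powers.
Hypothesis `hL` expresses that L is generated by √d and z, so that t in L is fixed along with them.
-/
theorem finite_quotient_of_numberField {K L : Type*} [Field K] [Algebra ℚ K] [DecidableEq K]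
    [IsAlgClosed K] [IsGalois ℚ K] [Field L] [Algebra ℚ L] [NumberField L] [DecidableEq L]
    (f : L →ₐ[ℚ] K) {δ z : L} (hδ : δ ^ 2 = algebraMap ℚ L (d a b))
    (hz : z ^ 4 + z ^ 3 + z ^ 2 + z + 1 = 0)
    (hL : ∀ σ : K ≃ₐ[ℚ] K, σ (f δ) = f δ → σ (f z) = f z → ∀ t, σ (f t) = f t) :
    Finite (EPoint a b ℚ ⧸ (ratDualIsogeny ha hd).range) := by
  classical
  have hcoords (P : EPoint a b ℚ) : ∃ v w, P ≠ 0 → BaseCoords a b δ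
      (WeierstrassCurve.Affine.Point.baseChange (W' := E a b) ℚ L P) v w := by
    by_cases hP : P = 0
    · exact ⟨0, 0, fun h => absurd hP h⟩
    · obtain ⟨v, w, h⟩ := exists_baseCoords ha hd hδ (P :=
        WeierstrassCurve.Affine.Point.baseChange (W' := E a b) ℚ L P) (by
          rwa [ne_eq, _root_.map_eq_zero_iff _ (baseChange_injective (E a b) L)])
      exact ⟨v, w, fun _ => h⟩
  choose v w hvw using hcoords
  have M := E_isModel (K := L) ha hd rfl rfl hδ
  have hw (P : EPoint a b ℚ) (hP : P ≠ 0) : w P ^ 2 = baseCubic (algebraMap ℚ L a) (v P) := by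
    rw [baseCubic_eq]
    exact (hvw P hP).equation M
  have hA : algebraMap ℚ L a ^ 2 - 11 * algebraMap ℚ L a - 1 ≠ 0 := by
    have := (_root_.map_ne_zero (algebraMap ℚ L)).mpr (quadratic_ne_zero a)
    simpa [_root_.map_ofNat (algebraMap ℚ L)] using this
  let g (P : EPoint a b ℚ) : L := kummerFun z (algebraMap ℚ L a) (v P) (w P)
  have hfg (P : EPoint a b ℚ) : f (g P) = kummerFun (f z) (algebraMap ℚ K a) (f (v P))
      (f (w P)) := by
    rw [← f.commutes]
    exact map_kummerFun (f : L →+* K) _ _ _ _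
  obtain ⟨S, hS, hg⟩ := exists_kummerFun_mem_selmerSubgroup (NumberField.RingOfIntegers L) hz hA
  have hX : {P : EPoint a b ℚ | P = 0 ∨ g P = 0}.Finite := by
    refine Set.Finite.subset ((Set.finite_singleton 0).union (finite_baseCoords ha hd hδ
      (kummerZero (z ^ 2 + z ^ 3) (algebraMap ℚ L a)))) fun P hP => ?_
    by_cases h0 : P = 0
    · exact .inl h0
    · right
      refine ⟨w P, ?_⟩
      rw [← eq_kummerZero_of_kummerFun_eq_zero hz (hw P h0) (hP.resolve_left h0)]
      exact hvw P h0
  have := hX.to_subtype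
  have hrel := powers_relIndex_selmerSubgroup_ne_zero (NumberField.RingOfIntegers L) L hS
    (n := 5) (by norm_num)
  rw [Subgroup.relIndex] at hrel
  have : ((powMonoidHom 5 : Lˣ →* Lˣ).range.subgroupOf
    (selmerSubgroup (NumberField.RingOfIntegers L) L S 5)).FiniteIndex := ⟨hrel⟩
  -- The finitely many points at which the Kummer value is zero or undefined are kept as labels of
  -- their own in the left summand.
  refine finite_quotient_of_setoid _ (fun P => if hP : P = 0 ∨ g P = 0 then
      (Sum.inl ⟨P, hP⟩ : {P : EPoint a b ℚ | P = 0 ∨ g P = 0} ⊕ _) else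
      Sum.inr (QuotientGroup.mk (s := ((powMonoidHom 5 : Lˣ →* Lˣ).range.subgroupOf
        (selmerSubgroup (NumberField.RingOfIntegers L) L S 5)))
        ⟨Units.mk0 (g P) (fun h => hP (.inr h)),
          hg _ _ _ (hw P fun h => hP (.inl h)) rfl⟩)) fun P Q h => ?_
  by_cases hP : P = 0 ∨ g P = 0
  · by_cases hQ : Q = 0 ∨ g Q = 0
    · rw [dif_pos hP, dif_pos hQ, Sum.inl.injEq, Subtype.mk.injEq] at h
      rw [h, sub_self]
      exact zero_mem _
    · rw [dif_pos hP, dif_neg hQ] at h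
      exact absurd h Sum.inl_ne_inr
  · by_cases hQ : Q = 0 ∨ g Q = 0
    · rw [dif_neg hP, dif_pos hQ] at h
      exact absurd h Sum.inr_ne_inl
    · rw [dif_neg hP, dif_neg hQ, Sum.inr.injEq, eq_comm, QuotientGroup.eq,
        Subgroup.mem_subgroupOf] at h
      push Not at hP hQ
      obtain ⟨t, ht⟩ := h
      have ht' : (t : L) ^ 5 = (g Q)⁻¹ * g P := by
        have := congrArg Units.val ht
        simpa using this
      refine sub_mem_range_of_kummerFun_eq (K := K) ha hd (δ := f δ) (z := f z) (t := f t)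
        (v := f (v P)) (w := f (w P)) (v' := f (v Q)) (w' := f (w Q)) ?_ ?_ ?_ ?_ ?_ ?_ ?_ ?_
      · rw [← map_pow, hδ, f.commutes]
      · simp only [← map_pow, ← map_add, ← map_one f, hz, map_zero]
      · exact (_root_.map_ne_zero f).mpr t.ne_zero
      · exact fun σ h1 h2 => hL σ h1 h2 t
      · have := (hvw P hP.1).map f
        rwa [WeierstrassCurve.Affine.Point.map_baseChange] at this
      · have := (hvw Q hQ.1).map f
        rwa [WeierstrassCurve.Affine.Point.map_baseChange] at this
      · rw [← hfg]
        exact (_root_.map_ne_zero f).mpr hQ.2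
      · rw [← hfg, ← hfg, ← map_pow, ht', ← map_mul]
        congr 1
        have := hQ.2
        field_simp

theorem finite_quotient : Finite (EPoint a b ℚ ⧸ (ratDualIsogeny ha hd).range) := by
  classical
  obtain ⟨δ, hδ⟩ := exists_sqrt (K := AlgebraicClosure ℚ) a b
  obtain ⟨z, hz⟩ := IsAlgClosed.exists_aeval_eq_zero (AlgebraicClosure ℚ)
    (X ^ 4 + X ^ 3 + X ^ 2 + X + 1 : ℚ[X]) (by
      have : (X ^ 4 + X ^ 3 + X ^ 2 + X + 1 : ℚ[X]).degree = 4 := by compute_degree!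
      rw [this]
      norm_num)
  simp only [map_add, map_pow, aeval_X, map_one] at hz
  let L := IntermediateField.adjoin ℚ {δ, z}
  have hδL : δ ∈ L := IntermediateField.subset_adjoin ℚ _ (by simp)
  have hzL : z ∈ L := IntermediateField.subset_adjoin ℚ _ (by simp)
  have hfin : FiniteDimensional ℚ L := by
    refine IntermediateField.finiteDimensional_adjoin fun x _ => ?_
    exact Algebra.IsIntegral.isIntegral x
  have hnum : NumberField L := { to_charZero := algebraRat.charZero L }
  refine @finite_quotient_of_numberField a b ha hd (AlgebraicClosure ℚ) L _ _ _ _ _ _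
    (IntermediateField.algebra' L) _ _ L.val ⟨δ, hδL⟩ ⟨z, hzL⟩ ?_ ?_ ?_
  · exact Subtype.ext hδ
  · exact Subtype.ext hz
  · intro σ h1 h2 t
    have := (mem_fixingSubgroup_adjoin_iff {δ, z} σ).mpr (by
      rintro x (rfl | rfl)
      exacts [h1, h2])
    exact (IntermediateField.mem_fixingSubgroup_iff _ σ).mp this t t.2

end Finiteness

end Brumer

theorem theorem2p1 [DecidableEq (AlgebraicClosure ℚ)] (a b : ℚ) (ha : a ≠ 0)
    (hd : Brumer.d a b ≠ 0) :
    -- over the algebraic closure: `φ*` is an isogeny of degree 5 and is the dual of `φ`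
    (∃ (φ : Brumer.EPoint a b (AlgebraicClosure ℚ) →+ Brumer.EstarPoint a b (AlgebraicClosure ℚ))
      (φs : Brumer.EstarPoint a b (AlgebraicClosure ℚ) →+ Brumer.EPoint a b (AlgebraicClosure ℚ)),
      (∀ R, φs R = Brumer.dualIsogeny ha hd (AlgebraicClosure ℚ) R) ∧
      Nat.card φs.ker = 5 ∧
      (∀ P, φs (φ P) = 5 • P) ∧
      (∀ R, φ (φs R) = 5 • R) ∧
      (∀ (σ : AlgebraicClosure ℚ →ₐ[ℚ] AlgebraicClosure ℚ) (P),
        φ (WeierstrassCurve.Affine.Point.map σ P) =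
          WeierstrassCurve.Affine.Point.map σ (φ P))) ∧
    -- over `ℚ`
    ∃ φs : Brumer.EstarPoint a b ℚ →+ Brumer.EPoint a b ℚ,
      (∀ R, φs R = Brumer.dualIsogeny ha hd ℚ R) ∧
      Finite (Brumer.EPoint a b ℚ ⧸ φs.range) ∧
      (∀ P : Brumer.EPoint a b ℚ, P ≠ 0 →
        (¬ Irreducible (Brumer.quinticAt a b P) ↔ P ∈ φs.range)) ∧
      ∃ Φ : AddSubgroup (Brumer.EPoint a b ℚ ⧸ φs.range) →
          IntermediateField ℚ (AlgebraicClosure ℚ),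
        Set.BijOn Φ {S | Nat.card S = 5}
          {L | ∃ P : Brumer.EPoint a b ℚ, P ∉ φs.range ∧
            L = Brumer.splittingField (Brumer.quinticAt a b P)} ∧
        ∀ P : Brumer.EPoint a b ℚ, P ∉ φs.range →
          Nat.card (AddSubgroup.zmultiples (P : Brumer.EPoint a b ℚ ⧸ φs.range)) = 5 ∧
          Φ (AddSubgroup.zmultiples (P : Brumer.EPoint a b ℚ ⧸ φs.range)) =
            Brumer.splittingField (Brumer.quinticAt a b P) := by
  obtain ⟨φ, h1, h2, h3⟩ := Brumer.exists_isogeny (K := AlgebraicClosure ℚ) ha hd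
  refine ⟨⟨φ, Brumer.dualIsogenyHom (AlgebraicClosure ℚ) ha hd, fun _ => rfl,
    Brumer.card_ker_dualIsogenyHom ha hd, h1, h2, h3⟩, Brumer.ratDualIsogeny ha hd, fun _ => rfl,
    Brumer.finite_quotient ha hd, fun P hP => ⟨fun h => ?_, fun h =>
      Brumer.not_irreducible_quinticAt ha hd hP h⟩, ?_⟩
  · by_contra hn
    exact h (Brumer.irreducible_quinticAt ha hd hn)
  -- The bijection needs only that 5P is always in the image and that equal splitting fields mean
  -- equal cyclic subgroups.
  · refine Brumer.exists_bijOn_of_zmultiples _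
      (fun P => Brumer.splittingField (Brumer.quinticAt a b P)) (fun P => ?_) fun P hP Q hQ =>
        Brumer.adjoin_rootSet_eq_iff (K := AlgebraicClosure ℚ) ha hd hP hQ
    exact Brumer.five_nsmul_mem_range ha hd P
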